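/- Let $N$ be an odd positive integer, let $L$ be a multiple of $N$, and let $s=q^{1/2}$ be a primitive $2N$-th root of unity, so that $q=s^2$ is a primitive $N$-th root of unity and $q^{1/2}$ is its square root with $q^{N/2}=-1$ (for instance $q=e^{2\pi i/N}$, $q^{1/2}=e^{\pi i/N}$). For $p\in\mathbb{C}^*$ with chosen square root $p^{1/2}\neq 0$ and $p^2\neq1$, put $[m]=\frac{p^m-p^{-m}}{p-p^{-1}}$, $[m]!=[1][2]\cdots[m]$, and let $U_p(\mathfrak{sl}_2)$ act on $\mathbb{C}^N$ with basis $v_0,\dots,v_{N-1}$ by $$\hat k^{1/2}v_a=p^{\frac{N-1}{2}-a}v_a,\quad \hat f v_a=[a+1]v_{a+1}\ (\hat f v_{N-1}=0),\quad \hat e v_a=[N-a]v_{a-1}\ (\hat e v_0=0).$$ On $(\mathbb{C}^N)^{\otimes L}$ let $$\mathcal{L}_i(z)=\begin{pmatrix}p^{-1/2}(z\hat k_i^{1/2}-z^{-1}\hat k_i^{-1/2})&(p-p^{-1})\hat f_i\\(p-p^{-1})\hat e_i&p^{1/2}(z\hat k_i^{-1/2}-z^{-1}\hat k_i^{1/2})\end{pmatrix},\qquad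 \mathcal{L}_L(z)\cdots\mathcal{L}_1(z)=\begin{pmatrix}A(z)&B(z)\\C(z)&D(z)\end{pmatrix},$$ where the index $i$ means action on the $i$-th tensor factor, and let $n_\pm(z)=(\pm z^{\pm1})^{L-1}(p-p^{-1})$. Then the following limits exist (the first one for every $p\ne0$), and $$A:=\lim_{z\to\infty}\frac{A(z)}{z^Lp^{-L/2}}=(\hat k^{1/2})^{\otimes L},$$ $$B_\pm:=\lim_{z^{\pm1}\to\infty}\frac{B(z)}{n_\pm(z)}=p^{-\frac{L+1}{2}}\sum_{i=1}^Lp^i(\hat k^{\mp1/2})^{\otimes(i-1)}\otimes\hat f\otimes(\hat k^{\pm1/2})^{\otimes(L-i)},$$ $$C_\pm:=\lim_{z^{\pm1}\to\infty}\frac{C(z)}{n_\pm(z)}=p^{\frac{L+1}{2}}\sum_{i=1}^Lp^{-i}(\hat k^{\pm1/2})^{\otimes(i-1)}\otimes\hat e\otimes(\hat k^{\mp1/2})^{\otimes(L-i)}.$$ The limits $$B_\pm^{(N)}:=\lim_{p^{1/2}\to q^{1/2}}\frac{(B_\pm)^N}{[N]!},\qquad C_\pm^{(N)}:=\lim_{p^{1/2}\to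 q^{1/2}}\frac{(C_\pm)^N}{[N]!}$$ exist. Put $H^{(N)}=\frac1N\sum_{i=1}^L\hat h_i$ with $\hat h=\mathrm{diag}(N-1,N-3,\dots,-N+1)$. Let $V\subseteq(\mathbb{C}^N)^{\otimes L}$ be the sector $A^2=1$, that is, the eigenspace for the eigenvalue $1$ of $A^2$, where $A$ is taken at $p^{1/2}=q^{1/2}$. Let $L(\mathfrak{sl}_2)=\mathbb{C}[t,t^{-1}]\otimes\mathfrak{sl}_2$ with Chevalley generators $E_0=t\otimes f$, $F_0=t^{-1}\otimes e$, $H_0=-1\otimes h$, $E_1=1\otimes e$, $F_1=1\otimes f$, $H_1=1\otimes h$. Then $H^{(N)},B_\pm^{(N)},C_\pm^{(N)}$ map $V$ into itself, and there is a Lie algebra representation $\rho:L(\mathfrak{sl}_2)\to\mathrm{End}(V)$ with $$\rho(H_1)=-\rho(H_0)=H^{(N)}|_V,\quad \rho(E_0)=B_+^{(N)}|_V,\quad\rho(E_1)=C_+^{(N)}|_V,\quad\rho(F_0)=C_-^{(N)}|_V,\quad\rho(F_1)=B_-^{(N)}|_V.$$ Finally, let $Zv_a=q^av_a$ and $Xv_a=v_{a+1}$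 (indices modulo $N$), and for $z\in\mathbb{C}^*$ let $\tau_{\mathrm{NBS}}(z)$ be the trace over $\mathbb{C}^2$ of $\mathcal{L}^{\mathrm{NBS}}_L(z)\cdots\mathcal{L}^{\mathrm{NBS}}_1(z)$, where $$\mathcal{L}^{\mathrm{NBS}}_i(z)=\begin{pmatrix}-zq^{-1}Z_i^{-1}+z^{-1}Z_i&-(Z_i^{-1}-Z_i)X_i\\X_i^{-1}(Z_i^{-1}-Z_i)&z^{-1}Z_i^{-1}-zqZ_i\end{pmatrix}.$$ Then, for every $z\in\mathbb{C}^*$, $\tau_{\mathrm{NBS}}(z)$ maps $V$ into itself and $[\tau_{\mathrm{NBS}}(z)|_V,\rho(x)]=0$ for every $x\in L(\mathfrak{sl}_2)$; in particular, on $V$ it commutes with the images of $H_0,H_1,E_0,E_1,F_0,F_1$. -/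

import Mathlib

open Filter Topology

attribute [local instance 100] LieRing.ofAssociativeRing LieAlgebra.ofAssociativeAlgebra

noncomputable section

namespace NBS

/-! The space `(ℂ^N)^{⊗L}` is written in its standard basis `v_{σ₁} ⊗ ⋯ ⊗ v_{σ_L}`, indexed by
`σ : Fin L → Fin N`. -/

/-- Vectors of `(ℂ^N)^{⊗L}`, by coordinates in the standard basis. -/
abbrev Space (N L : ℕ) : Type := (Fin L → Fin N) → ℂ

/-- Endomorphisms of `ℂ^N`, as matrices in the standard basis. -/
abbrev LocalOp (N : ℕ) : Type := Matrix (Fin N) (Fin N) ℂ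

/-- Endomorphisms of `(ℂ^N)^{⊗L}`, as matrices in the standard basis. -/
abbrev Op (N L : ℕ) : Type := Matrix (Fin L → Fin N) (Fin L → Fin N) ℂ

/-- The operator `M₁ ⊗ ⋯ ⊗ M_L`. -/
def tensorOp {N L : ℕ} (M : Fin L → LocalOp N) : Op N L :=
  Matrix.of fun σ τ => ∏ i, M i (σ i) (τ i)

/-- The operator acting as `M` on the `i`-th tensor factor and as the identity on the others. -/
def siteOp {N L : ℕ} (i : Fin L) (M : LocalOp N) : Op N L :=
  tensorOp fun j => if j = i then M else 1

/-! ### Monodromy matrices -/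

/-- The ordered product `𝓛_L ⋯ 𝓛_2 𝓛_1`, where `𝓛_i` is the local `2 × 2` operator matrix `ℓ`
acting on the `i`-th tensor factor. -/
def monodromy {N : ℕ} (L : ℕ) (ℓ : Matrix (Fin 2) (Fin 2) (LocalOp N)) :
    Matrix (Fin 2) (Fin 2) (Op N L) :=
  (List.ofFn fun i : Fin L => ℓ.map (siteOp i)).reverse.prod

/-! ### The chain at generic `q`

The variable `s` below is the square root `q^{1/2}`, so that `q = s ^ 2`. -/

/-- The `q`-integer `[m] = (q^m - q^{-m}) / (q - q^{-1})`. -/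
def qInt (q : ℂ) (m : ℕ) : ℂ := (q ^ m - q⁻¹ ^ m) / (q - q⁻¹)

/-- The `q`-factorial `[m]! = [1][2]⋯[m]`. -/
def qFact (q : ℂ) (m : ℕ) : ℂ := ∏ i ∈ Finset.range m, qInt q (i + 1)

/-- The power `k^{r/2}` in the `N`-dimensional representation of `U_q(sl₂)`:
`k^{1/2} v_a = q^{(N-1)/2 - a} v_a`. -/
def kHalfPow (N : ℕ) (s : ℂ) (r : ℤ) : LocalOp N :=
  Matrix.diagonal fun a => s ^ (r * ((N : ℤ) - 1 - 2 * (a : ℤ)))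

/-- The generator `f`: `f v_a = [a + 1] v_{a+1}`, and `f v_{N-1} = 0`. -/
def fOp (N : ℕ) (s : ℂ) : LocalOp N :=
  Matrix.of fun b a => if (b : ℕ) = (a : ℕ) + 1 then qInt (s ^ 2) ((a : ℕ) + 1) else 0

/-- The generator `e`: `e v_a = [N - a] v_{a-1}`, and `e v_0 = 0`. -/
def eOp (N : ℕ) (s : ℂ) : LocalOp N :=
  Matrix.of fun b a => if (b : ℕ) + 1 = (a : ℕ) then qInt (s ^ 2) (N - (a : ℕ)) else 0

/-- The local `L`-operator of the XXZ-type chain. -/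
def localXXZ (N : ℕ) (s z : ℂ) : Matrix (Fin 2) (Fin 2) (LocalOp N) :=
  !![s⁻¹ • (z • kHalfPow N s 1 - z⁻¹ • kHalfPow N s (-1)), (s ^ 2 - (s ^ 2)⁻¹) • fOp N s;
     (s ^ 2 - (s ^ 2)⁻¹) • eOp N s, s • (z • kHalfPow N s (-1) - z⁻¹ • kHalfPow N s 1)]

/-- The monodromy matrix `((A(z), B(z)), (C(z), D(z)))` of the XXZ-type chain. -/
def monodromyXXZ (N L : ℕ) (s z : ℂ) : Matrix (Fin 2) (Fin 2) (Op N L) :=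
  monodromy L (localXXZ N s z)

/-- The normalization `n_±(z) = (± z^{±1})^{L-1} (q - q^{-1})`, with `ε = ±1`. -/
def normFactor (L : ℕ) (s : ℂ) (ε : ℤ) (z : ℂ) : ℂ :=
  ((ε : ℂ) * z ^ ε) ^ ((L : ℤ) - 1) * (s ^ 2 - (s ^ 2)⁻¹)

/-- The operator `A = k^{1/2} ⊗ ⋯ ⊗ k^{1/2}`. -/
def opA (N L : ℕ) (s : ℂ) : Op N L := tensorOp fun _ => kHalfPow N s 1

/-- The operators `B_±`, with `ε = ±1`:
`q^{-(L+1)/2} ∑_{i=1}^L q^i (k^{∓1/2})^{⊗(i-1)} ⊗ f ⊗ (k^{±1/2})^{⊗(L-i)}`.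
The index `i : Fin L` starts from `0`. -/
def opB (N L : ℕ) (s : ℂ) (ε : ℤ) : Op N L :=
  ∑ i : Fin L, s ^ (2 * ((i : ℤ) + 1) - ((L : ℤ) + 1)) •
    tensorOp fun j =>
      if j < i then kHalfPow N s (-ε) else if j = i then fOp N s else kHalfPow N s ε

/-- The operators `C_±`, with `ε = ±1`:
`q^{(L+1)/2} ∑_{i=1}^L q^{-i} (k^{±1/2})^{⊗(i-1)} ⊗ e ⊗ (k^{∓1/2})^{⊗(L-i)}`. -/
def opC (N L : ℕ) (s : ℂ) (ε : ℤ) : Op N L :=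
  ∑ i : Fin L, s ^ (((L : ℤ) + 1) - 2 * ((i : ℤ) + 1)) •
    tensorOp fun j =>
      if j < i then kHalfPow N s ε else if j = i then eOp N s else kHalfPow N s (-ε)

/-- `M` is the limit of the divided powers `X(t)^n / [n]!` (at `q = t²`) as `t → s`. -/
def IsDividedPowerLimit {N L : ℕ} (X : ℂ → Op N L) (n : ℕ) (s : ℂ) (M : Op N L) : Prop :=
  Tendsto (fun t => (qFact (t ^ 2) n)⁻¹ • X t ^ n) (𝓝[≠] s) (𝓝 M)

/-- `H^{(n)} = (1/n) ∑_i h_i` with `h = diag(N-1, N-3, …, -N+1)`. -/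
def opH (N L n : ℕ) : Op N L :=
  (n : ℂ)⁻¹ • ∑ i : Fin L,
    siteOp i (Matrix.diagonal fun a : Fin N => (N : ℂ) - 1 - 2 * ((a : ℕ) : ℂ))

/-! ### The nilpotent Bazhanov–Stroganov model -/

/-- `Z v_a = q^a v_a`. -/
def opZ (N : ℕ) (q : ℂ) : LocalOp N := Matrix.diagonal fun a => q ^ (a : ℕ)

/-- `Z^{-1} v_a = q^{-a} v_a`. -/
def opZinv (N : ℕ) (q : ℂ) : LocalOp N := Matrix.diagonal fun a => q⁻¹ ^ (a : ℕ)

/-- `X v_a = v_{a+1}`, indices modulo `N`. -/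
def opX (N : ℕ) : LocalOp N :=
  Matrix.of fun b a => if (b : ℕ) = ((a : ℕ) + 1) % N then 1 else 0

/-- `X^{-1} v_a = v_{a-1}`, indices modulo `N`. -/
def opXinv (N : ℕ) : LocalOp N := (opX N).transpose

/-- The local `L`-operator of the nilpotent Bazhanov–Stroganov model. -/
def localNBS (N : ℕ) (q z : ℂ) : Matrix (Fin 2) (Fin 2) (LocalOp N) :=
  !![-(z * q⁻¹) • opZinv N q + z⁻¹ • opZ N q, -((opZinv N q - opZ N q) * opX N);
     opXinv N * (opZinv N q - opZ N q), z⁻¹ • opZinv N q - (z * q) • opZ N q]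

/-- The transfer matrix `τ_NBS(z)`, the trace over `ℂ²` of the monodromy matrix. -/
def tauNBS (N L : ℕ) (q z : ℂ) : Op N L := (monodromy L (localNBS N q z)).trace

/-- The sector `A² = 1` of `(ℂ^N)^{⊗L}`. -/
def sector (N L : ℕ) (s : ℂ) : Submodule ℂ (Space N L) :=
  Module.End.eigenspace (Matrix.toLin' (opA N L s ^ 2)) 1

/-! ### The loop algebra `L(sl₂) = ℂ[t, t⁻¹] ⊗ sl₂` and its Chevalley generators -/

/-- The Lie algebra `sl₂(ℂ)`. -/
abbrev SL2 : Type := LieAlgebra.SpecialLinear.sl (Fin 2) ℂ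

/-- The loop algebra `L(sl₂)`. -/
abbrev Loop : Type := LieAlgebra.loopAlgebra ℂ ℤ SL2

/-- The element `t^n ⊗ x`. -/
def loopElt (n : ℤ) (x : SL2) : Loop := TensorProduct.tmul ℂ (AddMonoidAlgebra.single n 1) x

/-- `e = ((0, 1), (0, 0))`. -/
def slE : SL2 := LieAlgebra.SpecialLinear.single 0 1 (by decide) 1

/-- `f = ((0, 0), (1, 0))`. -/
def slF : SL2 := LieAlgebra.SpecialLinear.single 1 0 (by decide) 1

/-- `h = ((1, 0), (0, -1))`. -/
def slH : SL2 := LieAlgebra.SpecialLinear.singleSubSingle 0 1 1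

/-- `E_0 = t ⊗ f`, `E_1 = 1 ⊗ e`. -/
def chevE : Fin 2 → Loop := ![loopElt 1 slF, loopElt 0 slE]

/-- `F_0 = t⁻¹ ⊗ e`, `F_1 = 1 ⊗ f`. -/
def chevF : Fin 2 → Loop := ![loopElt (-1) slE, loopElt 0 slF]

/-- `H_0 = -1 ⊗ h`, `H_1 = 1 ⊗ h`. -/
def chevH : Fin 2 → Loop := ![-loopElt 0 slH, loopElt 0 slH]

/-- The endomorphism `T` of the sector is the restriction of the operator `M`;
in particular `M` maps the sector into itself. -/
def IsRestriction {N L : ℕ} {V : Submodule ℂ (Space N L)} (T : Module.End ℂ V) (M : Op N L) :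
    Prop :=
  ∀ v : V, ((T v : V) : Space N L) = M.mulVec (v : Space N L)

end NBS

end

/-! The operators come from quantum affine `sl₂`. For generic `p`, each of `B_±`, `C_±` is a sum
over sites of one local `f` or `e`, dressed on its two sides by opposite powers of `k^{1/2}`. In
commutators of such sums the terms from different sites cancel. Hence `B_+` commutes with `B_-` and
`C_+` with `C_-`, while `[C_∓, B_±]` telescopes to multiplication by `[m]` on vectors of weight `m`
(`chainOp_commutator`, `opC_opB_commutator`).

At `p = q` the summands of `B_±` and `C_±` commute up to a primitive `N`-th root of unity and have
vanishing `N`-th powers, so the `q`-binomial theorem gives `B_±^N = C_±^N = 0`. Since `[N]` has only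
a simple zero at `q`, the divided powers converge (`exists_isDividedPowerLimit`). The sector `A² =
1` is spanned by the vectors of weight divisible by `N`. On it the commutator formula for divided
powers (`dividedPow_commutator`) keeps only its top term in the limit, and that term is `m / N`, the
value of `H^{(N)}` (`IsDividedPowerLimit.commutator`).

These are the Chevalley relations of the loop algebra apart from the Serre relations. The latter
hold automatically because `End V` is finite-dimensional. They make translation by `t` an invertible
operation on systems of generators; its iterates give the images of all `tⁿ ⊗ e` and `tⁿ ⊗ f`, and
the remaining brackets follow by induction (`ChevalleySystem.exists_loopHom`).

For the transfer matrix, the local operators of the two models coincide at `q`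
(`localXXZ_eq_localNBS`). For generic `p` an intertwining relation, proved at one site and
transported along the chain (`monodromy_intertwine`), compares `(A(z) + D(z)) Sⁿ` with `Sⁿ` times
the diagonal entries, for `S` one of `B_±`, `C_±`. At `n = N` the diagonal twists `q^{±N}` become
`1`. The remainder is `[N] S^{N-1}` times an off-diagonal entry and a difference of Cartan elements;
after division by `[N]!` it has a finite limit, and the Cartan difference vanishes on the sector
because `N ∣ L` (`IsDividedPowerLimit.transfer_commute`). Building the representation inside the
centralizer of the transfer matrices gives commutation with its whole image. -/

noncomputable section

namespace NBS

/-! ### Representations of the loop algebra from Chevalley generators -/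

section LoopRep

variable {g : Type*} [LieRing g] [LieAlgebra ℂ g]

/-- The Serre relation holds automatically in a finite-dimensional Lie algebra. -/
theorem serre_of_finiteDimensional [FiniteDimensional ℂ g] {h e f x : g}
    (hef : ⁅e, f⁆ = h) (hhe : ⁅h, e⁆ = (2 : ℂ) • e) (hhf : ⁅h, f⁆ = -((2 : ℂ) • f))
    (hfx : ⁅f, x⁆ = 0) (hhx : ⁅h, x⁆ = -((2 : ℂ) • x)) : ⁅e, ⁅e, ⁅e, x⁆⁆⁆ = 0 := by
  by_cases hx : x = 0
  · simp [hx]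
  by_cases hh : h = 0
  · have he : e = 0 := by
      rw [hh, zero_lie] at hhe
      exact (smul_eq_zero.mp hhe.symm).resolve_left two_ne_zero
    simp [he]
  have t : IsSl2Triple h e f :=
    ⟨hh, hef, by rw [hhe, ofNat_smul_eq_nsmul], by rw [hhf, ofNat_smul_eq_nsmul]⟩
  -- For the opposite triple `(-h, f, e)` the vector `x` is a highest weight vector of weight 2, so
  -- the cube of the lowering operator `ad e` annihilates it.
  have P : t.symm.HasPrimitiveVectorWith x (2 : ℂ) :=
    ⟨hx, by rw [neg_lie, hhx, neg_neg], hfx⟩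
  have := P.pow_toEnd_f_eq_zero_of_eq_nat (n := 2) (by norm_num)
  simpa [pow_succ] using this

/-- Elements `e`, `f`, `f'`, `e'` satisfying the relations of the generators `e`, `f`, `t ⊗ f`,
`t⁻¹ ⊗ e` of the loop algebra, the elements `h`, `t ⊗ h`, `t⁻¹ ⊗ h` being prescribed. -/
@[ext] structure ChevalleySystem (h hp hm : g) where
  e : g
  f : g
  f' : g
  e' : g
  lie_e_f : ⁅e, f⁆ = h
  lie_e'_f' : ⁅e', f'⁆ = h
  lie_e_e' : ⁅e, e'⁆ = 0
  lie_f_f' : ⁅f, f'⁆ = 0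
  lie_e_f' : ⁅e, f'⁆ = hp
  lie_e'_f : ⁅e', f⁆ = hm
  lie_h_e : ⁅h, e⁆ = (2 : ℂ) • e
  lie_h_e' : ⁅h, e'⁆ = (2 : ℂ) • e'
  lie_h_f : ⁅h, f⁆ = -((2 : ℂ) • f)
  lie_h_f' : ⁅h, f'⁆ = -((2 : ℂ) • f')

namespace ChevalleySystem

variable {h hp hm : g}

/-- The symmetry exchanging the two real simple root triples. -/
@[simps] def swap (S : ChevalleySystem h hp hm) : ChevalleySystem h hm hp where
  e := S.e'
  f := S.f'
  f' := S.f
  e' := S.e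
  lie_e_f := S.lie_e'_f'
  lie_e'_f' := S.lie_e_f
  lie_e_e' := by rw [← lie_skew, S.lie_e_e', neg_zero]
  lie_f_f' := by rw [← lie_skew, S.lie_f_f', neg_zero]
  lie_e_f' := S.lie_e'_f
  lie_e'_f := S.lie_e_f'
  lie_h_e := S.lie_h_e'
  lie_h_e' := S.lie_h_e
  lie_h_f := S.lie_h_f'
  lie_h_f' := S.lie_h_f

variable (S : ChevalleySystem h hp hm)

include S

theorem lie_hp_e' : ⁅hp, S.e'⁆ = (2 : ℂ) • S.e := by
  refine (congrArg (⁅·, S.e'⁆) S.lie_e_f').symm.trans ?_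
  rw [lie_lie, S.lie_e_e', lie_zero, sub_zero, ← lie_skew S.f', S.lie_e'_f', lie_neg,
    lie_skew, S.lie_h_e]

theorem lie_hp_f : ⁅hp, S.f⁆ = -((2 : ℂ) • S.f') := by
  refine (congrArg (⁅·, S.f⁆) S.lie_e_f').symm.trans ?_
  rw [lie_lie, S.lie_e_f, ← lie_skew S.f' S.f, S.lie_f_f', neg_zero, lie_zero,
    zero_sub, lie_skew, S.lie_h_f']

theorem lie_hm_e : ⁅hm, S.e⁆ = (2 : ℂ) • S.e' := S.swap.lie_hp_e'

/-- The two contributions cancel because both pairs `(e, f)` and `(e', f')` have the same bracket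
`h`: the central element of the affine algebra acts by zero. -/
theorem lie_hp_hm : ⁅hp, hm⁆ = 0 := by
  rw [← S.lie_e'_f, leibniz_lie, S.lie_hp_e', S.lie_hp_f, smul_lie, lie_neg, lie_smul, S.lie_e_f,
    S.lie_e'_f', add_neg_cancel]

theorem lie_h_hp : ⁅h, hp⁆ = 0 := by
  rw [← S.lie_e_f', leibniz_lie, S.lie_h_e, S.lie_h_f', smul_lie, lie_neg, lie_smul,
    add_neg_cancel]

theorem lie_h_hm : ⁅h, hm⁆ = 0 := S.swap.lie_h_hp

theorem lie_hm_hp_e : ⁅hm, ⁅hp, S.e⁆⁆ = (4 : ℂ) • S.e := by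
  rw [leibniz_lie, ← lie_skew hm hp, S.lie_hp_hm, neg_zero, zero_lie, zero_add, S.lie_hm_e,
    lie_smul, S.lie_hp_e', smul_smul]
  norm_num

theorem lie_lie_hp_e_f : ⁅⁅hp, S.e⁆, S.f⁆ = (2 : ℂ) • hp := by
  rw [lie_lie, S.lie_e_f, ← lie_skew hp h, S.lie_h_hp, S.lie_hp_f, lie_neg, lie_smul, S.lie_e_f']
  simp

theorem lie_e_lie_hm_f : ⁅S.e, ⁅hm, S.f⁆⁆ = -((2 : ℂ) • hm) := by
  rw [leibniz_lie, ← lie_skew S.e hm, S.lie_hm_e, S.lie_e_f, ← lie_skew hm h, S.lie_h_hm, neg_lie,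
    smul_lie, S.lie_e'_f]
  simp

theorem lie_lie_hp_e_lie_hm_f : ⁅⁅hp, S.e⁆, ⁅hm, S.f⁆⁆ = -((4 : ℂ) • h) := by
  rw [leibniz_lie, S.lie_lie_hp_e_f, ← lie_skew _ hm, S.lie_hm_hp_e, neg_lie, smul_lie, S.lie_e_f,
    lie_smul, ← lie_skew, S.lie_hp_hm]
  simp

/-- This is the Serre relation `(ad e)³ f' = 0`, rewritten with `hp = ⁅e, f'⁆`. -/
theorem lie_lie_hp_e_e [FiniteDimensional ℂ g] : ⁅⁅hp, S.e⁆, S.e⁆ = 0 := by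
  have := serre_of_finiteDimensional S.lie_e_f S.lie_h_e S.lie_h_f S.lie_f_f' S.lie_h_f'
  rw [S.lie_e_f'] at this
  rw [← lie_skew, ← lie_skew hp, lie_neg, this]
  simp

theorem lie_lie_hm_f_f [FiniteDimensional ℂ g] : ⁅⁅hm, S.f⁆, S.f⁆ = 0 := by
  have := serre_of_finiteDimensional (h := -h) (e := S.f) (f := S.e) (x := S.e')
    (by rw [← lie_skew, S.lie_e_f]) (by rw [neg_lie, S.lie_h_f, neg_neg])
    (by rw [neg_lie, S.lie_h_e]) S.lie_e_e' (by rw [neg_lie, S.lie_h_e'])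
  rw [← lie_skew S.f S.e', S.lie_e'_f, lie_neg, lie_neg, neg_eq_zero] at this
  rw [← lie_skew, ← lie_skew hm, lie_neg, this]
  simp

/-- Translation of the loop parameter by one step. -/
@[simps] def shift [FiniteDimensional ℂ g] : ChevalleySystem h hp hm where
  e := (2⁻¹ : ℂ) • ⁅hp, S.e⁆
  f := -((2⁻¹ : ℂ) • ⁅hm, S.f⁆)
  f' := S.f
  e' := S.e
  lie_e_f := by
    rw [smul_lie, lie_neg, lie_smul, S.lie_lie_hp_e_lie_hm_f, smul_neg, smul_neg, smul_neg, neg_neg,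
      smul_smul, smul_smul]
    norm_num
  lie_e'_f' := S.lie_e_f
  -- This field and the next are where the Serre relations enter; the others use only the prescribed
  -- brackets.
  lie_e_e' := by rw [smul_lie, S.lie_lie_hp_e_e, smul_zero]
  lie_f_f' := by rw [neg_lie, smul_lie, S.lie_lie_hm_f_f, smul_zero, neg_zero]
  lie_e_f' := by rw [smul_lie, S.lie_lie_hp_e_f, smul_smul]; norm_num
  lie_e'_f := by rw [lie_neg, lie_smul, S.lie_e_lie_hm_f, smul_neg, neg_neg, smul_smul]; norm_num
  lie_h_e := by
    rw [lie_smul, leibniz_lie, S.lie_h_hp, S.lie_h_e, zero_lie, zero_add, lie_smul,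
      smul_comm]
  lie_h_e' := S.lie_h_e
  lie_h_f := by
    rw [lie_neg, lie_smul, leibniz_lie, S.lie_h_hm, S.lie_h_f, zero_lie, zero_add, lie_neg,
      lie_smul, smul_neg, smul_neg, smul_comm]
  lie_h_f' := S.lie_h_f

/-- Conjugation by `swap` inverts `shift`, so translation is bijective and has integer powers. -/
theorem shift_swap_shift [FiniteDimensional ℂ g] : S.shift.swap.shift = S.swap := by
  ext
  · simp only [shift_e, swap_e, shift_e', S.lie_hm_e, smul_smul]
    norm_num
  · simp only [shift_f, swap_f, shift_f', S.lie_hp_f, smul_smul, smul_neg]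
    norm_num
  · rfl
  · rfl

omit S in
/-- Translation as a permutation of the set of all systems. -/
def shiftPerm [FiniteDimensional ℂ g] (h hp hm : g) : Equiv.Perm (ChevalleySystem h hp hm) where
  toFun S := S.shift
  invFun S := S.swap.shift.swap
  left_inv S := congrArg swap S.shift_swap_shift
  right_inv S := S.swap.shift_swap_shift

end ChevalleySystem


/-- Sequences satisfying the relations of `t ^ n ⊗ e` and `t ^ n ⊗ f`, those between adjacent
root vectors only. -/
structure LoopSequence (h hp hm : g) (e f : ℤ → g) : Prop where
  lie_e_succ : ∀ n, ⁅e n, e (n + 1)⁆ = 0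
  lie_f_succ : ∀ n, ⁅f n, f (n + 1)⁆ = 0
  lie_e_f : ∀ n, ⁅e n, f (-n)⁆ = h
  lie_e_f_one : ⁅e 0, f 1⁆ = hp
  lie_e_f_neg_one : ⁅e 0, f (-1)⁆ = hm
  lie_h_e : ∀ n, ⁅h, e n⁆ = (2 : ℂ) • e n
  lie_h_f : ∀ n, ⁅h, f n⁆ = -((2 : ℂ) • f n)
  lie_hp_e : ∀ n, ⁅hp, e n⁆ = (2 : ℂ) • e (n + 1)
  lie_hp_f : ∀ n, ⁅hp, f n⁆ = -((2 : ℂ) • f (n + 1))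
  lie_hm_e : ∀ n, ⁅hm, e n⁆ = (2 : ℂ) • e (n - 1)
  lie_hm_f : ∀ n, ⁅hm, f n⁆ = -((2 : ℂ) • f (n - 1))

theorem ChevalleySystem.exists_loopSequence [FiniteDimensional ℂ g] {h hp hm : g}
    (S : ChevalleySystem h hp hm) :
    ∃ e f : ℤ → g, LoopSequence h hp hm e f ∧ e 0 = S.e ∧ f 0 = S.f ∧ f 1 = S.f' ∧
      e (-1) = S.e' := by
  set s : ℤ → ChevalleySystem h hp hm := fun n => (shiftPerm h hp hm ^ n) S with hs
  have hsucc (n : ℤ) : s (n + 1) = (s n).shift := by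
    simp only [hs, add_comm n 1, zpow_one_add]; rfl
  have hpred (n : ℤ) : s n = (s (n - 1)).shift := by rw [← hsucc, sub_add_cancel]
  have h0 : s 0 = S := rfl
  have he' (n : ℤ) : (s n).e' = (s (n - 1)).e := by rw [hpred n]; rfl
  have hf' (n : ℤ) : (s n).f' = (s (n - 1)).f := by rw [hpred n]; rfl
  -- Translation multiplies `e` by `t` but `f` by `t⁻¹`, hence the opposite signs of the indices.
  refine ⟨fun n => (s n).e, fun n => (s (-n)).f, ⟨fun n => ?_, fun n => ?_, fun n => ?_, ?_, ?_,
    fun n => (s n).lie_h_e, fun n => (s _).lie_h_f, fun n => ?_, fun n => ?_, fun n => ?_,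
    fun n => ?_⟩, rfl, rfl, ?_, ?_⟩
  · have := (s (n + 1)).lie_e_e'
    rw [he', add_sub_cancel_right] at this
    rw [← lie_skew, this, neg_zero]
  · have := (s (-n)).lie_f_f'
    rwa [hf', ← neg_add'] at this
  · simpa using (s n).lie_e_f
  · have := (s 0).lie_e_f'
    rwa [hf'] at this
  · have := (s 1).lie_e'_f
    rwa [he'] at this
  · simp only [hsucc, shift_e, smul_smul]; norm_num
  · have := (s (-n)).lie_hp_f
    rwa [hf', ← neg_add'] at this
  · simpa only [he'] using (s n).lie_hm_e
  · have h1 := hsucc (-n)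
    rw [show -(n - 1) = -n + 1 by ring, h1]
    simp only [shift_f, smul_neg, neg_neg, smul_smul]
    norm_num
  · exact (hf' 0).symm
  · exact (he' 0).symm

/-! ### From brackets of adjacent root vectors to all brackets of the loop algebra. -/

namespace LoopSequence

variable {h hp hm : g} {e f : ℤ → g}

theorem reverse (Q : LoopSequence h hp hm e f) :
    LoopSequence h hm hp (fun n => e (-n)) (fun n => f (-n)) where
  lie_e_succ n := by
    have := Q.lie_e_succ (-(n + 1))
    rw [neg_add, neg_add_cancel_right] at this
    rw [← lie_skew, neg_add, this, neg_zero]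
  lie_f_succ n := by
    have := Q.lie_f_succ (-(n + 1))
    rw [neg_add, neg_add_cancel_right] at this
    rw [← lie_skew, neg_add, this, neg_zero]
  lie_e_f n := Q.lie_e_f (-n)
  lie_e_f_one := Q.lie_e_f_neg_one
  lie_e_f_neg_one := Q.lie_e_f_one
  lie_h_e n := Q.lie_h_e _
  lie_h_f n := Q.lie_h_f _
  lie_hp_e n := by rw [Q.lie_hm_e, neg_add']
  lie_hp_f n := by rw [Q.lie_hm_f, neg_add']
  lie_hm_e n := by rw [Q.lie_hp_e, neg_sub', sub_neg_eq_add]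
  lie_hm_f n := by rw [Q.lie_hp_f, neg_sub', sub_neg_eq_add]

/-- Induction on the degree `k` of the Cartan element `H = ⁅e 0, f k⁆`. The brackets `⁅e m, f (k + 1
- m)⁆` form an arithmetic progression in `m` whose difference is half of `⁅hp, H⁆`. Computing `⁅H,
hp⁆` a second time shows that this difference is zero, so the brackets do not depend on `m`.
Choosing `m` suitably then gives the action on each root vector from the adjacent commutations. -/
theorem nonneg_relations (Q : LoopSequence h hp hm e f) (k : ℕ) :
    (∀ m, ⁅e m, f (k - m)⁆ = ⁅e 0, f k⁆) ∧
    (∀ n, ⁅⁅e 0, f k⁆, e n⁆ = (2 : ℂ) • e (n + k)) ∧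
    (∀ n, ⁅⁅e 0, f k⁆, f n⁆ = -((2 : ℂ) • f (n + k))) := by
  induction k with
  | zero =>
    have h0 : ⁅e 0, f 0⁆ = h := Q.lie_e_f 0
    refine ⟨fun m => ?_, fun n => ?_, fun n => ?_⟩
    · simp only [Nat.cast_zero, zero_sub, Q.lie_e_f, h0]
    · simp only [Nat.cast_zero, h0, Q.lie_h_e, add_zero]
    · simp only [Nat.cast_zero, h0, Q.lie_h_f, add_zero]
  | succ k ih =>
    obtain ⟨h1, h2, h3⟩ := ih
    set H := ⁅e 0, f k⁆
    set x : ℤ → g := fun m => ⁅e m, f (k + 1 - m)⁆ with hx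
    have hstep (m : ℤ) : (2 : ℂ) • (x (m + 1) - x m) = ⁅hp, H⁆ := by
      have h4 : x (m + 1) = ⁅e (m + 1), f (k - m)⁆ := by simp only [hx]; congr 2; ring
      have h5 : x m = ⁅e m, f (k - m + 1)⁆ := by simp only [hx]; congr 2; ring
      rw [← h1 m, leibniz_lie, Q.lie_hp_e, Q.lie_hp_f, smul_lie, lie_neg, lie_smul, smul_sub, h4,
        h5, sub_eq_add_neg]
    have hsum (m : ℕ) : (2 : ℂ) • (x m - x 0) = (m : ℂ) • ⁅hp, H⁆ := by
      induction m with
      | zero => simp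
      | succ m ihm =>
        have : x ((m + 1 : ℕ) : ℤ) - x 0 = (x (m + 1) - x m) + (x m - x 0) := by push_cast; abel
        rw [this, smul_add, ihm, hstep]
        push_cast
        rw [add_smul, one_smul, add_comm]
    have hzero : ⁅hp, H⁆ = 0 := by
      -- Writing `hp = ⁅e 0, f 1⁆` and applying `H` gives `2 (x k - x 0)`, which is `k` steps of the
      -- progression. Antisymmetry then yields `(k + 1) ⁅hp, H⁆ = 0`.
      have key : ⁅H, hp⁆ = (k : ℂ) • ⁅hp, H⁆ := by
        rw [← hsum, ← Q.lie_e_f_one, leibniz_lie, h2, h3, smul_lie, lie_neg, lie_smul, smul_sub,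
          hx, sub_eq_add_neg]
        simp only
        congr 5 <;> ring_nf
      have : ((k : ℂ) + 1) • ⁅hp, H⁆ = 0 := by
        rw [add_smul, one_smul, ← key, ← lie_skew, add_comm, add_neg_cancel]
      exact (smul_eq_zero.mp this).resolve_left (Nat.cast_add_one_ne_zero k)
    have hsucc (m : ℤ) : x (m + 1) = x m := by
      have := hstep m
      rw [hzero] at this
      exact sub_eq_zero.mp ((smul_eq_zero.mp this).resolve_left two_ne_zero)
    have hconst (m : ℤ) : x m = x 0 := by
      induction m with
      | zero => rfl
      | succ i hi => rw [hsucc, hi]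
      | pred i hi => rw [← hi, ← hsucc (-(i : ℤ) - 1), sub_add_cancel]
    have hx0 : ⁅e 0, f ((k + 1 : ℕ) : ℤ)⁆ = x 0 := by simp [hx]
    refine ⟨fun m => ?_, fun n => ?_, fun n => ?_⟩
    · rw [hx0, ← hconst m]; simp [hx]
    · have h5 : x (n + 1) = ⁅e (n + 1), f (k - n)⁆ := by simp only [hx]; congr 2; ring
      rw [hx0, ← hconst (n + 1), h5, lie_lie, ← lie_skew (e (n + 1)) (e n), Q.lie_e_succ, neg_zero,
        lie_zero, sub_zero, ← lie_skew (f _) (e n), h1, lie_neg, lie_skew, h2]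
      congr 2; push_cast; ring
    · have h5 : x (k - n) = ⁅e (k - n), f (n + 1)⁆ := by simp only [hx]; congr 2; ring
      have h6 : ⁅e (k - n), f n⁆ = H := by rw [← h1 (k - n)]; congr 2; ring
      rw [hx0, ← hconst (k - n), h5, lie_lie, ← lie_skew (f (n + 1)) (f n), Q.lie_f_succ, neg_zero,
        lie_zero, zero_sub, h6, lie_skew, h3]
      congr 3; push_cast; ring

theorem relations (Q : LoopSequence h hp hm e f) (k : ℤ) :
    (∀ m, ⁅e m, f (k - m)⁆ = ⁅e 0, f k⁆) ∧
    (∀ n, ⁅⁅e 0, f k⁆, e n⁆ = (2 : ℂ) • e (n + k)) ∧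
    (∀ n, ⁅⁅e 0, f k⁆, f n⁆ = -((2 : ℂ) • f (n + k))) := by
  obtain ⟨j, rfl | rfl⟩ := k.eq_nat_or_neg
  · exact Q.nonneg_relations j
  · obtain ⟨h1, h2, h3⟩ := Q.reverse.nonneg_relations j
    simp only [neg_zero] at h1 h2 h3
    refine ⟨fun m => ?_, fun n => ?_, fun n => ?_⟩
    · rw [← h1 (-m), neg_neg]; congr 2; ring
    · have := h2 (-n)
      rwa [neg_neg, neg_add, neg_neg] at this
    · have := h3 (-n)
      rwa [neg_neg, neg_add, neg_neg] at this

theorem lie_e_f_eq (Q : LoopSequence h hp hm e f) (m n : ℤ) :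
    ⁅e m, f n⁆ = ⁅e 0, f (m + n)⁆ := by
  rw [← (Q.relations (m + n)).1 m, add_sub_cancel_left]

theorem lie_cartan (Q : LoopSequence h hp hm e f) (m n : ℤ) :
    ⁅⁅e 0, f m⁆, ⁅e 0, f n⁆⁆ = 0 := by
  rw [leibniz_lie, (Q.relations m).2.1, (Q.relations m).2.2, smul_lie, lie_neg, lie_smul,
    Q.lie_e_f_eq, zero_add, add_comm n m, add_neg_cancel]

/-- Induction on the distance of the indices, two steps at a time. Applying the Cartan element of
degree `d + 1` to `⁅e n, e (n + 1)⁆ = 0` produces one bracket at distance `d` and one at distance `d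
+ 2`. -/
theorem lie_e_e (Q : LoopSequence h hp hm e f) (m n : ℤ) : ⁅e m, e n⁆ = 0 := by
  have key (d : ℕ) : ∀ n : ℤ, ⁅e n, e (n + d)⁆ = 0 := by
    induction d using Nat.twoStepInduction with
    | zero => simp
    | one => simpa using Q.lie_e_succ
    | more d ih _ =>
      intro n
      have h1 := congrArg (⁅⁅e 0, f (d + 1)⁆, ·⁆) (Q.lie_e_succ n)
      simp only [lie_zero] at h1
      rw [leibniz_lie, (Q.relations _).2.1, (Q.relations _).2.1, smul_lie, lie_smul, ← smul_add]
        at h1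
      have h2 := ih (n + 1)
      rw [← lie_skew, neg_eq_zero, add_assoc, add_comm 1 (d : ℤ)] at h2
      have h3 := (smul_eq_zero.mp h1).resolve_left two_ne_zero
      rw [h2, zero_add] at h3
      rw [← h3]
      congr 2
      push_cast
      ring
  rcases le_total m n with hmn | hmn
  · obtain ⟨d, rfl⟩ := Int.exists_add_of_le hmn
    exact key d m
  · obtain ⟨d, rfl⟩ := Int.exists_add_of_le hmn
    rw [← lie_skew, key, neg_zero]

theorem lie_f_f (Q : LoopSequence h hp hm e f) (m n : ℤ) : ⁅f m, f n⁆ = 0 := by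
  have key (d : ℕ) : ∀ n : ℤ, ⁅f n, f (n + d)⁆ = 0 := by
    induction d using Nat.twoStepInduction with
    | zero => simp
    | one => simpa using Q.lie_f_succ
    | more d ih _ =>
      intro n
      have h1 := congrArg (⁅⁅e 0, f (d + 1)⁆, ·⁆) (Q.lie_f_succ n)
      simp only [lie_zero] at h1
      rw [leibniz_lie, (Q.relations _).2.2, (Q.relations _).2.2, neg_lie, lie_neg, smul_lie,
        lie_smul, ← neg_add, ← smul_add, neg_eq_zero] at h1
      have h2 := ih (n + 1)
      rw [← lie_skew, neg_eq_zero, add_assoc, add_comm 1 (d : ℤ)] at h2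
      have h3 := (smul_eq_zero.mp h1).resolve_left two_ne_zero
      rw [h2, zero_add] at h3
      rw [← h3]
      congr 2
      push_cast
      ring
  rcases le_total m n with hmn | hmn
  · obtain ⟨d, rfl⟩ := Int.exists_add_of_le hmn
    exact key d m
  · obtain ⟨d, rfl⟩ := Int.exists_add_of_le hmn
    rw [← lie_skew, key, neg_zero]

end LoopSequence

/-- The image of `t ^ n ⊗ x`, as a linear function of `x`. -/
def loopComponent (e f : ℤ → g) (n : ℤ) : SL2 →ₗ[ℂ] g where
  toFun x := x.1 0 1 • e n + x.1 1 0 • f n + x.1 0 0 • ⁅e 0, f n⁆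
  map_add' x y := by
    change (x.1 0 1 + y.1 0 1) • e n + (x.1 1 0 + y.1 1 0) • f n + (x.1 0 0 + y.1 0 0) • _ = _
    module
  map_smul' c x := by
    change (c * x.1 0 1) • e n + (c * x.1 1 0) • f n + (c * x.1 0 0) • _ = c • _
    module

theorem SL2.apply_one_one (x : SL2) : x.1 1 1 = -x.1 0 0 := by
  have h : Matrix.trace x.1 = 0 := x.2
  rw [Matrix.trace_fin_two] at h
  linear_combination h

theorem loopComponent_lie {h hp hm : g} {e f : ℤ → g} (Q : LoopSequence h hp hm e f) (m n : ℤ)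
    (x y : SL2) :
    ⁅loopComponent e f m x, loopComponent e f n y⁆ = loopComponent e f (m + n) ⁅x, y⁆ := by
  have hfe : ⁅f m, e n⁆ = -⁅e 0, f (m + n)⁆ := by
    rw [← lie_skew, Q.lie_e_f_eq, add_comm]
  have heh : ⁅e m, ⁅e 0, f n⁆⁆ = -((2 : ℂ) • e (m + n)) := by
    rw [← lie_skew, (Q.relations n).2.1]
  have hfh : ⁅f m, ⁅e 0, f n⁆⁆ = (2 : ℂ) • f (m + n) := by
    rw [← lie_skew, (Q.relations n).2.2, neg_neg]
  have hhe := (Q.relations m).2.1 n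
  have hhf := (Q.relations m).2.2 n
  rw [add_comm n m] at hhe hhf
  simp only [loopComponent, LinearMap.coe_mk, AddHom.coe_mk, LieAlgebra.SpecialLinear.sl_bracket,
    Matrix.sub_apply, Matrix.mul_apply, Fin.sum_univ_two, SL2.apply_one_one, add_lie, lie_add,
    smul_lie, lie_smul, Q.lie_e_e, Q.lie_f_f, Q.lie_e_f_eq m n, hfe, heh, hfh, hhe, hhf, Q.lie_cartan]
  module

/-- The Lie algebra homomorphism from the loop algebra attached to a loop sequence. -/
def LoopSequence.toHom {h hp hm : g} {e f : ℤ → g} (Q : LoopSequence h hp hm e f) :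
    Loop →ₗ⁅ℂ⁆ g where
  toLinearMap := Finsupp.lsum ℂ (loopComponent e f) ∘ₗ
    (LieAlgebra.LoopAlgebra.toFinsupp ℂ ℤ SL2).toLinearMap
  map_lie' {x y} := by
    set φ : Loop →ₗ[ℂ] g := Finsupp.lsum ℂ (loopComponent e f) ∘ₗ
      (LieAlgebra.LoopAlgebra.toFinsupp ℂ ℤ SL2).toLinearMap with hφ
    have hsingle (n : ℤ) (a : SL2) : φ ((LieAlgebra.LoopAlgebra.toFinsupp ℂ ℤ SL2).symm
        (Finsupp.single n a)) = loopComponent e f n a := by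
      simp [hφ, -LieAlgebra.LoopAlgebra.toFinsupp_symm_single]
    change φ _ = ⁅φ _, φ _⁆
    obtain ⟨x, rfl⟩ := (LieAlgebra.LoopAlgebra.toFinsupp ℂ ℤ SL2).symm.surjective x
    obtain ⟨y, rfl⟩ := (LieAlgebra.LoopAlgebra.toFinsupp ℂ ℤ SL2).symm.surjective y
    induction x using Finsupp.induction_linear with
    | zero => simp only [map_zero, zero_lie]
    | add x₁ x₂ h₁ h₂ => simp only [map_add, add_lie, h₁, h₂]
    | single m a =>
      induction y using Finsupp.induction_linear with
      | zero => simp only [map_zero, lie_zero]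
      | add y₁ y₂ h₁ h₂ => simp only [map_add, lie_add, h₁, h₂]
      | single n b =>
        rw [hsingle, hsingle, loopComponent_lie Q, ← hsingle]
        congr 1
        simp only [LieAlgebra.LoopAlgebra.toFinsupp_symm_single,
          LieAlgebra.ExtendScalars.bracket_tmul, AddMonoidAlgebra.single_mul_single, one_mul]

theorem LoopSequence.toHom_loopElt {h hp hm : g} {e f : ℤ → g} (Q : LoopSequence h hp hm e f)
    (n : ℤ) (x : SL2) : Q.toHom (loopElt n x) = loopComponent e f n x := by
  change (Finsupp.lsum ℂ (loopComponent e f)) (LieAlgebra.LoopAlgebra.toFinsupp ℂ ℤ SL2 _) = _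
  rw [loopElt, LieAlgebra.LoopAlgebra.toFinsupp_single_tmul]
  simp

/-- In finite dimension, the Chevalley relations of the loop algebra other than the Serre relations
suffice to define a homomorphism from the loop algebra. -/
theorem ChevalleySystem.exists_loopHom [FiniteDimensional ℂ g] {h hp hm : g}
    (S : ChevalleySystem h hp hm) :
    ∃ ρ : Loop →ₗ⁅ℂ⁆ g, ρ (chevH 0) = -h ∧ ρ (chevH 1) = h ∧ ρ (chevE 0) = S.f' ∧
      ρ (chevE 1) = S.e ∧ ρ (chevF 0) = S.e' ∧ ρ (chevF 1) = S.f := by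
  obtain ⟨e, f, Q, h1, h2, h3, h4⟩ := S.exists_loopSequence
  have hH : loopComponent e f 0 slH = h := by
    have : ⁅e 0, f 0⁆ = h := Q.lie_e_f 0
    simp [loopComponent, slH, LieAlgebra.SpecialLinear.val_singleSubSingle, this]
  have hE (n : ℤ) : loopComponent e f n slE = e n := by
    simp [loopComponent, slE, LieAlgebra.SpecialLinear.val_single]
  have hF (n : ℤ) : loopComponent e f n slF = f n := by
    simp [loopComponent, slF, LieAlgebra.SpecialLinear.val_single]
  refine ⟨Q.toHom, ?_, ?_, ?_, ?_, ?_, ?_⟩ <;>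
    simp [chevH, chevE, chevF, Q.toHom_loopElt, hH, hE, hF, h1, h2, h3, h4]

end LoopRep

/-! ### Operators on tensor products -/

section TensorOp

variable {N L : ℕ}

theorem tensorOp_apply (M : Fin L → LocalOp N) (σ τ : Fin L → Fin N) :
    tensorOp M σ τ = ∏ i, M i (σ i) (τ i) := rfl

theorem tensorOp_mul (M M' : Fin L → LocalOp N) :
    tensorOp M * tensorOp M' = tensorOp fun i => M i * M' i := by
  ext σ τ
  simp only [Matrix.mul_apply, tensorOp_apply, ← Finset.prod_mul_distrib]
  rw [Finset.prod_univ_sum, Fintype.piFinset_univ]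

theorem tensorOp_one : tensorOp (fun _ : Fin L => (1 : LocalOp N)) = 1 := by
  ext σ τ
  rw [tensorOp_apply, Matrix.one_apply]
  split_ifs with h
  · exact Finset.prod_eq_one fun i _ => by rw [h]; exact Matrix.one_apply_eq _
  · obtain ⟨i, hi⟩ := Function.ne_iff.mp h
    exact Finset.prod_eq_zero (Finset.mem_univ i) (Matrix.one_apply_ne hi)

theorem tensorOp_pow (M : Fin L → LocalOp N) (n : ℕ) :
    tensorOp M ^ n = tensorOp fun i => M i ^ n := by
  induction n with
  | zero => simp only [pow_zero, tensorOp_one]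
  | succ n ih => simp only [pow_succ, ih, tensorOp_mul]

theorem tensorOp_smul (c : Fin L → ℂ) (M : Fin L → LocalOp N) :
    tensorOp (fun i => c i • M i) = (∏ i, c i) • tensorOp M := by
  ext σ τ
  simp only [tensorOp_apply, Matrix.smul_apply, smul_eq_mul, Finset.prod_mul_distrib]

theorem tensorOp_diagonal (d : Fin L → Fin N → ℂ) :
    tensorOp (fun i => Matrix.diagonal (d i)) = Matrix.diagonal fun σ => ∏ i, d i (σ i) := by
  ext σ τ
  rw [tensorOp_apply, Matrix.diagonal_apply]
  split_ifs with h
  · simp [h]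
  · obtain ⟨i, hi⟩ := Function.ne_iff.mp h
    exact Finset.prod_eq_zero (Finset.mem_univ i) (Matrix.diagonal_apply_ne _ hi)

/-- The operator `⊗ M_i` as a linear function of the factor at site `j`. -/
def tensorAt (M : Fin L → LocalOp N) (j : Fin L) : LocalOp N →ₗ[ℂ] Op N L where
  toFun A := tensorOp (Function.update M j A)
  map_add' A B := by
    ext σ τ
    simp only [Matrix.add_apply, tensorOp_apply]
    rw [← Finset.mul_prod_erase _ _ (Finset.mem_univ j),
      ← Finset.mul_prod_erase _ _ (Finset.mem_univ j),
      ← Finset.mul_prod_erase _ _ (Finset.mem_univ j)]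
    simp only [Function.update_self, Matrix.add_apply, add_mul]
    congr 2 <;> refine Finset.prod_congr rfl fun i hi => ?_ <;>
      simp only [Function.update_of_ne (Finset.ne_of_mem_erase hi)]
  map_smul' c A := by
    ext σ τ
    simp only [Matrix.smul_apply, tensorOp_apply, RingHom.id_apply]
    rw [← Finset.mul_prod_erase _ _ (Finset.mem_univ j),
      ← Finset.mul_prod_erase _ _ (Finset.mem_univ j)]
    simp only [Function.update_self, Matrix.smul_apply, smul_eq_mul, mul_assoc]
    congr 2
    refine Finset.prod_congr rfl fun i hi => ?_
    simp only [Function.update_of_ne (Finset.ne_of_mem_erase hi)]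

theorem tensorAt_apply (M : Fin L → LocalOp N) (j : Fin L) (A : LocalOp N) :
    tensorAt M j A = tensorOp (Function.update M j A) := rfl

theorem tensorAt_self (M : Fin L → LocalOp N) (j : Fin L) : tensorAt M j (M j) = tensorOp M := by
  rw [tensorAt_apply, Function.update_eq_self]

theorem siteOp_eq_tensorAt (j : Fin L) : siteOp (N := N) j = tensorAt 1 j := by
  funext A
  rw [tensorAt_apply, siteOp]
  congr 1
  funext i
  rw [Function.update_apply, Pi.one_apply]

theorem siteOp_mul_tensorAt (M : Fin L → LocalOp N) (j : Fin L) (A B : LocalOp N) :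
    siteOp j A * tensorAt M j B = tensorAt M j (A * B) := by
  rw [tensorAt_apply, tensorAt_apply, siteOp, tensorOp_mul]
  congr 1
  funext i
  by_cases h : i = j
  · subst h; simp
  · simp [h]

theorem tensorAt_mul_siteOp (M : Fin L → LocalOp N) (j : Fin L) (A B : LocalOp N) :
    tensorAt M j A * siteOp j B = tensorAt M j (A * B) := by
  rw [tensorAt_apply, tensorAt_apply, siteOp, tensorOp_mul]
  congr 1
  funext i
  by_cases h : i = j
  · subst h; simp
  · simp [h]

end TensorOp

/-! ### Sums over sites of one local operator dressed on both sides, and their commutators. -/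

section ChainOp

variable {N L : ℕ}

/-- The factors of `u ⊗ ⋯ ⊗ u ⊗ x ⊗ w ⊗ ⋯ ⊗ w`, with `x` at site `i`. -/
def chainFactor (i : Fin L) (u x w : LocalOp N) (j : Fin L) : LocalOp N :=
  if j < i then u else if j = i then x else w

/-- The operator `∑ c_i u ⊗ ⋯ ⊗ u ⊗ x ⊗ w ⊗ ⋯ ⊗ w`, with `x` at site `i`. -/
def chainOp (c : Fin L → ℂ) (u x w : LocalOp N) : Op N L :=
  ∑ i, c i • tensorOp (chainFactor i u x w)

theorem chainFactor_mul (i : Fin L) (u x w u' x' w' : LocalOp N) (j : Fin L) :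
    chainFactor i u x w j * chainFactor i u' x' w' j =
      chainFactor i (u * u') (x * x') (w * w') j := by
  unfold chainFactor
  split_ifs <;> rfl

theorem chainFactor_self (i : Fin L) (u x w : LocalOp N) : chainFactor i u x w i = x := by
  simp [chainFactor]

theorem update_chainFactor (i : Fin L) (u x y w : LocalOp N) :
    Function.update (chainFactor i u x w) i y = chainFactor i u y w := by
  funext j
  by_cases h : j = i
  · subst h; simp [chainFactor]
  · simp [chainFactor, h]

theorem tensorOp_chainFactor_eq_tensorAt (i : Fin L) (u x y w : LocalOp N) :
    tensorOp (chainFactor i u x w) = tensorAt (chainFactor i u y w) i x := by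
  rw [tensorAt_apply, update_chainFactor]

theorem tensorOp_chainFactor_sub (i : Fin L) (u x y w : LocalOp N) :
    tensorOp (chainFactor i u x w) - tensorOp (chainFactor i u y w) =
      tensorOp (chainFactor i u (x - y) w) := by
  rw [tensorOp_chainFactor_eq_tensorAt i u x 0 w, tensorOp_chainFactor_eq_tensorAt i u y 0 w,
    tensorOp_chainFactor_eq_tensorAt i u (x - y) 0 w, map_sub]

theorem tensorOp_chainFactor_smul (i : Fin L) (u x w : LocalOp N) (a : ℂ) :
    tensorOp (chainFactor i u (a • x) w) = a • tensorOp (chainFactor i u x w) := by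
  rw [tensorOp_chainFactor_eq_tensorAt i u x 0 w, tensorOp_chainFactor_eq_tensorAt i u (a • x) 0 w,
    map_smul]

/-- Two tensor products agree when their factors agree up to scalars concentrated at two sites and
inverse to each other. -/
theorem tensorOp_eq_of_two_sites {M M' : Fin L → LocalOp N} {i j : Fin L} (hij : i ≠ j) {a : ℂ}
    {P Q : LocalOp N}
    (hi : M' i = a • M i) (hj : M j = a • P) (hj' : M' j = P)
    (h : ∀ k, k ≠ i → k ≠ j → M k = M' k) (hQ : M i = Q) : tensorOp M = tensorOp M' := by
  have h1 : tensorOp M = a • tensorOp (Function.update M j P) := by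
    rw [← tensorAt_self M j, hj, map_smul, tensorAt_apply]
  have h2 : tensorOp M' = a • tensorOp (Function.update M' i (M i)) := by
    rw [← tensorAt_self M' i, hi, map_smul, tensorAt_apply]
  rw [h1, h2]
  congr 2
  funext k
  by_cases hki : k = i
  · subst hki; simp [hij]
  · by_cases hkj : k = j
    · subst hkj; simp [hki, hj']
    · simp [hki, hkj, h k hki hkj]

/-- Comparing the two orders, the factors differ only at sites `i` and `j`. The scalar `a` appears
at site `i` in one order and at site `j` in the other, so the products agree. -/
theorem chain_cross_comm {u x w u' x' w' : LocalOp N} {a : ℂ} {i j : Fin L} (hij : i < j)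
    (huu : Commute u u') (hwu : Commute w u') (hww : Commute w w')
    (hx : u' * x = a • (x * u')) (hx' : w * x' = a • (x' * w)) :
    tensorOp (chainFactor i u x w) * tensorOp (chainFactor j u' x' w') =
      tensorOp (chainFactor j u' x' w') * tensorOp (chainFactor i u x w) := by
  rw [tensorOp_mul, tensorOp_mul]
  refine tensorOp_eq_of_two_sites (i := i) (j := j) (a := a) (P := x' * w) hij.ne ?_ ?_ ?_ ?_ rfl
  · simp [chainFactor, hij, hx]
  · simp [chainFactor, hij.ne', hij.not_gt, hx']
  · simp [chainFactor, hij.ne', hij.not_gt]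
  · intro k hki hkj
    unfold chainFactor
    by_cases h1 : k < i
    · simp [h1, h1.trans hij, huu.eq]
    · by_cases h2 : k < j
      · simp [h1, h2, hki, hwu.eq]
      · simp [h1, h2, hki, hkj, hww.eq]

/-- All terms with insertions at different sites cancel by `chain_cross_comm`, with `a` for one
ordering of the sites and `b` for the other; only the diagonal of the double sum remains. -/
theorem chainOp_commutator {c c' : Fin L → ℂ} {u x w u' x' w' : LocalOp N} {a b : ℂ}
    (huu : Commute u u') (hwu : Commute w u') (huw : Commute u w') (hww : Commute w w')
    (h1 : u' * x = a • (x * u')) (h2 : w * x' = a • (x' * w))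
    (h3 : u * x' = b • (x' * u)) (h4 : w' * x = b • (x * w')) :
    chainOp c u x w * chainOp c' u' x' w' - chainOp c' u' x' w' * chainOp c u x w =
      ∑ i, (c i * c' i) • tensorOp (chainFactor i (u * u') (x * x' - x' * x) (w * w')) := by
  have key (i j : Fin L) : (c i • tensorOp (chainFactor i u x w)) *
      (c' j • tensorOp (chainFactor j u' x' w')) - (c' j • tensorOp (chainFactor j u' x' w')) *
      (c i • tensorOp (chainFactor i u x w)) =
      if i = j then (c i * c' i) • tensorOp (chainFactor i (u * u') (x * x' - x' * x) (w * w'))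
        else 0 := by
    rw [smul_mul_smul_comm, smul_mul_smul_comm, mul_comm (c' j), ← smul_sub]
    split_ifs with h
    · subst h
      rw [tensorOp_mul, tensorOp_mul, ← tensorOp_chainFactor_sub]
      congr 3
      · funext j; rw [chainFactor_mul]
      · funext j; rw [chainFactor_mul, huu.eq, hww.eq]
    · rcases lt_or_gt_of_ne h with h | h
      · rw [chain_cross_comm h huu hwu hww h1 h2, sub_self, smul_zero]
      · rw [chain_cross_comm h huu.symm huw.symm hww.symm h3 h4, sub_self, smul_zero]
  simp only [chainOp, Finset.sum_mul_sum]
  rw [Finset.sum_comm (s := (Finset.univ : Finset (Fin L))) (t := Finset.univ)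
    (f := fun i j => (c' i • tensorOp (chainFactor i u' x' w')) *
      (c j • tensorOp (chainFactor j u x w))), ← Finset.sum_sub_distrib]
  refine Finset.sum_congr rfl fun i _ => ?_
  rw [← Finset.sum_sub_distrib, Finset.sum_congr rfl fun j _ => key i j]
  simp

theorem tensorOp_mul_chainOp {c : Fin L → ℂ} {k u x w : LocalOp N} {a : ℂ}
    (hu : Commute k u) (hx : k * x = a • (x * k)) (hw : Commute k w) :
    tensorOp (fun _ => k) * chainOp c u x w = a • (chainOp c u x w * tensorOp fun _ => k) := by
  simp only [chainOp, Finset.mul_sum, Finset.sum_mul, Finset.smul_sum]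
  refine Finset.sum_congr rfl fun i _ => ?_
  rw [mul_smul_comm, smul_mul_assoc, smul_comm a, tensorOp_mul, tensorOp_mul]
  congr 1
  have h1 : (fun j => k * chainFactor i u x w j) = chainFactor i (k * u) (a • (x * k)) (k * w) := by
    funext j; unfold chainFactor; split_ifs <;> simp [hx]
  have h2 : (fun j => chainFactor i u x w j * k) = chainFactor i (k * u) (x * k) (k * w) := by
    funext j; unfold chainFactor; split_ifs <;> simp [hu.eq, hw.eq]
  rw [h1, h2, tensorOp_chainFactor_smul]

/-- The telescoping sum `∑_i u ⊗ ⋯ ⊗ u ⊗ (w - u) ⊗ w ⊗ ⋯ ⊗ w`. -/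
theorem sum_tensorOp_chainFactor_sub (u w : LocalOp N) :
    ∑ i : Fin L, tensorOp (chainFactor i u (w - u) w) =
      tensorOp (fun _ => w) - tensorOp fun _ => u := by
  set G : ℕ → Op N L := fun m => tensorOp fun j : Fin L => if (j : ℕ) < m then u else w with hG
  have h (i : Fin L) : tensorOp (chainFactor i u (w - u) w) = G i - G (i + 1) := by
    rw [← tensorOp_chainFactor_sub]
    congr 1
    · congr 1; funext j; unfold chainFactor
      rcases lt_trichotomy j i with h | h | h
      · simp [h]
      · simp [h]
      · simp [h.not_gt, h.ne']
    · congr 1; funext j; unfold chainFactor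
      rcases lt_trichotomy j i with h | h | h
      · simp [h, Nat.lt_succ_of_lt (Fin.lt_def.mp h)]
      · simp [h]
      · have : ¬ (j : ℕ) < i + 1 := by have := Fin.lt_def.mp h; omega
        simp [h.not_gt, h.ne', this]
  rw [Finset.sum_congr rfl fun i _ => h i, Fin.sum_univ_eq_sum_range (fun m => G m - G (m + 1)),
    Finset.sum_range_sub']
  simp [hG]

end ChainOp

/-! ### Quantum integers and the local representation -/

/-- The `q`-integer `[m]` for an integer `m`. -/
def qz (p : ℂ) (m : ℤ) : ℂ := (p ^ m - p ^ (-m)) / (p - p⁻¹)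

theorem qInt_eq_qz (p : ℂ) (m : ℕ) : qInt p m = qz p m := by
  simp [qInt, qz, inv_pow]

theorem qz_zero (p : ℂ) : qz p 0 = 0 := by simp [qz]

theorem qz_neg (p : ℂ) (m : ℤ) : qz p (-m) = -qz p m := by
  rw [qz, qz, neg_neg, ← neg_div, neg_sub]

/-- This identity drives all later recursions between `q`-integers. It needs no assumption `p² ≠ 1`:
when the denominator is zero, both sides are zero by the convention for division. -/
theorem qz_mul_sub_mul {p : ℂ} (hp : p ≠ 0) (A B j : ℤ) :
    qz p A * qz p B - qz p (A - j) * qz p (B - j) = qz p j * qz p (A + B - j) := by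
  unfold qz
  rw [div_mul_div_comm, div_mul_div_comm, div_mul_div_comm, ← sub_div]
  congr 1
  simp only [sub_eq_add_neg, neg_add, neg_neg, zpow_add₀ hp, zpow_neg]
  have h1 := zpow_ne_zero A hp
  have h2 := zpow_ne_zero B hp
  have h3 := zpow_ne_zero j hp
  field_simp
  ring

section LocalOps

variable {N : ℕ} {s : ℂ}

theorem kHalfPow_zero : kHalfPow N s 0 = 1 := by
  simp [kHalfPow]

theorem kHalfPow_mul (hs : s ≠ 0) (r r' : ℤ) :
    kHalfPow N s r * kHalfPow N s r' = kHalfPow N s (r + r') := by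
  rw [kHalfPow, kHalfPow, kHalfPow, Matrix.diagonal_mul_diagonal]
  congr 1
  funext a
  rw [← zpow_add₀ hs, add_mul]

theorem kHalfPow_commute (r r' : ℤ) : Commute (kHalfPow N s r) (kHalfPow N s r') :=
  Matrix.commute_diagonal _ _

theorem kHalfPow_mul_fOp (hs : s ≠ 0) (r : ℤ) :
    kHalfPow N s r * fOp N s = s ^ (-2 * r) • (fOp N s * kHalfPow N s r) := by
  ext b a
  rw [kHalfPow, Matrix.diagonal_mul, Matrix.smul_apply, Matrix.mul_diagonal, fOp, Matrix.of_apply]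
  split_ifs with h
  · rw [smul_eq_mul, mul_left_comm, ← zpow_add₀ hs, mul_comm, h]
    congr 2
    push_cast
    ring
  · simp

theorem kHalfPow_mul_eOp (hs : s ≠ 0) (r : ℤ) :
    kHalfPow N s r * eOp N s = s ^ (2 * r) • (eOp N s * kHalfPow N s r) := by
  ext b a
  rw [kHalfPow, Matrix.diagonal_mul, Matrix.smul_apply, Matrix.mul_diagonal, eOp, Matrix.of_apply]
  split_ifs with h
  · rw [smul_eq_mul, mul_left_comm, ← zpow_add₀ hs, mul_comm, ← h]
    congr 2
    push_cast
    ring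
  · simp

/-- The diagonal formula covers the end of the chain `v_0, …, v_{N-1}` because its first factor is
`[0]` at `a = N - 1`; in `fOp_mul_eOp` the factor `[a]` does the same at `a = 0`. -/
theorem eOp_mul_fOp : eOp N s * fOp N s =
    Matrix.diagonal fun a : Fin N => qz (s ^ 2) (N - 1 - a) * qz (s ^ 2) (a + 1) := by
  ext b a
  rw [Matrix.mul_apply, Matrix.diagonal_apply]
  simp only [eOp, fOp, Matrix.of_apply]
  by_cases h : (a : ℕ) + 1 < N
  · rw [Finset.sum_eq_single ⟨a + 1, h⟩]
    · simp only [if_true, Nat.add_right_cancel_iff, Fin.ext_iff, qInt_eq_qz]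
      split_ifs with hba
      · rw [hba, Nat.cast_sub h.le]
        push_cast
        congr 2
        ring
      · simp
    · intro c _ hc
      have : (c : ℕ) ≠ a + 1 := fun h' => hc (Fin.ext h')
      simp [this]
    · simp
  · have ha : ((N : ℤ) - 1 - (a : ℕ)) = 0 := by have := a.2; omega
    rw [Finset.sum_eq_zero]
    · split_ifs with hba
      · rw [hba, ha, qz_zero, zero_mul]
      · rfl
    · intro c _
      have : (c : ℕ) ≠ a + 1 := by have := c.2; omega
      simp [this]

theorem fOp_mul_eOp : fOp N s * eOp N s =
    Matrix.diagonal fun a : Fin N => qz (s ^ 2) (N - a) * qz (s ^ 2) a := by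
  ext b a
  rw [Matrix.mul_apply, Matrix.diagonal_apply]
  simp only [eOp, fOp, Matrix.of_apply]
  by_cases h : (a : ℕ) = 0
  · rw [Finset.sum_eq_zero]
    · split_ifs with hba
      · rw [hba, h, Nat.cast_zero, qz_zero, mul_zero]
      · rfl
    · intro c _
      simp [h]
  · obtain ⟨n, hn⟩ := Nat.exists_eq_succ_of_ne_zero h
    have hnN : n < N := by have := a.2; omega
    rw [Finset.sum_eq_single ⟨n, hnN⟩]
    · rw [if_pos (show ((⟨n, hnN⟩ : Fin N) : ℕ) + 1 = a by simp [hn])]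
      simp only [qInt_eq_qz, Fin.ext_iff]
      rw [show n + 1 = (a : ℕ) from hn.symm, Nat.cast_sub a.2.le]
      split_ifs with hba
      · rw [hba, mul_comm]
      · simp
    · intro c _ hc
      have : ¬ (c : ℕ) + 1 = a := fun h' => hc (Fin.ext (by simp; omega))
      simp [this]
    · simp

theorem eOp_fOp_commutator (hs : s ≠ 0) : eOp N s * fOp N s - fOp N s * eOp N s =
    Matrix.diagonal fun a : Fin N => qz (s ^ 2) (N - 1 - 2 * a) := by
  rw [eOp_mul_fOp, fOp_mul_eOp, Matrix.diagonal_sub]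
  congr 1
  funext a
  have h5 := qz_mul_sub_mul (pow_ne_zero 2 hs) (N - a) (-a) 1
  rw [qz_neg, show (-(a : ℤ) - 1) = -(a + 1) by ring, qz_neg,
    show ((N : ℤ) - a - 1) = N - 1 - a by ring,
    show ((N : ℤ) - a + -a - 1) = N - 1 - 2 * a by ring] at h5
  have h6 : (s ^ 2 - (s ^ 2)⁻¹ = 0) ∨ qz (s ^ 2) 1 = 1 := by
    by_cases h0 : s ^ 2 - (s ^ 2)⁻¹ = 0
    · exact Or.inl h0
    · right
      rw [qz, zpow_one, zpow_neg_one, div_self h0]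
  rcases h6 with h6 | h6
  · simp [qz, h6]
  · rw [h6] at h5
    linear_combination h5

theorem smul_eOp_fOp_commutator (hs : s ≠ 0) (hs' : s ^ 2 - (s ^ 2)⁻¹ ≠ 0) :
    (s ^ 2 - (s ^ 2)⁻¹) • (eOp N s * fOp N s - fOp N s * eOp N s) =
      kHalfPow N s 2 - kHalfPow N s (-2) := by
  rw [eOp_fOp_commutator hs, kHalfPow, kHalfPow, Matrix.diagonal_sub, ← Matrix.diagonal_smul]
  congr 1
  funext a
  rw [Pi.smul_apply, smul_eq_mul, qz, mul_div_cancel₀ _ hs', ← zpow_natCast, ← zpow_mul, ← zpow_mul]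
  congr 2
  push_cast
  ring

end LocalOps

/-! ### Weights -/

section Weights

variable {N L : ℕ}

/-- The weight of a basis vector of `(ℂ^N)^{⊗L}`. -/
def wt (σ : Fin L → Fin N) : ℤ := ∑ i, ((N : ℤ) - 1 - 2 * ((σ i : ℕ) : ℤ))

/-- The diagonal operator multiplying vectors of weight `m` by `g m`. -/
def wtOp (N L : ℕ) (g : ℤ → ℂ) : Op N L := Matrix.diagonal fun σ => g (wt σ)

theorem wtOp_mul (g g' : ℤ → ℂ) :
    wtOp N L g * wtOp N L g' = wtOp N L fun m => g m * g' m :=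
  Matrix.diagonal_mul_diagonal _ _

theorem wtOp_add (g g' : ℤ → ℂ) :
    wtOp N L g + wtOp N L g' = wtOp N L fun m => g m + g' m :=
  Matrix.diagonal_add _ _

theorem wtOp_sub (g g' : ℤ → ℂ) :
    wtOp N L g - wtOp N L g' = wtOp N L fun m => g m - g' m :=
  Matrix.diagonal_sub _ _

theorem wtOp_smul (c : ℂ) (g : ℤ → ℂ) : c • wtOp N L g = wtOp N L fun m => c * g m :=
  (Matrix.diagonal_smul _ _).symm

theorem wtOp_zero : wtOp N L (fun _ => 0) = 0 := Matrix.diagonal_zero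

theorem wtOp_one : wtOp N L (fun _ => 1) = 1 := Matrix.diagonal_one

theorem prod_zpow_eq_zpow_sum {ι : Type*} (S : Finset ι) {s : ℂ} (hs : s ≠ 0) (g : ι → ℤ) :
    ∏ i ∈ S, s ^ g i = s ^ ∑ i ∈ S, g i := by
  classical
  induction S using Finset.induction_on with
  | empty => simp
  | insert a S ha ih => rw [Finset.prod_insert ha, Finset.sum_insert ha, zpow_add₀ hs, ih]

theorem tensorOp_kHalfPow {s : ℂ} (hs : s ≠ 0) (r : ℤ) :
    tensorOp (fun _ : Fin L => kHalfPow N s r) = wtOp N L fun m => s ^ (r * m) := by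
  simp only [kHalfPow]
  rw [tensorOp_diagonal, wtOp]
  congr 1
  funext σ
  rw [prod_zpow_eq_zpow_sum _ hs, wt, Finset.mul_sum]

/-- The operator `M` raises weights by `d`. -/
def HasWeight (d : ℤ) (M : Op N L) : Prop :=
  ∀ g : ℤ → ℂ, wtOp N L g * M = M * wtOp N L fun m => g (m + d)

theorem hasWeight_of_apply {d : ℤ} {M : Op N L} (h : ∀ σ τ, M σ τ ≠ 0 → wt σ = wt τ + d) :
    HasWeight d M := by
  intro g
  ext σ τ
  rw [wtOp, wtOp, Matrix.diagonal_mul, Matrix.mul_diagonal]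
  by_cases h0 : M σ τ = 0
  · simp [h0]
  · rw [h σ τ h0, mul_comm]

theorem HasWeight.sum {ι : Type*} {S : Finset ι} {d : ℤ} {M : ι → Op N L}
    (h : ∀ i ∈ S, HasWeight d (M i)) : HasWeight d (∑ i ∈ S, M i) := fun g => by
  rw [Finset.mul_sum, Finset.sum_mul, Finset.sum_congr rfl fun i hi => h i hi g]

theorem HasWeight.smul {d : ℤ} {M : Op N L} (h : HasWeight d M) (c : ℂ) : HasWeight d (c • M) :=
  fun g => by rw [mul_smul_comm, h g, smul_mul_assoc]

theorem HasWeight.mul {d d' : ℤ} {M M' : Op N L} (h : HasWeight d M) (h' : HasWeight d' M') :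
    HasWeight (d + d') (M * M') := fun g => by
  rw [← mul_assoc, h g, mul_assoc, h', ← mul_assoc]
  simp only [add_assoc, add_comm d d']

theorem HasWeight.pow {d : ℤ} {M : Op N L} (h : HasWeight d M) (n : ℕ) :
    HasWeight (n * d) (M ^ n) := by
  induction n with
  | zero => intro g; simp
  | succ n ih =>
    rw [pow_succ, Nat.cast_succ, add_mul, one_mul]
    exact ih.mul h

theorem hasWeight_chainOp {d : ℤ} {c : Fin L → ℂ} {u x w : LocalOp N}
    (hu : ∀ a b, u a b ≠ 0 → a = b) (hw : ∀ a b, w a b ≠ 0 → a = b)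
    (hx : ∀ a b, x a b ≠ 0 → -2 * ((a : ℕ) : ℤ) = -2 * ((b : ℕ) : ℤ) + d) :
    HasWeight d (chainOp c u x w) := by
  refine HasWeight.sum fun i _ => HasWeight.smul (hasWeight_of_apply fun σ τ h => ?_) _
  rw [tensorOp_apply, Finset.prod_ne_zero_iff] at h
  have key (j : Fin L) : ((N : ℤ) - 1 - 2 * ((σ j : ℕ) : ℤ)) =
      ((N : ℤ) - 1 - 2 * ((τ j : ℕ) : ℤ)) + if j = i then d else 0 := by
    have hj := h j (Finset.mem_univ j)
    unfold chainFactor at hj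
    split_ifs at hj with h1 h2
    · rw [hu _ _ hj, if_neg h1.ne, add_zero]
    · rw [if_pos h2]; linarith [hx _ _ hj]
    · rw [hw _ _ hj, if_neg h2, add_zero]
  rw [wt, Finset.sum_congr rfl fun j _ => key j, Finset.sum_add_distrib]
  simp [wt]

end Weights

/-! ### The operators `B_±` and `C_±` -/

section ChainGenerators

variable {N L : ℕ} {s : ℂ}

theorem opB_eq_chainOp (ε : ℤ) : opB N L s ε =
    chainOp (fun i => s ^ (2 * ((i : ℤ) + 1) - ((L : ℤ) + 1)))
      (kHalfPow N s (-ε)) (fOp N s) (kHalfPow N s ε) := rfl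

theorem opC_eq_chainOp (ε : ℤ) : opC N L s ε =
    chainOp (fun i => s ^ (((L : ℤ) + 1) - 2 * ((i : ℤ) + 1)))
      (kHalfPow N s ε) (eOp N s) (kHalfPow N s (-ε)) := rfl

theorem kHalfPow_apply_ne {r : ℤ} {a b : Fin N} (h : kHalfPow N s r a b ≠ 0) : a = b := by
  by_contra hab
  exact h (Matrix.diagonal_apply_ne _ hab)

theorem hasWeight_opB (ε : ℤ) : HasWeight (-2) (opB N L s ε) := by
  rw [opB_eq_chainOp]
  refine hasWeight_chainOp (fun _ _ => kHalfPow_apply_ne) (fun _ _ => kHalfPow_apply_ne) ?_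
  intro a b h
  simp only [fOp, Matrix.of_apply, ne_eq, ite_eq_right_iff, Classical.not_imp] at h
  rw [h.1]
  push_cast
  ring

theorem hasWeight_opC (ε : ℤ) : HasWeight 2 (opC N L s ε) := by
  rw [opC_eq_chainOp]
  refine hasWeight_chainOp (fun _ _ => kHalfPow_apply_ne) (fun _ _ => kHalfPow_apply_ne) ?_
  intro a b h
  simp only [eOp, Matrix.of_apply, ne_eq, ite_eq_right_iff, Classical.not_imp] at h
  rw [← h.1]
  push_cast
  ring

/-- Both chains carry the same local operator `f`, so the surviving same-site terms contain `f f - f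
f = 0`. The opposite dressings make the off-site scalars match. -/
theorem opB_commute (hs : s ≠ 0) (ε ε' : ℤ) (h : ε' = -ε) :
    Commute (opB N L s ε) (opB N L s ε') := by
  subst h
  rw [Commute, SemiconjBy, ← sub_eq_zero, opB_eq_chainOp, opB_eq_chainOp,
    chainOp_commutator (a := s ^ (-2 * ε)) (b := s ^ (-2 * -ε)) (kHalfPow_commute _ _)
      (kHalfPow_commute _ _) (kHalfPow_commute _ _) (kHalfPow_commute _ _)]
  · simp only [sub_self]
    refine Finset.sum_eq_zero fun i _ => ?_
    have := tensorOp_chainFactor_smul i (kHalfPow N s (-ε) * kHalfPow N s (- -ε)) 0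
      (kHalfPow N s ε * kHalfPow N s (-ε)) 0
    rw [zero_smul, zero_smul] at this
    rw [this, smul_zero]
  all_goals (try simp only [neg_neg]); exact kHalfPow_mul_fOp hs _

theorem opC_commute (hs : s ≠ 0) (ε ε' : ℤ) (h : ε' = -ε) :
    Commute (opC N L s ε) (opC N L s ε') := by
  subst h
  rw [Commute, SemiconjBy, ← sub_eq_zero, opC_eq_chainOp, opC_eq_chainOp,
    chainOp_commutator (a := s ^ (2 * -ε)) (b := s ^ (2 * ε)) (kHalfPow_commute _ _)
      (kHalfPow_commute _ _) (kHalfPow_commute _ _) (kHalfPow_commute _ _)]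
  · simp only [sub_self]
    refine Finset.sum_eq_zero fun i _ => ?_
    have := tensorOp_chainFactor_smul i (kHalfPow N s ε * kHalfPow N s (-ε)) 0
      (kHalfPow N s (-ε) * kHalfPow N s (- -ε)) 0
    rw [zero_smul, zero_smul] at this
    rw [this, smul_zero]
  all_goals (try simp only [neg_neg]); exact kHalfPow_mul_eOp hs _

/-- The coefficients of the two chains cancel site by site. After multiplication by `q - q⁻¹` the
local commutator is `k - k⁻¹`, which up to the sign `ε` is the difference of the right and left
dressings `k^{±1}`; the sum over sites telescopes. -/
theorem opC_opB_commutator (hs : s ≠ 0) (hs' : s ^ 2 - (s ^ 2)⁻¹ ≠ 0) {ε : ℤ}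
    (hε : ε = 1 ∨ ε = -1) :
    opC N L s (-ε) * opB N L s ε - opB N L s ε * opC N L s (-ε) =
      wtOp N L fun m => qz (s ^ 2) m := by
  have hc : (s ^ 2 - (s ^ 2)⁻¹) •
      (opC N L s (-ε) * opB N L s ε - opB N L s ε * opC N L s (-ε)) =
      ∑ i : Fin L, tensorOp (chainFactor i (kHalfPow N s (-ε + -ε))
        (kHalfPow N s 2 - kHalfPow N s (-2)) (kHalfPow N s (ε + ε))) := by
    rw [opB_eq_chainOp, opC_eq_chainOp, neg_neg,
      chainOp_commutator (a := s ^ (2 * -ε)) (b := s ^ (-2 * -ε)) (kHalfPow_commute _ _)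
        (kHalfPow_commute _ _) (kHalfPow_commute _ _) (kHalfPow_commute _ _)
        (kHalfPow_mul_eOp hs _) (by rw [kHalfPow_mul_fOp hs]; congr 2; ring)
        (kHalfPow_mul_fOp hs _) (by rw [kHalfPow_mul_eOp hs]; congr 2; ring), Finset.smul_sum]
    refine Finset.sum_congr rfl fun i _ => ?_
    rw [← zpow_add₀ hs, kHalfPow_mul hs, kHalfPow_mul hs, ← smul_eOp_fOp_commutator hs hs',
      tensorOp_chainFactor_smul]
    simp
  have hq : (s ^ 2 - (s ^ 2)⁻¹) • (wtOp N L fun m => qz (s ^ 2) m) =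
      (wtOp N L fun m => s ^ (2 * m)) - wtOp N L fun m => s ^ (-2 * m) := by
    rw [wtOp_smul, wtOp_sub]
    congr 1
    funext m
    rw [qz, mul_div_cancel₀ _ hs', ← zpow_natCast, ← zpow_mul, ← zpow_mul]
    congr 2
    push_cast
    ring
  refine smul_right_injective _ hs' ?_
  simp only
  rw [hc, hq]
  rcases hε with rfl | rfl
  · have := sum_tensorOp_chainFactor_sub (L := L) (kHalfPow N s (-2)) (kHalfPow N s 2)
    rw [tensorOp_kHalfPow hs, tensorOp_kHalfPow hs] at this
    exact this
  · have := sum_tensorOp_chainFactor_sub (L := L) (kHalfPow N s 2) (kHalfPow N s (-2))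
    rw [tensorOp_kHalfPow hs, tensorOp_kHalfPow hs] at this
    rw [← neg_sub (wtOp N L fun m => s ^ (-2 * m)), ← this, ← Finset.sum_neg_distrib]
    refine Finset.sum_congr rfl fun i _ => ?_
    rw [← neg_one_smul ℂ (tensorOp _), ← tensorOp_chainFactor_smul, neg_one_smul, neg_sub]
    rfl

end ChainGenerators

/-! ### Commuting powers in `U_q(sl₂)` -/

section PowCommutator

variable {N L : ℕ} {p : ℂ} {E F : Op N L}

theorem mul_pow_succ_of_commutator (hp : p ≠ 0) (hp' : p - p⁻¹ ≠ 0) (hF : HasWeight (-2) F)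
    (hEF : E * F - F * E = wtOp N L (qz p)) (n : ℕ) :
    E * F ^ (n + 1) = F ^ (n + 1) * E +
      F ^ n * wtOp N L fun m => qz p (n + 1) * qz p (m - n) := by
  have hEF' : E * F = F * E + wtOp N L (qz p) := by rw [← hEF]; abel
  have h1 : qz p 1 = 1 := by rw [qz, zpow_one, zpow_neg_one, div_self hp']
  induction n with
  | zero => simp [hEF', h1]
  | succ n ih =>
    rw [pow_succ F (n + 1), ← mul_assoc, ih, add_mul, mul_assoc, hEF', mul_add, mul_assoc (F ^ n),
      hF, ← mul_assoc (F ^ n), ← pow_succ F n, ← mul_assoc, add_assoc, ← mul_add, wtOp_add]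
    congr 3
    funext m
    have := qz_mul_sub_mul hp (n + 1 + 1) (m - n) 1
    rw [h1, add_sub_cancel_right, show ((n : ℤ) + 1 + 1 + (m - n) - 1) = m + 1 by ring] at this
    have h2 := qz_mul_sub_mul hp (n + 1 + 1) (m - n - 1) 1
    rw [h1, add_sub_cancel_right, show ((n : ℤ) + 1 + 1 + (m - n - 1) - 1) = m by ring] at h2
    push_cast
    rw [show m - ((n : ℤ) + 1) = m - n - 1 by ring,
      show m + -2 - (n : ℤ) = m - n - 1 - 1 by ring]
    linear_combination -h2

/-- The coefficients in the expansion of `E ^ a F ^ b`. -/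
def powCoeff (p : ℂ) (a b : ℤ) (j : ℕ) (m : ℤ) : ℂ :=
  (∏ i ∈ Finset.range j, qz p (a - i) * qz p (b - i) * qz p (m + a - b - i)) / qFact p j

theorem powCoeff_zero (p : ℂ) (a b m : ℤ) : powCoeff p a b 0 m = 1 := by
  simp [powCoeff, qFact]

theorem powCoeff_self_succ (p : ℂ) (a : ℕ) (b m : ℤ) : powCoeff p a b (a + 1) m = 0 := by
  rw [powCoeff, Finset.prod_range_succ, sub_self, qz_zero]
  simp

/-- A Pascal-type recursion. Once the common factors are removed it is the instance of
`qz_mul_sub_mul` recorded as `key`. -/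
theorem powCoeff_succ (hp : p ≠ 0) (a b : ℤ) {j : ℕ} (hj : qFact p (j + 1) ≠ 0) (m : ℤ) :
    powCoeff p (a + 1) b (j + 1) m = powCoeff p a b (j + 1) m +
      qz p (b - j) * qz p (m + 2 * (a - j) - (b - j - 1)) * powCoeff p a b j m := by
  have hf : qFact p (j + 1) = qFact p j * qz p (j + 1) := by
    rw [qFact, Finset.prod_range_succ, qFact]
    simp [qInt_eq_qz]
  rw [hf] at hj
  have hj1 := left_ne_zero_of_mul hj
  have hj2 := right_ne_zero_of_mul hj
  have key := qz_mul_sub_mul hp (a + 1) (m + a - b + 1) (j + 1)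
  rw [show a + 1 - ((j : ℤ) + 1) = a - j by ring,
    show m + a - b + 1 - ((j : ℤ) + 1) = m + a - b - j by ring,
    show a + 1 + (m + a - b + 1) - ((j : ℤ) + 1) = m + 2 * (a - j) - (b - j - 1) by ring] at key
  simp only [powCoeff, hf, Finset.prod_mul_distrib]
  rw [Finset.prod_range_succ' (fun i : ℕ => qz p (a + 1 - i)),
    Finset.prod_range_succ' (fun i : ℕ => qz p (m + (a + 1) - b - i)),
    Finset.prod_range_succ (fun i : ℕ => qz p (a - i)),
    Finset.prod_range_succ (fun i : ℕ => qz p (b - i)),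
    Finset.prod_range_succ (fun i : ℕ => qz p (m + a - b - i))]
  simp only [Nat.cast_succ, Nat.cast_zero, sub_zero]
  rw [Finset.prod_congr rfl fun (i : ℕ) _ => show qz p (a + 1 - ((i : ℤ) + 1)) = qz p (a - i) by
      congr 1; ring,
    Finset.prod_congr rfl fun (i : ℕ) _ =>
      show qz p (m + (a + 1) - b - ((i : ℤ) + 1)) = qz p (m + a - b - i) by congr 1; ring,
    show m + (a + 1) - b = m + a - b + 1 by ring]
  field_simp
  linear_combination (∏ i ∈ Finset.range j, qz p (a - i)) * (∏ i ∈ Finset.range j, qz p (b - i)) *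
    qz p (b - j) * (∏ i ∈ Finset.range j, qz p (m + a - b - i)) * key

/-- Induction on `a`, moving one further `E` through each `F ^ (b - j)`. The Cartan part is kept on
the right so that it can later be evaluated on vectors of the sector. -/
theorem pow_mul_pow_of_commutator (hp : p ≠ 0) (hp' : p - p⁻¹ ≠ 0) (hE : HasWeight 2 E)
    (hF : HasWeight (-2) F) (hEF : E * F - F * E = wtOp N L (qz p)) {b : ℕ}
    (hb : ∀ j ≤ b, qFact p j ≠ 0) {a : ℕ} (hab : a ≤ b) :
    E ^ a * F ^ b = ∑ j ∈ Finset.range (a + 1),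
      F ^ (b - j) * E ^ (a - j) * wtOp N L (powCoeff p a b j) := by
  induction a with
  | zero => simp [show powCoeff p 0 b 0 = fun _ => 1 from funext (powCoeff_zero p 0 b), wtOp_one]
  | succ a ih =>
    have hterm (j : ℕ) (hj : j ∈ Finset.range (a + 1)) :
        E * (F ^ (b - j) * E ^ (a - j) * wtOp N L (powCoeff p a b j)) =
        F ^ (b - j) * E ^ (a + 1 - j) * wtOp N L (powCoeff p a b j) +
        F ^ (b - (j + 1)) * E ^ (a - j) * wtOp N L (fun m =>
          qz p (b - j) * qz p (m + 2 * (a - j) - (b - j - 1)) * powCoeff p a b j m) := by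
      have hja : j ≤ a := Nat.lt_succ_iff.mp (Finset.mem_range.mp hj)
      have h1 : b - j = b - (j + 1) + 1 := by omega
      have h2 : a + 1 - j = a - j + 1 := by omega
      have h3 : ((b - (j + 1) : ℕ) : ℤ) = (b : ℤ) - j - 1 := by omega
      have h4 : ((a - j : ℕ) : ℤ) = (a : ℤ) - j := by omega
      rw [h1, h2, ← mul_assoc, ← mul_assoc, mul_pow_succ_of_commutator hp hp' hF hEF, add_mul,
        add_mul, mul_assoc (F ^ (b - (j + 1) + 1)) E, ← pow_succ', mul_assoc (F ^ (b - (j + 1))),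
        hE.pow (a - j), ← mul_assoc (F ^ (b - (j + 1))), mul_assoc _ (wtOp N L _), wtOp_mul, h3, h4]
      congr 4
      funext m
      rw [show (b : ℤ) - j - 1 + 1 = b - j by ring, mul_comm ((a : ℤ) - j) 2]
    rw [pow_succ', mul_assoc, ih (Nat.le_of_succ_le hab), Finset.mul_sum,
      Finset.sum_congr rfl hterm, Finset.sum_add_distrib]
    -- The missing top term is zero and is added so that both sums can be matched index by index.
    have hlast : F ^ (b - (a + 1)) * E ^ (a + 1 - (a + 1)) *
        wtOp N L (powCoeff p a b (a + 1)) = 0 := by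
      rw [show powCoeff p a b (a + 1) = fun _ => 0 from funext (powCoeff_self_succ p a b), wtOp_zero,
        mul_zero]
    rw [← add_zero (∑ j ∈ Finset.range (a + 1), F ^ (b - j) * E ^ (a + 1 - j) *
        wtOp N L (powCoeff p a b j)), ← hlast,
      ← Finset.sum_range_succ (fun j => F ^ (b - j) * E ^ (a + 1 - j) *
        wtOp N L (powCoeff p a b j)), Finset.sum_range_succ', Finset.sum_range_succ' _ (a + 1),
      add_right_comm, ← Finset.sum_add_distrib]
    congr 1
    refine Finset.sum_congr rfl fun j hj => ?_
    have hja : j < a + 1 := Finset.mem_range.mp hj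
    rw [Nat.add_sub_add_right, ← mul_add, wtOp_add]
    congr 2
    funext m
    push_cast
    rw [powCoeff_succ hp _ _ (hb _ (by omega))]

/-- The commutator of divided powers. -/
theorem dividedPow_commutator (hp : p ≠ 0) (hp' : p - p⁻¹ ≠ 0) (hE : HasWeight 2 E)
    (hF : HasWeight (-2) F) (hEF : E * F - F * E = wtOp N L (qz p)) {n : ℕ}
    (hn : ∀ j ≤ n, qFact p j ≠ 0) :
    ((qFact p n)⁻¹ • E ^ n) * ((qFact p n)⁻¹ • F ^ n) -
      ((qFact p n)⁻¹ • F ^ n) * ((qFact p n)⁻¹ • E ^ n) =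
    ∑ j ∈ Finset.range n, (qFact p (n - (j + 1)))⁻¹ ^ 2 • (F ^ (n - (j + 1)) * E ^ (n - (j + 1)) *
      wtOp N L fun m => (∏ i ∈ Finset.range (j + 1), qz p (m - i)) / qFact p (j + 1)) := by
  rw [smul_mul_smul_comm, smul_mul_smul_comm, ← smul_sub,
    pow_mul_pow_of_commutator hp hp' hE hF hEF hn le_rfl, Finset.sum_range_succ']
  rw [show powCoeff p n n 0 = fun _ => 1 from funext (powCoeff_zero p n n), wtOp_one, mul_one,
    Nat.sub_zero, add_sub_cancel_right, Finset.smul_sum]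
  refine Finset.sum_congr rfl fun j hj => ?_
  have hjn : j + 1 ≤ n := Finset.mem_range.mp hj
  -- Two such products occur in `powCoeff` for `a = b = n`; against the prefactor `[n]!⁻²` they
  -- leave `[n - k]!⁻²`.
  have hfact (k : ℕ) (hk : k ≤ n) :
      qFact p (n - k) * ∏ i ∈ Finset.range k, qz p (n - i) = qFact p n := by
    induction k with
    | zero => simp
    | succ k ih =>
      rw [← ih (by omega), Finset.prod_range_succ, mul_comm (∏ i ∈ Finset.range k, qz p (n - i)),
        ← mul_assoc]
      congr 1
      obtain ⟨l, hl⟩ : ∃ l, n - k = l + 1 := ⟨n - k - 1, by omega⟩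
      rw [show n - (k + 1) = l by omega, hl, qFact, qFact, Finset.prod_range_succ, qInt_eq_qz]
      congr 2
      push_cast
      omega
  rw [← mul_smul_comm, ← mul_smul_comm, wtOp_smul, wtOp_smul]
  congr 2
  funext m
  have h1 := hfact (j + 1) hjn
  have h2 := hn _ (Nat.sub_le n (j + 1))
  have h3 := hn n le_rfl
  rw [powCoeff, Finset.prod_mul_distrib, Finset.prod_mul_distrib]
  rw [← h1] at h3
  have h4 := right_ne_zero_of_mul h3
  have h5 := hn _ hjn
  simp only [add_sub_cancel_right]
  rw [← h1]
  field_simp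

end PowCommutator

/-! ### The `q`-binomial theorem at roots of unity -/

section QBinomial

/-- The Gaussian binomial coefficients. -/
def gaussCoeff (ω : ℂ) : ℕ → ℕ → ℂ
  | _, 0 => 1
  | 0, _ + 1 => 0
  | n + 1, k + 1 => gaussCoeff ω n k + ω ^ (k + 1) * gaussCoeff ω n (k + 1)

theorem gaussCoeff_zero_right (ω : ℂ) (n : ℕ) : gaussCoeff ω n 0 = 1 := by
  cases n <;> rfl

theorem gaussCoeff_eq_zero (ω : ℂ) {n k : ℕ} (h : n < k) : gaussCoeff ω n k = 0 := by
  induction n generalizing k with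
  | zero => obtain ⟨k, rfl⟩ := Nat.exists_eq_succ_of_ne_zero h.ne'; rfl
  | succ n ih =>
    obtain ⟨k, rfl⟩ := Nat.exists_eq_succ_of_ne_zero (Nat.ne_of_gt (Nat.zero_lt_of_lt h))
    rw [gaussCoeff, ih (Nat.lt_of_succ_lt_succ h), ih (Nat.lt_of_succ_lt h), mul_zero, add_zero]

theorem gaussCoeff_self (ω : ℂ) (n : ℕ) : gaussCoeff ω n n = 1 := by
  induction n with
  | zero => rfl
  | succ n ih => rw [gaussCoeff, ih, gaussCoeff_eq_zero ω (Nat.lt_succ_self n), mul_zero, add_zero]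

/-- The ratio of consecutive Gaussian binomials, cleared of denominators so that it can be used at
roots of unity. -/
theorem gaussCoeff_succ_right (ω : ℂ) (n k : ℕ) :
    ω ^ k * (1 - ω ^ (k + 1)) * gaussCoeff ω n (k + 1) =
      (ω ^ k - ω ^ n) * gaussCoeff ω n k := by
  induction n generalizing k with
  | zero =>
    cases k with
    | zero => simp [gaussCoeff]
    | succ k => simp [gaussCoeff]
  | succ n ih =>
    cases k with
    | zero =>
      have h := ih 0
      rw [gaussCoeff_zero_right] at h
      rw [show gaussCoeff ω (n + 1) (0 + 1) = gaussCoeff ω n 0 + ω ^ (0 + 1) * gaussCoeff ω n (0 + 1)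
        from rfl, gaussCoeff_zero_right, gaussCoeff_zero_right]
      linear_combination ω * h
    | succ k =>
      rw [gaussCoeff, gaussCoeff]
      linear_combination ω ^ (k + 2) * ih (k + 1) + ω * ih k

/-- In `gaussCoeff_succ_right` the right side vanishes at `k = 0` because `ω ^ n = 1`, while the
factors on the left stay nonzero below `n`. The vanishing therefore propagates from `k = 1` upwards.
-/
theorem gaussCoeff_eq_zero_of_isPrimitiveRoot {ω : ℂ} {n : ℕ} (hω : IsPrimitiveRoot ω n) {k : ℕ}
    (hk0 : k ≠ 0) (hkn : k < n) : gaussCoeff ω n k = 0 := by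
  have hne : ω ≠ 0 := hω.ne_zero (Nat.ne_of_gt (Nat.zero_lt_of_lt hkn))
  obtain ⟨k, rfl⟩ := Nat.exists_eq_succ_of_ne_zero hk0
  have h1 (k : ℕ) (hkn : k + 1 < n) (h : (ω ^ k - ω ^ n) * gaussCoeff ω n k = 0) :
      gaussCoeff ω n (k + 1) = 0 := by
    have h2 := gaussCoeff_succ_right ω n k
    rw [h] at h2
    refine (mul_eq_zero.mp h2).resolve_left (mul_ne_zero (pow_ne_zero _ hne) ?_)
    exact sub_ne_zero.mpr (hω.pow_ne_one_of_pos_of_lt (Nat.succ_ne_zero k) hkn).symm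
  induction k with
  | zero => exact h1 0 hkn (by rw [hω.pow_eq_one, pow_zero, sub_self, zero_mul])
  | succ k ih => exact h1 _ hkn (by rw [ih (Nat.succ_ne_zero k) (Nat.lt_of_succ_lt hkn), mul_zero])

variable {R : Type*} [Ring R] [Algebra ℂ R]

theorem mul_pow_of_qcomm {X Y : R} {ω : ℂ} (h : Y * X = ω • (X * Y)) (k : ℕ) :
    Y * X ^ k = ω ^ k • (X ^ k * Y) := by
  induction k with
  | zero => simp
  | succ k ih =>
    rw [pow_succ, ← mul_assoc, ih, smul_mul_assoc, mul_assoc, h, mul_smul_comm, smul_smul,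
      ← pow_succ, mul_assoc]

theorem add_pow_of_qcomm {X Y : R} {ω : ℂ} (h : Y * X = ω • (X * Y)) (n : ℕ) :
    (X + Y) ^ n = ∑ k ∈ Finset.range (n + 1), gaussCoeff ω n k • (X ^ k * Y ^ (n - k)) := by
  induction n with
  | zero => simp [gaussCoeff]
  | succ n ih =>
    have hX : X * (X + Y) ^ n =
        ∑ k ∈ Finset.range (n + 1), gaussCoeff ω n k • (X ^ (k + 1) * Y ^ (n - k)) := by
      rw [ih, Finset.mul_sum]
      refine Finset.sum_congr rfl fun k _ => ?_
      rw [mul_smul_comm, ← mul_assoc, ← pow_succ']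
    have hY : Y * (X + Y) ^ n = ∑ k ∈ Finset.range (n + 1 + 1),
        (ω ^ k * gaussCoeff ω n k) • (X ^ k * Y ^ (n + 1 - k)) := by
      rw [Finset.sum_range_succ, gaussCoeff_eq_zero ω (Nat.lt_succ_self n), mul_zero, zero_smul,
        add_zero, ih, Finset.mul_sum]
      refine Finset.sum_congr rfl fun k hk => ?_
      have hkn : n + 1 - k = n - k + 1 := by have := Finset.mem_range.mp hk; omega
      rw [mul_smul_comm, ← mul_assoc, mul_pow_of_qcomm h, smul_mul_assoc, mul_assoc, ← pow_succ',
        hkn, smul_smul, mul_comm]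
    rw [pow_succ', add_mul, hX, hY, Finset.sum_range_succ' _ (n + 1), ← add_assoc,
      ← Finset.sum_add_distrib, Finset.sum_range_succ' _ (n + 1)]
    congr 1
    · refine Finset.sum_congr rfl fun k _ => ?_
      rw [Nat.add_sub_add_right, ← add_smul, gaussCoeff]
    · simp [gaussCoeff_zero_right]

theorem add_pow_of_qcomm_of_isPrimitiveRoot {X Y : R} {ω : ℂ} {n : ℕ} (hω : IsPrimitiveRoot ω n)
    (hn : n ≠ 0) (h : Y * X = ω • (X * Y)) : (X + Y) ^ n = X ^ n + Y ^ n := by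
  obtain ⟨m, rfl⟩ := Nat.exists_eq_succ_of_ne_zero hn
  rw [add_pow_of_qcomm h, Finset.sum_range_succ, Finset.sum_range_succ', Finset.sum_eq_zero]
  · simp [gaussCoeff_zero_right, gaussCoeff_self, add_comm]
  · intro k hk
    rw [gaussCoeff_eq_zero_of_isPrimitiveRoot hω (Nat.succ_ne_zero k)
      (Nat.succ_lt_succ (Finset.mem_range.mp hk)), zero_smul]

/-- The terms are added in increasing order, so each new one commutes with the whole partial sum up
to the same `ω`, and the `n`-th power is additive. -/
theorem sum_pow_eq_zero_of_qcomm {ι : Type*} [LinearOrder ι] {X : ι → R} {ω : ℂ} {n : ℕ}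
    (hω : IsPrimitiveRoot ω n) (hn : n ≠ 0) (h : ∀ i j, i < j → X j * X i = ω • (X i * X j))
    (hX : ∀ i, X i ^ n = 0) (S : Finset ι) : (∑ i ∈ S, X i) ^ n = 0 := by
  induction S using Finset.induction_on_max with
  | empty => simp [hn]
  | insert a S ha ih =>
    rw [Finset.sum_insert fun h => (ha a h).false, add_comm,
      add_pow_of_qcomm_of_isPrimitiveRoot hω hn, ih, hX, add_zero]
    rw [Finset.mul_sum, Finset.sum_mul, Finset.smul_sum]
    exact Finset.sum_congr rfl fun i hi => h i a (ha i hi)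

end QBinomial

/-! ### Nilpotency at the root of unity -/

section Nilpotent

variable {N L : ℕ} {s : ℂ}

/-- Only two sites contribute scalars: at `i` the left dressing of the other term meets `x`, at `j`
the right dressing does. -/
theorem chainFactor_qcomm {u x w : LocalOp N} {a b : ℂ} (huw : Commute u w)
    (hu : u * x = a • (x * u)) (hw : x * w = b • (w * x)) {i j : Fin L} (hij : i < j) :
    tensorOp (chainFactor j u x w) * tensorOp (chainFactor i u x w) =
      (a * b) • (tensorOp (chainFactor i u x w) * tensorOp (chainFactor j u x w)) := by
  have hprod : ∏ k : Fin L, (if k = i then a else 1) * (if k = j then b else 1) = a * b := by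
    rw [Finset.prod_mul_distrib]
    simp
  rw [tensorOp_mul, tensorOp_mul, ← hprod, ← tensorOp_smul]
  congr 1
  funext k
  unfold chainFactor
  rcases lt_trichotomy k i with h | h | h
  · simp [h, h.trans hij, h.ne, (h.trans hij).ne]
  · subst h
    simp [hij, hij.ne, hu]
  · rcases lt_trichotomy k j with h' | h' | h'
    · simp [h.ne', h.not_gt, h', h'.ne, huw.eq]
    · subst h'
      simp [h.ne', h.not_gt, hw]
    · simp [h.ne', h.not_gt, h'.ne', h'.not_gt]

theorem chainOp_pow_eq_zero {c : Fin L → ℂ} {u x w : LocalOp N} {a b : ℂ} {n : ℕ}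
    (huw : Commute u w) (hu : u * x = a • (x * u)) (hw : x * w = b • (w * x))
    (hab : IsPrimitiveRoot (a * b) n) (hn : n ≠ 0) (hx : x ^ n = 0) : chainOp c u x w ^ n = 0 := by
  refine sum_pow_eq_zero_of_qcomm hab hn (fun i j hij => ?_) (fun i => ?_) _
  · rw [smul_mul_smul_comm, smul_mul_smul_comm, chainFactor_qcomm huw hu hw hij, smul_comm,
      mul_comm (c j)]
  · rw [smul_pow, tensorOp_pow]
    have h0 : tensorOp (fun k => chainFactor i u x w k ^ n) = 0 := by
      ext σ τ
      refine Finset.prod_eq_zero (Finset.mem_univ i) ?_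
      change (chainFactor i u x w i ^ n) (σ i) (τ i) = 0
      rw [chainFactor_self, hx]
      rfl
    rw [h0, smul_zero]

theorem fOp_pow_apply (n : ℕ) {b a : Fin N} (h : (fOp N s ^ n) b a ≠ 0) :
    (b : ℕ) = a + n := by
  induction n generalizing b a with
  | zero =>
    rw [pow_zero] at h
    by_contra hab
    exact h (Matrix.one_apply_ne fun h' => hab (by rw [h', add_zero]))
  | succ n ih =>
    rw [pow_succ, Matrix.mul_apply] at h
    obtain ⟨c, _, hc⟩ := Finset.exists_ne_zero_of_sum_ne_zero h
    have h1 := ih (left_ne_zero_of_mul hc)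
    have h2 := right_ne_zero_of_mul hc
    simp only [fOp, Matrix.of_apply, ne_eq, ite_eq_right_iff, Classical.not_imp] at h2
    omega

theorem eOp_pow_apply (n : ℕ) {b a : Fin N} (h : (eOp N s ^ n) b a ≠ 0) :
    (b : ℕ) + n = a := by
  induction n generalizing b a with
  | zero =>
    rw [pow_zero] at h
    by_contra hab
    exact h (Matrix.one_apply_ne fun h' => hab (by rw [h', add_zero]))
  | succ n ih =>
    rw [pow_succ, Matrix.mul_apply] at h
    obtain ⟨c, _, hc⟩ := Finset.exists_ne_zero_of_sum_ne_zero h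
    have h1 := ih (left_ne_zero_of_mul hc)
    have h2 := right_ne_zero_of_mul hc
    simp only [eOp, Matrix.of_apply, ne_eq, ite_eq_right_iff, Classical.not_imp] at h2
    omega

theorem fOp_pow_self : fOp N s ^ N = 0 := by
  ext b a
  by_contra h
  have := fOp_pow_apply N h
  have := b.2
  omega

theorem eOp_pow_self : eOp N s ^ N = 0 := by
  ext b a
  by_contra h
  have := eOp_pow_apply N h
  have := a.2
  omega

/-- Oddness of `N` is what keeps `q² = s⁴` of order `N`. This is the scalar, up to inversion, by
which the summands of `B_±` and `C_±` commute. -/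
theorem isPrimitiveRoot_four (hN : Odd N) (hs : IsPrimitiveRoot s (2 * N)) :
    IsPrimitiveRoot (s ^ 4) N := by
  have h := (hs.pow (Nat.mul_pos two_pos hN.pos) rfl).pow_of_coprime 2 (Nat.coprime_two_left.mpr hN)
  rwa [← pow_mul] at h

theorem isPrimitiveRoot_zpow_four (hN : Odd N) (hs : IsPrimitiveRoot s (2 * N)) {ε : ℤ}
    (hε : ε = 1 ∨ ε = -1) : IsPrimitiveRoot (s ^ (4 * ε)) N := by
  have h := isPrimitiveRoot_four hN hs
  rcases hε with rfl | rfl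
  · exact_mod_cast h
  · have := h.inv
    rw [← zpow_natCast, ← zpow_neg] at this
    exact this

theorem ne_zero_of_primitive (hN : Odd N) (hs : IsPrimitiveRoot s (2 * N)) : s ≠ 0 :=
  hs.ne_zero (Nat.mul_pos two_pos hN.pos).ne'

theorem opB_pow_eq_zero (hN : Odd N) (hs : IsPrimitiveRoot s (2 * N)) {ε : ℤ}
    (hε : ε = 1 ∨ ε = -1) : opB N L s ε ^ N = 0 := by
  have hs0 := ne_zero_of_primitive hN hs
  rw [opB_eq_chainOp]
  refine chainOp_pow_eq_zero (a := s ^ (-2 * -ε)) (b := s ^ (2 * ε)) (kHalfPow_commute _ _)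
    (kHalfPow_mul_fOp hs0 _) ?_ ?_ hN.pos.ne' fOp_pow_self
  · rw [kHalfPow_mul_fOp hs0, smul_smul, ← zpow_add₀ hs0]
    simp
  · rw [← zpow_add₀ hs0, show -2 * -ε + 2 * ε = 4 * ε by ring]
    exact isPrimitiveRoot_zpow_four hN hs hε

theorem opC_pow_eq_zero (hN : Odd N) (hs : IsPrimitiveRoot s (2 * N)) {ε : ℤ}
    (hε : ε = 1 ∨ ε = -1) : opC N L s ε ^ N = 0 := by
  have hs0 := ne_zero_of_primitive hN hs
  rw [opC_eq_chainOp]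
  refine chainOp_pow_eq_zero (a := s ^ (2 * ε)) (b := s ^ (-2 * -ε)) (kHalfPow_commute _ _)
    (kHalfPow_mul_eOp hs0 _) ?_ ?_ hN.pos.ne' eOp_pow_self
  · rw [kHalfPow_mul_eOp hs0, smul_smul, ← zpow_add₀ hs0]
    simp
  · rw [← zpow_add₀ hs0, show 2 * ε + -2 * -ε = 4 * ε by ring]
    exact isPrimitiveRoot_zpow_four hN hs hε

end Nilpotent

/-! ### Divided powers in the limit -/

section Limits

variable {N L : ℕ} {s : ℂ}

theorem tendsto_div_of_hasDerivAt {f g : ℂ → ℂ} {f' g' x : ℂ} (hf : HasDerivAt f f' x)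
    (hg : HasDerivAt g g' x) (hf0 : f x = 0) (hg0 : g x = 0) (hg' : g' ≠ 0) :
    Tendsto (fun t => f t / g t) (𝓝[≠] x) (𝓝 (f' / g')) := by
  refine ((hasDerivAt_iff_tendsto_slope.mp hf).div (hasDerivAt_iff_tendsto_slope.mp hg) hg').congr' ?_
  filter_upwards [self_mem_nhdsWithin] with t ht
  rw [Pi.div_apply, slope_def_field, slope_def_field, hf0, hg0, sub_zero, sub_zero,
    div_div_div_cancel_right₀ (sub_ne_zero.mpr ht)]

theorem sq_sub_inv_ne_zero (hN : Odd N) (hN1 : N ≠ 1) (hs : IsPrimitiveRoot s (2 * N)) :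
    s ^ 2 - (s ^ 2)⁻¹ ≠ 0 := by
  have hs0 := ne_zero_of_primitive hN hs
  have h4 : s ^ 4 ≠ 1 := (isPrimitiveRoot_four hN hs).ne_one (by have := hN.pos; omega)
  intro h
  refine h4 ?_
  field_simp at h
  linear_combination h

theorem zpow_sub_zpow_neg_ne_zero (hN : Odd N) (hs : IsPrimitiveRoot s (2 * N)) {m : ℤ}
    (hm : ¬ (N : ℤ) ∣ m) : (s ^ 2) ^ m - (s ^ 2) ^ (-m) ≠ 0 := by
  have hs0 := ne_zero_of_primitive hN hs
  intro h
  refine hm ((isPrimitiveRoot_four hN hs).zpow_eq_one_iff_dvd m |>.mp ?_)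
  rw [zpow_neg, sub_eq_zero] at h
  rw [show s ^ 4 = s ^ 2 * s ^ 2 by ring, mul_zpow]
  nth_rewrite 2 [h]
  exact mul_inv_cancel₀ (zpow_ne_zero _ (pow_ne_zero 2 hs0))

theorem sq_zpow_eq_one (hN : Odd N) (hs : IsPrimitiveRoot s (2 * N)) {m : ℤ}
    (hm : (N : ℤ) ∣ m) : (s ^ 2) ^ m = 1 := by
  exact ((hs.pow (Nat.mul_pos two_pos hN.pos) rfl).zpow_eq_one_iff_dvd m).mpr hm

theorem qz_eq_zero (hN : Odd N) (hs : IsPrimitiveRoot s (2 * N)) {m : ℤ}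
    (hm : (N : ℤ) ∣ m) : qz (s ^ 2) m = 0 := by
  rw [qz, sq_zpow_eq_one hN hs hm, sq_zpow_eq_one hN hs (hm.neg_right), sub_self, zero_div]

theorem qz_ne_zero (hN : Odd N) (hs : IsPrimitiveRoot s (2 * N)) {m : ℤ}
    (hm : ¬ (N : ℤ) ∣ m) : qz (s ^ 2) m ≠ 0 := by
  have hN1 : N ≠ 1 := by rintro rfl; simp at hm
  exact div_ne_zero (zpow_sub_zpow_neg_ne_zero hN hs hm) (sq_sub_inv_ne_zero hN hN1 hs)

theorem qFact_ne_zero (hN : Odd N) (hs : IsPrimitiveRoot s (2 * N)) {j : ℕ} (hj : j < N) :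
    qFact (s ^ 2) j ≠ 0 := by
  refine Finset.prod_ne_zero_iff.mpr fun i hi => ?_
  have hi' := Finset.mem_range.mp hi
  rw [qInt_eq_qz]
  refine qz_ne_zero hN hs fun h => ?_
  exact absurd (Nat.le_of_dvd (Nat.succ_pos i) (Int.natCast_dvd_natCast.mp h)) (by omega)

/-- The numerator of `[m]` vanishes at `s`, and its derivative there is proportional to `m`. So
`[N]` has a simple zero, and `[m] / [N]` tends to `m / N`. -/
theorem hasDerivAt_zpow_sub (hN : Odd N) (hs : IsPrimitiveRoot s (2 * N)) {m : ℤ}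
    (hm : (N : ℤ) ∣ m) :
    HasDerivAt (fun t : ℂ => (t ^ 2) ^ m - (t ^ 2) ^ (-m)) (4 * m * s⁻¹) s := by
  have hs0 := ne_zero_of_primitive hN hs
  have h (m : ℤ) (hm : (N : ℤ) ∣ m) : HasDerivAt (fun t : ℂ => (t ^ 2) ^ m) (2 * m * s⁻¹) s := by
    have h1 := hasDerivAt_zpow (2 * m) s (Or.inl hs0)
    have h2 : s ^ (2 * m - 1) = s⁻¹ := by
      rw [zpow_sub₀ hs0, zpow_mul, zpow_one, show s ^ (2 : ℤ) = s ^ 2 by norm_cast,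
        sq_zpow_eq_one hN hs hm, one_div]
    rw [h2] at h1
    refine (h1.congr_deriv (by push_cast; ring)).congr_of_eventuallyEq (Eventually.of_forall ?_)
    intro t
    simp only
    rw [zpow_mul, show t ^ (2 : ℤ) = t ^ 2 by norm_cast]
  refine ((h m hm).sub (h (-m) hm.neg_right)).congr_deriv ?_
  push_cast
  ring

theorem continuousAt_qz (hN : Odd N) (hN1 : N ≠ 1) (hs : IsPrimitiveRoot s (2 * N)) (m : ℤ) :
    ContinuousAt (fun t : ℂ => qz (t ^ 2) m) s := by
  have hs0 := ne_zero_of_primitive hN hs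
  have h2 : ContinuousAt (fun t : ℂ => t ^ 2) s := by fun_prop
  have hne : s ^ 2 ≠ 0 := pow_ne_zero 2 hs0
  exact ((h2.zpow₀ m (Or.inl hne)).sub (h2.zpow₀ (-m) (Or.inl hne))).div
    (h2.sub (h2.inv₀ hne)) (sq_sub_inv_ne_zero hN hN1 hs)

theorem continuousAt_qFact (hN : Odd N) (hN1 : N ≠ 1) (hs : IsPrimitiveRoot s (2 * N)) (j : ℕ) :
    ContinuousAt (fun t : ℂ => qFact (t ^ 2) j) s := by
  unfold qFact
  refine tendsto_finsetProd _ fun i _ => ?_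
  simp only [qInt_eq_qz]
  exact continuousAt_qz hN hN1 hs _

theorem qFact_succ (p : ℂ) (j : ℕ) : qFact p (j + 1) = qFact p j * qz p ((j + 1 : ℕ) : ℤ) := by
  rw [qFact, Finset.prod_range_succ, qInt_eq_qz, qFact]

theorem qFact_self (p : ℂ) (hN : N ≠ 0) : qFact p N = qFact p (N - 1) * qz p N := by
  obtain ⟨n, rfl⟩ := Nat.exists_eq_succ_of_ne_zero hN
  exact qFact_succ p n

theorem four_mul_natCast_ne_zero (hN : Odd N) (hs : IsPrimitiveRoot s (2 * N)) :
    (4 * ((N : ℤ) : ℂ) * s⁻¹) ≠ 0 := by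
  have hs0 := ne_zero_of_primitive hN hs
  have : (N : ℂ) ≠ 0 := Nat.cast_ne_zero.mpr hN.pos.ne'
  simp [hs0, this]

/-- Near the root of unity, but not at it, the parameter is generic. -/
theorem eventually_generic (hN : Odd N) (hN1 : N ≠ 1) (hs : IsPrimitiveRoot s (2 * N)) :
    ∀ᶠ t in 𝓝[≠] s, t ≠ 0 ∧ t ^ 2 - (t ^ 2)⁻¹ ≠ 0 ∧ ∀ j ≤ N, qFact (t ^ 2) j ≠ 0 := by
  have hs0 := ne_zero_of_primitive hN hs
  have h1 : ∀ᶠ t in 𝓝[≠] s, t ≠ 0 := (continuousAt_id.eventually_ne hs0).filter_mono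
    nhdsWithin_le_nhds
  have h2 : ContinuousAt (fun t : ℂ => t ^ 2 - (t ^ 2)⁻¹) s := by
    have h2 : ContinuousAt (fun t : ℂ => t ^ 2) s := by fun_prop
    exact h2.sub (h2.inv₀ (pow_ne_zero 2 hs0))
  have h2 := (h2.eventually_ne (sq_sub_inv_ne_zero hN hN1 hs)).filter_mono
    (nhdsWithin_le_nhds (s := {s}ᶜ))
  have h3 := (hasDerivAt_zpow_sub hN hs (dvd_refl (N : ℤ))).eventually_ne
    (c := 0) (four_mul_natCast_ne_zero hN hs)
  have h4 : ∀ᶠ t in 𝓝[≠] s, ∀ j ∈ Finset.range N, qFact (t ^ 2) j ≠ 0 := by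
    rw [Finset.eventually_all]
    intro j hj
    exact ((continuousAt_qFact hN hN1 hs j).eventually_ne
      (qFact_ne_zero hN hs (Finset.mem_range.mp hj))).filter_mono nhdsWithin_le_nhds
  filter_upwards [h1, h2, h3, h4] with t h1 h2 h3 h4
  refine ⟨h1, h2, fun j hj => ?_⟩
  rcases hj.lt_or_eq with hj | rfl
  · exact h4 j (Finset.mem_range.mpr hj)
  · rw [qFact_self _ hN.pos.ne']
    refine mul_ne_zero (h4 _ (Finset.mem_range.mpr (Nat.sub_lt hN.pos one_pos))) ?_
    exact div_ne_zero h3 h2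

theorem tendsto_inv_qz_mul (hN : Odd N) (hs : IsPrimitiveRoot s (2 * N))
    {f : ℂ → ℂ} {f' : ℂ} (hf : HasDerivAt f f' s) (hf0 : f s = 0) :
    ∃ l, Tendsto (fun t => (qz (t ^ 2) N)⁻¹ * f t) (𝓝[≠] s) (𝓝 l) := by
  have hs0 := ne_zero_of_primitive hN hs
  have h2 : ContinuousAt (fun t : ℂ => t ^ 2 - (t ^ 2)⁻¹) s := by
    have h2 : ContinuousAt (fun t : ℂ => t ^ 2) s := by fun_prop
    exact h2.sub (h2.inv₀ (pow_ne_zero 2 hs0))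
  have h0 : (fun t : ℂ => (t ^ 2) ^ (N : ℤ) - (t ^ 2) ^ (-(N : ℤ))) s = 0 := by
    simp only
    rw [sq_zpow_eq_one hN hs (dvd_refl _), sq_zpow_eq_one hN hs (dvd_refl _).neg_right, sub_self]
  have h := (tendsto_div_of_hasDerivAt hf (hasDerivAt_zpow_sub hN hs (dvd_refl (N : ℤ))) hf0 h0
    (four_mul_natCast_ne_zero hN hs)).mul (h2.tendsto.mono_left (nhdsWithin_le_nhds (s := {s}ᶜ)))
  refine ⟨_, h.congr fun t => ?_⟩
  rw [qz, inv_div, div_mul_eq_mul_div, div_mul_eq_mul_div, mul_comm (f t)]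

/-- The family `X` of operators has entries differentiable at `s`. -/
def EntriesDifferentiableAt (X : ℂ → Op N L) (s : ℂ) : Prop :=
  ∀ σ τ, DifferentiableAt ℂ (fun t => X t σ τ) s

theorem EntriesDifferentiableAt.pow {X : ℂ → Op N L} (h : EntriesDifferentiableAt X s) (n : ℕ) :
    EntriesDifferentiableAt (fun t => X t ^ n) s := by
  induction n with
  | zero => intro σ τ; simp only [pow_zero]; exact differentiableAt_const _
  | succ n ih =>
    intro σ τ
    simp only [pow_succ, Matrix.mul_apply]
    exact DifferentiableAt.fun_sum fun ρ _ => (ih σ ρ).mul (h ρ τ)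

theorem EntriesDifferentiableAt.tendsto {X : ℂ → Op N L} (h : EntriesDifferentiableAt X s) :
    Tendsto X (𝓝[≠] s) (𝓝 (X s)) := by
  refine tendsto_pi_nhds.mpr fun σ => tendsto_pi_nhds.mpr fun τ => ?_
  exact (h σ τ).continuousAt.tendsto.mono_left nhdsWithin_le_nhds

/-- Each entry of `X ^ N` is differentiable and vanishes at `s`. Of the factors of `[N]!` only `[N]`
vanishes there, and to first order, so the quotient converges. -/
theorem exists_isDividedPowerLimit (hN : Odd N) (hN1 : N ≠ 1) (hs : IsPrimitiveRoot s (2 * N))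
    {X : ℂ → Op N L} (hX : EntriesDifferentiableAt X s) (h0 : X s ^ N = 0) :
    ∃ M, IsDividedPowerLimit X N s M := by
  have key (σ τ : Fin L → Fin N) : ∃ l, Tendsto (fun t => ((qFact (t ^ 2) N)⁻¹ • X t ^ N) σ τ)
      (𝓝[≠] s) (𝓝 l) := by
    obtain ⟨l, hl⟩ := tendsto_inv_qz_mul hN hs (hX.pow N σ τ).hasDerivAt
      (by simp only [h0]; rfl)
    have h1 := ((continuousAt_qFact hN hN1 hs (N - 1)).inv₀
      (qFact_ne_zero hN hs (Nat.sub_lt hN.pos one_pos))).tendsto.mono_left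
      (nhdsWithin_le_nhds (s := {s}ᶜ))
    refine ⟨_, (h1.mul hl).congr fun t => ?_⟩
    rw [Matrix.smul_apply, smul_eq_mul, qFact_self _ hN.pos.ne', mul_inv, Pi.inv_apply, mul_assoc]
  choose M hM using key
  exact ⟨Matrix.of M, tendsto_pi_nhds.mpr fun σ => tendsto_pi_nhds.mpr fun τ => hM σ τ⟩

theorem differentiableAt_kHalfPow (hs : s ≠ 0) (r : ℤ) (a b : Fin N) :
    DifferentiableAt ℂ (fun t => kHalfPow N t r a b) s := by
  simp only [kHalfPow, Matrix.diagonal_apply]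
  split_ifs
  · exact differentiableAt_zpow.mpr (Or.inl hs)
  · exact differentiableAt_const _

theorem differentiableAt_qInt (hs : s ≠ 0) (hs' : s ^ 2 - (s ^ 2)⁻¹ ≠ 0) (m : ℕ) :
    DifferentiableAt ℂ (fun t => qInt (t ^ 2) m) s := by
  have hne : s ^ 2 ≠ 0 := pow_ne_zero 2 hs
  have h2 : DifferentiableAt ℂ (fun t : ℂ => t ^ 2) s := by fun_prop
  exact ((h2.pow m).sub ((h2.inv hne).pow m)).div (h2.sub (h2.inv hne)) hs'

theorem entriesDifferentiableAt_chainOp {c : ℂ → Fin L → ℂ} {u x w : ℂ → LocalOp N}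
    (hc : ∀ i, DifferentiableAt ℂ (fun t => c t i) s)
    (hu : ∀ a b, DifferentiableAt ℂ (fun t => u t a b) s)
    (hx : ∀ a b, DifferentiableAt ℂ (fun t => x t a b) s)
    (hw : ∀ a b, DifferentiableAt ℂ (fun t => w t a b) s) :
    EntriesDifferentiableAt (fun t => chainOp (c t) (u t) (x t) (w t)) s := by
  intro σ τ
  simp only [chainOp, Matrix.sum_apply, Matrix.smul_apply, smul_eq_mul, tensorOp_apply]
  refine DifferentiableAt.fun_sum fun i _ => (hc i).mul (DifferentiableAt.fun_finsetProd ?_)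
  intro j _
  unfold chainFactor
  split_ifs
  · exact hu _ _
  · exact hx _ _
  · exact hw _ _

theorem entriesDifferentiableAt_opB (hs : s ≠ 0) (hs' : s ^ 2 - (s ^ 2)⁻¹ ≠ 0) (ε : ℤ) :
    EntriesDifferentiableAt (fun t => opB N L t ε) s := by
  simp only [opB_eq_chainOp]
  refine entriesDifferentiableAt_chainOp (fun i => differentiableAt_zpow.mpr (Or.inl hs))
    (differentiableAt_kHalfPow hs _) (fun a b => ?_) (differentiableAt_kHalfPow hs _)
  simp only [fOp, Matrix.of_apply]
  split_ifs
  · exact differentiableAt_qInt hs hs' _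
  · exact differentiableAt_const _

theorem entriesDifferentiableAt_opC (hs : s ≠ 0) (hs' : s ^ 2 - (s ^ 2)⁻¹ ≠ 0) (ε : ℤ) :
    EntriesDifferentiableAt (fun t => opC N L t ε) s := by
  simp only [opC_eq_chainOp]
  refine entriesDifferentiableAt_chainOp (fun i => differentiableAt_zpow.mpr (Or.inl hs))
    (differentiableAt_kHalfPow hs _) (fun a b => ?_) (differentiableAt_kHalfPow hs _)
  simp only [eOp, Matrix.of_apply]
  split_ifs
  · exact differentiableAt_qInt hs hs' _
  · exact differentiableAt_const _

/-! ### Relations between the limits -/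

theorem HasWeight.limit {X : ℂ → Op N L} {d : ℤ} (hX : ∀ t, HasWeight d (X t)) {n : ℕ}
    {M : Op N L} (hM : IsDividedPowerLimit X n s M) : HasWeight (n * d) M := by
  intro g
  refine tendsto_nhds_unique (hM.const_mul (wtOp N L g)) ?_
  refine (hM.mul_const (wtOp N L fun m => g (m + n * d))).congr fun t => ?_
  exact (((hX t).pow n).smul _ g).symm

theorem IsDividedPowerLimit.commute (hN : Odd N) (hs : IsPrimitiveRoot s (2 * N))
    {X Y : ℂ → Op N L} (hXY : ∀ t ≠ 0, Commute (X t) (Y t)) {n : ℕ} {A B : Op N L}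
    (hA : IsDividedPowerLimit X n s A) (hB : IsDividedPowerLimit Y n s B) : A * B = B * A := by
  have hs0 := ne_zero_of_primitive hN hs
  refine tendsto_nhds_unique (hA.mul hB) ((hB.mul hA).congr' ?_)
  filter_upwards [(continuousAt_id.eventually_ne hs0).filter_mono
    (nhdsWithin_le_nhds (s := {s}ᶜ))] with t ht
  exact ((((hXY t ht).pow_pow n n).smul_left _).smul_right _).eq.symm

theorem neg_one_pow_even_prod {n : ℕ} (hn : Even n) (g : ℕ → ℂ) :
    ∏ i ∈ Finset.range n, -g i = ∏ i ∈ Finset.range n, g i := by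
  rw [Finset.prod_neg, Finset.card_range, hn.neg_one_pow, one_mul]

/-- The Cartan coefficients in the commutator of divided powers, on vectors of weight divisible
by `N`. -/
theorem tendsto_cartanCoeff (hN : Odd N) (hN1 : N ≠ 1) (hs : IsPrimitiveRoot s (2 * N)) {m : ℤ}
    (hm : (N : ℤ) ∣ m) {j : ℕ} (hj : j < N) :
    Tendsto (fun t => (∏ i ∈ Finset.range (j + 1), qz (t ^ 2) (m - i)) / qFact (t ^ 2) (j + 1))
      (𝓝[≠] s) (𝓝 (if j + 1 = N then (m : ℂ) / N else 0)) := by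
  have hc (k : ℤ) : Tendsto (fun t => qz (t ^ 2) k) (𝓝[≠] s) (𝓝 (qz (s ^ 2) k)) :=
    (continuousAt_qz hN hN1 hs k).tendsto.mono_left nhdsWithin_le_nhds
  have hf (k : ℕ) : Tendsto (fun t => qFact (t ^ 2) k) (𝓝[≠] s) (𝓝 (qFact (s ^ 2) k)) :=
    (continuousAt_qFact hN hN1 hs k).tendsto.mono_left nhdsWithin_le_nhds
  split_ifs with hjN
  · have h1 : Tendsto (fun t => qz (t ^ 2) m / qz (t ^ 2) N) (𝓝[≠] s) (𝓝 ((m : ℂ) / N)) := by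
      have h0 (m : ℤ) (hm : (N : ℤ) ∣ m) :
          (fun t : ℂ => (t ^ 2) ^ m - (t ^ 2) ^ (-m)) s = 0 := by
        simp only
        rw [sq_zpow_eq_one hN hs hm, sq_zpow_eq_one hN hs hm.neg_right, sub_self]
      have h2 := tendsto_div_of_hasDerivAt (hasDerivAt_zpow_sub hN hs hm)
        (hasDerivAt_zpow_sub hN hs (dvd_refl (N : ℤ))) (h0 m hm) (h0 N (dvd_refl _))
        (four_mul_natCast_ne_zero hN hs)
      have h3 : 4 * (m : ℂ) * s⁻¹ / (4 * ((N : ℤ) : ℂ) * s⁻¹) = m / N := by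
        have hs0 := ne_zero_of_primitive hN hs
        rw [mul_div_mul_right _ _ (inv_ne_zero hs0), mul_div_mul_left _ _ (by norm_num),
          Int.cast_natCast]
      rw [h3] at h2
      refine h2.congr' ?_
      filter_upwards [eventually_generic hN hN1 hs] with t ht
      rw [qz, qz, div_div_div_cancel_right₀ ht.2.1]
    -- Since `q ^ m = 1`, the product over `i = 1, …, N - 1` is `[N - 1]!` up to the sign
    -- `(-1)^{N-1}`, which is `1` because `N` is odd.
    have hper (i : ℕ) : qz (s ^ 2) (m - i) = -qz (s ^ 2) i := by
      have hs0 := pow_ne_zero 2 (ne_zero_of_primitive hN hs)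
      rw [← qz_neg, qz, qz, neg_sub, neg_neg, zpow_sub₀ hs0, zpow_sub₀ hs0,
        sq_zpow_eq_one hN hs hm, div_one, one_div, ← zpow_neg]
    have h4 : Tendsto (fun t => (∏ i ∈ Finset.range j, qz (t ^ 2) (m - (i + 1 : ℕ))) /
        qFact (t ^ 2) j) (𝓝[≠] s) (𝓝 1) := by
      have h5 := (tendsto_finsetProd (Finset.range j) fun i _ => hc (m - (i + 1 : ℕ))).div (hf j)
        (qFact_ne_zero hN hs hj)
      have h6 : (∏ i ∈ Finset.range j, qz (s ^ 2) (m - (i + 1 : ℕ))) = qFact (s ^ 2) j := by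
        rw [Finset.prod_congr rfl fun i _ => hper (i + 1), neg_one_pow_even_prod, qFact]
        · exact Finset.prod_congr rfl fun i _ => (qInt_eq_qz _ _).symm
        · rw [← hjN] at hN
          simpa [parity_simps] using hN
      rw [h6, div_self (qFact_ne_zero hN hs hj)] at h5
      exact h5
    have h7 := h1.mul h4
    rw [mul_one] at h7
    refine h7.congr fun t => ?_
    rw [Finset.prod_range_succ', qFact_succ, hjN, Nat.cast_zero, sub_zero, div_mul_div_comm,
      mul_comm (qz _ m), mul_comm (qz _ (N : ℤ))]
  -- Below the top degree the denominator has a nonzero limit, and the factor at `i = 0` tends to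
  -- `[m] = 0`.
  · have h5 := (tendsto_finsetProd (Finset.range (j + 1)) fun i _ => hc (m - (i : ℕ))).div
      (hf (j + 1)) (qFact_ne_zero hN hs (by omega))
    rw [Finset.prod_range_succ', Nat.cast_zero, sub_zero, qz_eq_zero hN hs hm, mul_zero,
      zero_div] at h5
    exact h5

/-- The indicator function of weights divisible by `N`. -/
def sectorWeight (N : ℕ) (m : ℤ) : ℂ := if (N : ℤ) ∣ m then 1 else 0

theorem tendsto_wtOp {ι : Type*} {l : Filter ι} {g : ι → ℤ → ℂ} {g' : ℤ → ℂ}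
    (h : ∀ m, Tendsto (fun t => g t m) l (𝓝 (g' m))) :
    Tendsto (fun t => wtOp N L (g t)) l (𝓝 (wtOp N L g')) := by
  refine tendsto_pi_nhds.mpr fun σ => tendsto_pi_nhds.mpr fun τ => ?_
  simp only [wtOp, Matrix.diagonal_apply]
  split_ifs
  · exact h _
  · exact tendsto_const_nhds

/-- Passing to the limit in `dividedPow_commutator`, with the projector to weights divisible by `N`
on the right. Only the term `j + 1 = N` survives, and there the powers of `B` and `C` and the
factorial prefactor are all trivial. -/
theorem IsDividedPowerLimit.commutator (hN : Odd N) (hN1 : N ≠ 1) (hs : IsPrimitiveRoot s (2 * N))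
    {ε : ℤ} (hε : ε = 1 ∨ ε = -1) {C B : Op N L}
    (hC : IsDividedPowerLimit (fun t => opC N L t (-ε)) N s C)
    (hB : IsDividedPowerLimit (fun t => opB N L t ε) N s B) :
    (C * B - B * C) * wtOp N L (sectorWeight N) =
      (wtOp N L fun m => (m : ℂ) / N) * wtOp N L (sectorWeight N) := by
  have hs0 := ne_zero_of_primitive hN hs
  have hs' := sq_sub_inv_ne_zero hN hN1 hs
  refine tendsto_nhds_unique
    (((hC.mul hB).sub (hB.mul hC)).mul_const (wtOp N L (sectorWeight N))) ?_
  have hterm (j : ℕ) (hj : j ∈ Finset.range N) : Tendsto (fun t =>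
      (qFact (t ^ 2) (N - (j + 1)))⁻¹ ^ 2 •
        (opB N L t ε ^ (N - (j + 1)) * opC N L t (-ε) ^ (N - (j + 1)) *
          (wtOp N L (fun m => (∏ i ∈ Finset.range (j + 1), qz (t ^ 2) (m - i)) /
            qFact (t ^ 2) (j + 1)) * wtOp N L (sectorWeight N)))) (𝓝[≠] s)
      (𝓝 ((qFact (s ^ 2) (N - (j + 1)))⁻¹ ^ 2 •
        (opB N L s ε ^ (N - (j + 1)) * opC N L s (-ε) ^ (N - (j + 1)) *
          wtOp N L (fun m => if j + 1 = N then (m : ℂ) / N * sectorWeight N m else 0)))) := by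
    have hjN := Finset.mem_range.mp hj
    have h1 := ((continuousAt_qFact hN hN1 hs (N - (j + 1))).inv₀
      (qFact_ne_zero hN hs (by omega))).tendsto.mono_left (nhdsWithin_le_nhds (s := {s}ᶜ))
    refine (h1.pow 2).smul (Tendsto.mul (Tendsto.mul
      (((entriesDifferentiableAt_opB hs0 hs' ε).pow _).tendsto)
      (((entriesDifferentiableAt_opC hs0 hs' (-ε)).pow _).tendsto)) ?_)
    simp only [wtOp_mul]
    refine tendsto_wtOp fun m => ?_
    by_cases hm : (N : ℤ) ∣ m
    · simpa only [sectorWeight, if_pos hm, mul_one] using tendsto_cartanCoeff hN hN1 hs hm hjN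
    · simpa only [sectorWeight, if_neg hm, mul_zero, ite_self] using tendsto_const_nhds
  have hsum := tendsto_finsetSum (Finset.range N) hterm
  have hlim : (∑ j ∈ Finset.range N, (qFact (s ^ 2) (N - (j + 1)))⁻¹ ^ 2 •
        (opB N L s ε ^ (N - (j + 1)) * opC N L s (-ε) ^ (N - (j + 1)) *
          wtOp N L (fun m => if j + 1 = N then (m : ℂ) / N * sectorWeight N m else 0))) =
      (wtOp N L fun m => (m : ℂ) / N) * wtOp N L (sectorWeight N) := by
    rw [Finset.sum_eq_single (N - 1)]
    · have h1 : N - 1 + 1 = N := Nat.sub_add_cancel hN.pos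
      simp [h1, wtOp_mul, qFact]
    · intro j hj hne
      have : j + 1 ≠ N := by omega
      simp [this, wtOp_zero]
    · intro h
      exact absurd (Finset.mem_range.mpr (Nat.sub_lt hN.pos one_pos)) h
  rw [hlim] at hsum
  refine hsum.congr' ?_
  filter_upwards [eventually_generic hN hN1 hs] with t ht
  rw [dividedPow_commutator (pow_ne_zero 2 ht.1) ht.2.1 (hasWeight_opC _) (hasWeight_opB _)
    (opC_opB_commutator ht.1 ht.2.1 hε) ht.2.2, Finset.sum_mul]
  refine Finset.sum_congr rfl fun j _ => ?_
  rw [smul_mul_assoc, mul_assoc _ (wtOp N L _)]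

end Limits

/-! ### Intertwining relations for the monodromy matrix -/

section Intertwine

/-- The auxiliary operator `X` is carried through the product one site at a time, changing its form
at each step. -/
theorem prod_reverse_ofFn_intertwine {R : Type*} [Monoid R] {L : ℕ} (M M' : Fin L → R) (X : ℕ → R)
    (h : ∀ j : Fin L, M j * X j = X (j + 1) * M' j) :
    (List.ofFn M).reverse.prod * X 0 = X L * (List.ofFn M').reverse.prod := by
  induction L generalizing X with
  | zero => simp
  | succ L ih =>
    have h1 := ih (fun i => M i.succ) (fun i => M' i.succ) (fun n => X (n + 1)) fun j => h j.succ
    have h2 : M 0 * X 0 = X 1 * M' 0 := h 0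
    rw [List.ofFn_succ, List.ofFn_succ, List.reverse_cons, List.reverse_cons, List.prod_append,
      List.prod_append, List.prod_singleton, List.prod_singleton, mul_assoc, h2, ← mul_assoc, h1,
      mul_assoc]

/-- The `2 × 2` matrix with entries `D_{ab} • M`. -/
def scal {R : Type*} [SMul ℂ R] (D : Matrix (Fin 2) (Fin 2) ℂ) (M : R) :
    Matrix (Fin 2) (Fin 2) R := D.map (· • M)

variable {N L : ℕ}

theorem map_siteOp_mul (M : Fin L → LocalOp N) (j : Fin L)
    (Y Z : Matrix (Fin 2) (Fin 2) (LocalOp N)) :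
    Y.map (siteOp j) * Z.map (tensorAt M j) = (Y * Z).map (tensorAt M j) := by
  ext1 a b
  simp only [Matrix.mul_apply, Matrix.map_apply, siteOp_mul_tensorAt, map_sum]

theorem mul_map_siteOp (M : Fin L → LocalOp N) (j : Fin L)
    (Y Z : Matrix (Fin 2) (Fin 2) (LocalOp N)) :
    Y.map (tensorAt M j) * Z.map (siteOp j) = (Y * Z).map (tensorAt M j) := by
  ext1 a b
  simp only [Matrix.mul_apply, Matrix.map_apply, tensorAt_mul_siteOp, map_sum]

theorem smul_scal_tensorAt (M : Fin L → LocalOp N) (j : Fin L) (c : ℂ)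
    (D : Matrix (Fin 2) (Fin 2) ℂ) (A : LocalOp N) :
    c • scal D (tensorAt M j A) = (c • scal D A).map (tensorAt M j) := by
  ext1 a b
  simp only [scal, Matrix.map_apply, Matrix.smul_apply, map_smul]

/-- The exchange of two coproducts on `ℂ² ⊗ (ℂ^N)^{⊗L}`. Three local relations suffice: two for the
Cartan dressings `u`, `w`, and one for the insertion at the site being crossed. -/
theorem monodromy_intertwine {ℓ : Matrix (Fin 2) (Fin 2) (LocalOp N)} {c : Fin L → ℂ}
    {ω : ℕ → ℂ} {u x w : LocalOp N} {D₀ D₁ ε : Matrix (Fin 2) (Fin 2) ℂ}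
    (h0 : ℓ * scal D₀ u = scal D₀ u * ℓ) (h1 : ℓ * scal D₁ w = scal D₁ w * ℓ)
    (h : ∀ j : Fin L, ℓ * (c j • scal D₀ x + ω j • scal ε w) =
      (c j • scal D₁ x + ω (j + 1) • scal ε u) * ℓ) :
    monodromy L ℓ * (scal D₀ (chainOp c u x w) + ω 0 • scal ε (tensorOp fun _ => w)) =
      (scal D₁ (chainOp c u x w) + ω L • scal ε (tensorOp fun _ => u)) * monodromy L ℓ := by
  -- The operator once the auxiliary space has passed the sites below `j`. Insertions already passed
  -- carry `D₁`, the others `D₀`; the term acting on the auxiliary space itself has dressing `u` on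
  -- the sites passed and `w` on the rest.
  set X : ℕ → Matrix (Fin 2) (Fin 2) (Op N L) := fun j =>
    ∑ i : Fin L, c i • scal (if (i : ℕ) < j then D₁ else D₀) (tensorOp (chainFactor i u x w)) +
      ω j • scal ε (tensorOp fun l : Fin L => if (l : ℕ) < j then u else w) with hX
  have hscal (D : Matrix (Fin 2) (Fin 2) ℂ) :
      ∑ i : Fin L, c i • scal D (tensorOp (chainFactor i u x w)) =
        scal D (chainOp c u x w) := by
    ext1 a b
    simp only [Matrix.sum_apply, scal, Matrix.map_apply, Matrix.smul_apply, chainOp,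
      Finset.smul_sum, smul_comm (D a b)]
  have hX0 : X 0 = scal D₀ (chainOp c u x w) + ω 0 • scal ε (tensorOp fun _ => w) := by
    simp [hX, hscal]
  have hXL : X L = scal D₁ (chainOp c u x w) + ω L • scal ε (tensorOp fun _ => u) := by
    simp [hX, hscal]
  rw [← hX0, ← hXL]
  refine prod_reverse_ofFn_intertwine _ _ X fun j => ?_
  have hG (y : LocalOp N) : tensorAt (chainFactor j u x w) j y =
      tensorOp (chainFactor j u y w) := by rw [tensorAt_apply, update_chainFactor]
  have hcf : (fun l : Fin L => if (l : ℕ) < j then u else w) = chainFactor j u w w := by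
    funext l
    simp [chainFactor]
  have hcf' : (fun l : Fin L => if (l : ℕ) < j + 1 then u else w) = chainFactor j u u w := by
    funext l
    unfold chainFactor
    rcases lt_trichotomy l j with h | h | h
    · simp [h, Nat.lt_succ_of_lt (Fin.lt_def.mp h)]
    · simp [h]
    · have : ¬ (l : ℕ) < j + 1 := by have := Fin.lt_def.mp h; omega
      simp [h.not_gt, h.ne', this]
  -- The insertion at `j` and the auxiliary term are separated off: they mix when site `j` is
  -- crossed. Every other term shows only `u` or `w` at that site.
  have e1 : X j = (∑ i ∈ Finset.univ.erase j, (c i • scal (if i < j then D₁ else D₀)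
      (chainFactor i u x w j)).map (tensorAt (chainFactor i u x w) j)) +
      (c j • scal D₀ x + ω j • scal ε w).map (tensorAt (chainFactor j u x w) j) := by
    rw [Matrix.map_add _ (map_add _), ← smul_scal_tensorAt, ← smul_scal_tensorAt, hG, hG,
      ← add_assoc, Finset.sum_congr rfl fun i _ => (smul_scal_tensorAt (chainFactor i u x w) j
        (c i) (if i < j then D₁ else D₀) (chainFactor i u x w j)).symm]
    simp only [tensorAt_self]
    have := Finset.sum_erase_add (Finset.univ : Finset (Fin L)) (fun i => c i •
      scal (if i < j then D₁ else D₀) (tensorOp (chainFactor i u x w))) (Finset.mem_univ j)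
    rw [if_neg (lt_irrefl j)] at this
    rw [this, ← hcf, hX]
    rfl
  have e2 : X (j + 1) = (∑ i ∈ Finset.univ.erase j, (c i • scal (if i < j then D₁ else D₀)
      (chainFactor i u x w j)).map (tensorAt (chainFactor i u x w) j)) +
      (c j • scal D₁ x + ω (j + 1) • scal ε u).map (tensorAt (chainFactor j u x w) j) := by
    rw [Matrix.map_add _ (map_add _), ← smul_scal_tensorAt, ← smul_scal_tensorAt, hG, hG,
      ← add_assoc, Finset.sum_congr rfl fun i _ => (smul_scal_tensorAt (chainFactor i u x w) j
        (c i) (if i < j then D₁ else D₀) (chainFactor i u x w j)).symm]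
    simp only [tensorAt_self]
    have := Finset.sum_erase_add (Finset.univ : Finset (Fin L)) (fun i => c i •
      scal (if (i : ℕ) < j + 1 then D₁ else D₀) (tensorOp (chainFactor i u x w)))
      (Finset.mem_univ j)
    rw [if_pos (Nat.lt_succ_self _)] at this
    have h3 : ∑ i ∈ Finset.univ.erase j, c i • scal (if i < j then D₁ else D₀)
        (tensorOp (chainFactor i u x w)) = ∑ i ∈ Finset.univ.erase j, c i •
        scal (if (i : ℕ) < j + 1 then D₁ else D₀) (tensorOp (chainFactor i u x w)) := by
      refine Finset.sum_congr rfl fun i hi => ?_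
      have hij : (i : ℕ) ≠ j := fun h => Finset.ne_of_mem_erase hi (Fin.ext h)
      have : i < j ↔ (i : ℕ) < j + 1 := by rw [Fin.lt_def]; omega
      simp only [this]
    rw [h3, this, ← hcf', hX]
  rw [e1, e2, mul_add, add_mul, Finset.mul_sum, Finset.sum_mul, map_siteOp_mul, mul_map_siteOp, h j]
  congr 1
  refine Finset.sum_congr rfl fun i hi => ?_
  rw [map_siteOp_mul, mul_map_siteOp]
  congr 1
  rw [Matrix.mul_smul, Matrix.smul_mul]
  congr 1
  rcases lt_or_gt_of_ne (Finset.ne_of_mem_erase hi) with hij | hij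
  · rw [if_pos hij, show chainFactor i u x w j = w by simp [chainFactor, hij.ne', hij.not_gt], h1]
  · rw [if_neg hij.not_gt, show chainFactor i u x w j = u by simp [chainFactor, hij], h0]

theorem monodromy_commute_tensorOp {ℓ : Matrix (Fin 2) (Fin 2) (LocalOp N)} {k : LocalOp N}
    {D : Matrix (Fin 2) (Fin 2) ℂ} (h : ℓ * scal D k = scal D k * ℓ) :
    monodromy L ℓ * scal D (tensorOp fun _ => k) = scal D (tensorOp fun _ => k) * monodromy L ℓ := by
  refine prod_reverse_ofFn_intertwine _ _ (fun _ => scal D (tensorOp fun _ => k)) fun j => ?_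
  have hk : scal D (tensorOp fun _ : Fin L => k) =
      (scal D k).map (tensorAt (fun _ => k) j) := by
    rw [← one_smul ℂ (scal D k), ← smul_scal_tensorAt, one_smul, tensorAt_self]
  rw [hk, map_siteOp_mul, mul_map_siteOp, h]

end Intertwine

/-! ### Local intertwining relations -/

section LocalIntertwine

set_option linter.unusedSimpArgs false

variable {N : ℕ} {t z : ℂ}

/-- The diagonal matrix `diag(t^r, t^{-r})`. -/
def kappa (t : ℂ) (r : ℤ) : Matrix (Fin 2) (Fin 2) ℂ := !![t ^ r, 0; 0, t ^ (-r)]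

/-- Conservation of weight: the total weight of the auxiliary and the quantum space is preserved
entry by entry. -/
theorem localXXZ_commute (ht : t ≠ 0) (r : ℤ) :
    localXXZ N t z * scal (kappa t r) (kHalfPow N t r) =
      scal (kappa t r) (kHalfPow N t r) * localXXZ N t z := by
  have hf : kHalfPow N t r * fOp N t = (t ^ r * t ^ r)⁻¹ • (fOp N t * kHalfPow N t r) := by
    rw [kHalfPow_mul_fOp ht, ← zpow_add₀ ht, ← zpow_neg]; congr 2; ring
  have he : kHalfPow N t r * eOp N t = (t ^ r * t ^ r) • (eOp N t * kHalfPow N t r) := by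
    rw [kHalfPow_mul_eOp ht, ← zpow_add₀ ht]; congr 2; ring
  have h1 := (kHalfPow_commute (N := N) (s := t) r 1).eq
  have h2 := (kHalfPow_commute (N := N) (s := t) r (-1)).eq
  have hR : t ^ r ≠ 0 := zpow_ne_zero r ht
  ext1 a b
  fin_cases a <;> fin_cases b <;>
    simp only [Matrix.mul_apply, Fin.sum_univ_two, scal, Matrix.map_apply, localXXZ, kappa,
      Matrix.of_apply, Matrix.cons_val', Matrix.cons_val_zero, Matrix.cons_val_one, Fin.zero_eta,
      Fin.mk_one, Matrix.cons_val_fin_one, mul_smul_comm, smul_mul_assoc, mul_sub, sub_mul, h1, h2,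
      hf, he, zero_smul, mul_zero, zero_mul, add_zero, zero_add, zpow_neg] <;>
    match_scalars <;> field_simp

/-- Relations between `k`, `k⁻¹`, `e`, `f` in the form used below. -/
theorem kHalfPow_relations (ht : t ≠ 0) :
    kHalfPow N t 1 * fOp N t = (t ^ 2)⁻¹ • (fOp N t * kHalfPow N t 1) ∧
    kHalfPow N t (-1) * fOp N t = t ^ 2 • (fOp N t * kHalfPow N t (-1)) ∧
    kHalfPow N t 1 * eOp N t = t ^ 2 • (eOp N t * kHalfPow N t 1) ∧
    kHalfPow N t (-1) * eOp N t = (t ^ 2)⁻¹ • (eOp N t * kHalfPow N t (-1)) ∧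
    kHalfPow N t 1 * kHalfPow N t 1 = kHalfPow N t 2 ∧
    kHalfPow N t (-1) * kHalfPow N t (-1) = kHalfPow N t (-2) ∧
    kHalfPow N t 1 * kHalfPow N t (-1) = 1 ∧
    kHalfPow N t (-1) * kHalfPow N t 1 = 1 := by
  refine ⟨?_, ?_, ?_, ?_, ?_, ?_, ?_, ?_⟩
  · rw [kHalfPow_mul_fOp ht, mul_one, zpow_neg]; norm_cast
  · rw [kHalfPow_mul_fOp ht, neg_mul_neg, mul_one]; norm_cast
  · rw [kHalfPow_mul_eOp ht, mul_one]; norm_cast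
  · rw [kHalfPow_mul_eOp ht, mul_neg_one, zpow_neg]; norm_cast
  · rw [kHalfPow_mul ht]; rfl
  · rw [kHalfPow_mul ht]; rfl
  · rw [kHalfPow_mul ht, add_neg_cancel, kHalfPow_zero]
  · rw [kHalfPow_mul ht, neg_add_cancel, kHalfPow_zero]

theorem pow_four_sub_one_ne_zero (ht : t ≠ 0) (ht' : t ^ 2 - (t ^ 2)⁻¹ ≠ 0) : t ^ 4 - 1 ≠ 0 := by
  intro h
  refine ht' ?_
  field_simp
  linear_combination h

theorem eOp_mul_fOp_eq (ht : t ≠ 0) (ht' : t ^ 2 - (t ^ 2)⁻¹ ≠ 0) :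
    eOp N t * fOp N t = fOp N t * eOp N t +
      (t ^ 2 / (t ^ 4 - 1)) • (kHalfPow N t 2 - kHalfPow N t (-2)) := by
  have h := pow_four_sub_one_ne_zero ht ht'
  have h1 : t ^ 2 / (t ^ 4 - 1) * (t ^ 2 - (t ^ 2)⁻¹) = 1 := by field_simp
  rw [← smul_eOp_fOp_commutator ht ht', smul_smul, h1, one_smul, add_sub_cancel]

/-- The one-site intertwining relation for a Chevalley generator on `ℂ² ⊗ ℂ^N`, with the
`z`-dependence carried by the first factor. It is checked entrywise; beyond the weight relations it
needs only the commutator of `e` and `f`. -/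
theorem localXXZ_intertwine_fOp (ht : t ≠ 0) (ht' : t ^ 2 - (t ^ 2)⁻¹ ≠ 0) (hz : z ≠ 0) {ε : ℤ}
    (hε : ε = 1 ∨ ε = -1) :
    localXXZ N t z * (scal (kappa t (-ε)) (fOp N t) +
        (z ^ ε * t ^ (-1 - ε)) • scal !![0, 0; 1, 0] (kHalfPow N t ε)) =
      (scal (kappa t ε) (fOp N t) +
        (z ^ ε * t ^ (1 - ε)) • scal !![0, 0; 1, 0] (kHalfPow N t (-ε))) * localXXZ N t z := by
  obtain ⟨h1, h2, h3, h4, h5, h6, h7, h8⟩ := kHalfPow_relations (N := N) ht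
  have h10 := pow_four_sub_one_ne_zero ht ht'
  have h9 := eOp_mul_fOp_eq (N := N) ht ht'
  have e1 : t ^ (-1 - 1 : ℤ) = (t ^ 2)⁻¹ := by rw [← zpow_natCast, ← zpow_neg]; rfl
  have e2 : t ^ (1 - -1 : ℤ) = t ^ 2 := by rw [← zpow_natCast]; rfl
  have e3 : t ^ (1 + 1 : ℤ) = t ^ 2 := e2
  rcases hε with rfl | rfl
  all_goals
    ext1 a b
    fin_cases a <;> fin_cases b <;>
    simp only [Matrix.mul_apply, Fin.sum_univ_two, scal, Matrix.map_apply, localXXZ, kappa,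
      Matrix.add_apply, Matrix.smul_apply, smul_smul, neg_neg, zpow_one, zpow_neg_one,
      sub_self, zpow_zero, mul_one, one_smul, e1, e2, e3, sub_neg_eq_add, neg_add_cancel,
      Matrix.of_apply, Matrix.cons_val', Matrix.cons_val_zero, Matrix.cons_val_one, Fin.zero_eta,
      Fin.mk_one, Matrix.cons_val_fin_one, mul_smul_comm, smul_mul_assoc, mul_sub, sub_mul,
      mul_add, add_mul, h1, h2, h3, h4, h5, h6, h7, h8, h9, smul_add, smul_sub, mul_zero,
      zero_smul, add_zero, zero_add] <;>
    match_scalars <;> field_simp <;> ring_nf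

theorem localXXZ_intertwine_eOp (ht : t ≠ 0) (ht' : t ^ 2 - (t ^ 2)⁻¹ ≠ 0) (hz : z ≠ 0) {ε : ℤ}
    (hε : ε = 1 ∨ ε = -1) :
    localXXZ N t z * (scal (kappa t ε) (eOp N t) +
        (z ^ ε * t ^ (1 - ε)) • scal !![0, 1; 0, 0] (kHalfPow N t (-ε))) =
      (scal (kappa t (-ε)) (eOp N t) +
        (z ^ ε * t ^ (-1 - ε)) • scal !![0, 1; 0, 0] (kHalfPow N t ε)) * localXXZ N t z := by
  obtain ⟨h1, h2, h3, h4, h5, h6, h7, h8⟩ := kHalfPow_relations (N := N) ht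
  have h10 := pow_four_sub_one_ne_zero ht ht'
  have h9 := eOp_mul_fOp_eq (N := N) ht ht'
  have e1 : t ^ (-1 - 1 : ℤ) = (t ^ 2)⁻¹ := by rw [← zpow_natCast, ← zpow_neg]; rfl
  have e2 : t ^ (1 - -1 : ℤ) = t ^ 2 := by rw [← zpow_natCast]; rfl
  have e3 : t ^ (1 + 1 : ℤ) = t ^ 2 := e2
  rcases hε with rfl | rfl
  all_goals
    ext1 a b
    fin_cases a <;> fin_cases b <;>
    simp only [Matrix.mul_apply, Fin.sum_univ_two, scal, Matrix.map_apply, localXXZ, kappa,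
      Matrix.add_apply, Matrix.smul_apply, smul_smul, neg_neg, zpow_one, zpow_neg_one,
      sub_self, zpow_zero, mul_one, one_smul, e1, e2, e3, sub_neg_eq_add, neg_add_cancel,
      Matrix.of_apply, Matrix.cons_val', Matrix.cons_val_zero, Matrix.cons_val_one, Fin.zero_eta,
      Fin.mk_one, Matrix.cons_val_fin_one, mul_smul_comm, smul_mul_assoc, mul_sub, sub_mul,
      mul_add, add_mul, h1, h2, h3, h4, h5, h6, h7, h8, h9, smul_add, smul_sub, mul_zero,
      zero_smul, add_zero, zero_add] <;>
    match_scalars <;> field_simp <;> ring_nf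

end LocalIntertwine

/-! ### Commutation of the transfer matrix with divided powers -/

section TransferMatrix

variable {N L : ℕ} {s z : ℂ}

theorem qz_inv (p : ℂ) (m : ℤ) : qz p⁻¹ m = qz p m := by
  rw [qz, qz, inv_zpow', inv_zpow', neg_neg, inv_inv, ← neg_sub (p ^ m), ← neg_sub p, neg_div_neg_eq]

theorem qz_succ {p : ℂ} (hp : p ≠ 0) (hp' : p - p⁻¹ ≠ 0) (n : ℕ) :
    qz p (n + 1 : ℕ) = p ^ n + p⁻¹ * qz p n := by
  rw [qz, qz]
  push_cast
  rw [neg_add, zpow_add₀ hp, zpow_add₀ hp, zpow_neg, zpow_natCast, zpow_one, zpow_neg_one]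
  have h := pow_ne_zero n hp
  have h1 : p - p⁻¹ = (p ^ 2 - 1) / p := by field_simp
  have h2 : p ^ 2 - 1 ≠ 0 := fun h => hp' (by rw [h1, h, zero_div])
  rw [h1]
  field_simp
  ring

theorem qz_succ' {p : ℂ} (hp : p ≠ 0) (hp' : p - p⁻¹ ≠ 0) (n : ℕ) :
    qz p (n + 1 : ℕ) = (p ^ n)⁻¹ + p * qz p n := by
  have h1 : p⁻¹ - p⁻¹⁻¹ ≠ 0 := by rw [inv_inv, ← neg_sub]; exact neg_ne_zero.mpr hp'
  have := qz_succ (inv_ne_zero hp) h1 n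
  rwa [qz_inv, qz_inv, inv_inv, inv_pow] at this

/-- The relations between the entries `P`, `Q`, `Y` of the monodromy matrix (`P` and `Q` the
diagonal ones) and a chain operator `S`. -/
structure ChainRelations (v a b : ℂ) (P Q Y S W U : Op N L) : Prop where
  left_diag : v⁻¹ • (P * S) + a • (Y * W) = v • (S * P)
  right_diag : v • (Q * S) = v⁻¹ • (S * Q) + b • (U * Y)
  off_diag : Y * S = S * Y
  left_cartan : W * S = (v ^ 2)⁻¹ • (S * W)
  right_cartan : U * S = v ^ 2 • (S * U)
  cartan_off_diag : U * Y = v ^ 2 • (Y * U)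

namespace ChainRelations

variable {v a b : ℂ} {P Q Y S W U : Op N L}

/-- Every `S` moved past `P` creates a term `Y * W`, and `Y * W` commutes with `S` up to `v⁻²`. The
powers of `v` collected in this way add up to a `q`-integer. -/
theorem left_pow (h : ChainRelations v a b P Q Y S W U) (hv : v ≠ 0)
    (hv' : v ^ 2 - (v ^ 2)⁻¹ ≠ 0) (n : ℕ) :
    P * S ^ (n + 1) = (v ^ 2) ^ (n + 1) • (S ^ (n + 1) * P) -
      (v * a * qz (v ^ 2) (n + 1 : ℕ)) • (S ^ n * (Y * W)) := by
  have h0 : P * S = v ^ 2 • (S * P) - (v * a) • (Y * W) := by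
    have := congrArg (v • ·) h.left_diag
    simp only [smul_add, smul_smul, mul_inv_cancel₀ hv, one_smul] at this
    rw [sq, ← this, add_sub_cancel_right]
  have hX : Y * W * S = (v ^ 2)⁻¹ • (S * (Y * W)) := by
    rw [mul_assoc, h.left_cartan, mul_smul_comm, ← mul_assoc, h.off_diag, mul_assoc]
  have h1 : qz (v ^ 2) (0 + 1 : ℕ) = 1 := by
    rw [qz_succ (pow_ne_zero 2 hv) hv', Nat.cast_zero, qz_zero]; simp
  induction n with
  | zero => rw [h1]; simp [h0]
  | succ n ih =>
    conv_lhs =>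
      rw [pow_succ S (n + 1), ← mul_assoc, ih, sub_mul, smul_mul_assoc, smul_mul_assoc,
        mul_assoc (S ^ (n + 1)) P, h0, mul_assoc (S ^ n) (Y * W), hX]
    rw [qz_succ (pow_ne_zero 2 hv) hv' (n + 1)]
    simp only [mul_sub, mul_smul_comm, smul_sub, smul_smul, ← mul_assoc, ← pow_succ]
    module

theorem right_pow (h : ChainRelations v a b P Q Y S W U) (hv : v ≠ 0)
    (hv' : v ^ 2 - (v ^ 2)⁻¹ ≠ 0) (n : ℕ) :
    Q * S ^ (n + 1) = ((v ^ 2) ^ (n + 1))⁻¹ • (S ^ (n + 1) * Q) +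
      (v * b * qz (v ^ 2) (n + 1 : ℕ)) • (S ^ n * (Y * U)) := by
  have h0 : Q * S = (v ^ 2)⁻¹ • (S * Q) + (v * b) • (Y * U) := by
    have := congrArg (v⁻¹ • ·) h.right_diag
    simp only [smul_add, smul_smul, inv_mul_cancel₀ hv, one_smul, h.cartan_off_diag] at this
    rw [this, ← mul_inv, ← sq]
    congr 2
    field_simp
  have hX : Y * U * S = v ^ 2 • (S * (Y * U)) := by
    rw [mul_assoc, h.right_cartan, mul_smul_comm, ← mul_assoc, h.off_diag, mul_assoc]
  have h1 : qz (v ^ 2) (0 + 1 : ℕ) = 1 := by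
    rw [qz_succ (pow_ne_zero 2 hv) hv', Nat.cast_zero, qz_zero]; simp
  induction n with
  | zero => rw [h1]; simp [h0]
  | succ n ih =>
    conv_lhs =>
      rw [pow_succ S (n + 1), ← mul_assoc, ih, add_mul, smul_mul_assoc, smul_mul_assoc,
        mul_assoc (S ^ (n + 1)) Q, h0, mul_assoc (S ^ n) (Y * U), hX]
    rw [qz_succ' (pow_ne_zero 2 hv) hv' (n + 1), pow_succ (v ^ 2) (n + 1), mul_inv]
    simp only [mul_add, mul_smul_comm, smul_add, smul_smul, ← mul_assoc, ← pow_succ]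
    module

/-- The failure to commute is proportional to `[n + 1]`. For `n + 1 = N` it cancels the vanishing
factor of `[N]!` and leaves a finite term, which the Cartan difference `b • U - a • W` must then
kill. -/
theorem add_mul_pow (h : ChainRelations v a b P Q Y S W U) (hv : v ≠ 0)
    (hv' : v ^ 2 - (v ^ 2)⁻¹ ≠ 0) (n : ℕ) :
    (P + Q) * S ^ (n + 1) =
      S ^ (n + 1) * ((v ^ 2) ^ (n + 1) • P + ((v ^ 2) ^ (n + 1))⁻¹ • Q) +
      qz (v ^ 2) (n + 1 : ℕ) • (v • (S ^ n * (Y * (b • U - a • W)))) := by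
  rw [add_mul, h.left_pow hv hv', h.right_pow hv hv']
  simp only [mul_add, mul_sub, mul_smul_comm]
  module

end ChainRelations

theorem qz_sq_zpow {t : ℂ} {ε : ℤ} (hε : ε = 1 ∨ ε = -1) (m : ℤ) :
    qz ((t ^ ε) ^ 2) m = qz (t ^ 2) m := by
  rcases hε with rfl | rfl
  · rw [zpow_one]
  · rw [zpow_neg_one, inv_pow, qz_inv]

/-- The commutation of the transfer matrix with divided powers, in the limit. -/
theorem IsDividedPowerLimit.transfer_commute (hN : Odd N) (hN1 : N ≠ 1)
    (hs : IsPrimitiveRoot s (2 * N)) {ε : ℤ} (hε : ε = 1 ∨ ε = -1)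
    {a b : ℂ → ℂ} {P Q Y S W U : ℂ → Op N L} {M R : Op N L}
    (hrel : ∀ᶠ t in 𝓝[≠] s, ChainRelations (t ^ ε) (a t) (b t) (P t) (Q t) (Y t) (S t) (W t) (U t))
    (ha : Tendsto a (𝓝[≠] s) (𝓝 (a s))) (hb : Tendsto b (𝓝[≠] s) (𝓝 (b s)))
    (hP : Tendsto P (𝓝[≠] s) (𝓝 (P s))) (hQ : Tendsto Q (𝓝[≠] s) (𝓝 (Q s)))
    (hY : Tendsto Y (𝓝[≠] s) (𝓝 (Y s))) (hW : Tendsto W (𝓝[≠] s) (𝓝 (W s)))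
    (hU : Tendsto U (𝓝[≠] s) (𝓝 (U s))) (hS : EntriesDifferentiableAt S s)
    (hM : IsDividedPowerLimit S N s M) (hR : (b s • U s - a s • W s) * R = 0) :
    (P s + Q s) * M * R = M * (P s + Q s) * R := by
  have hs0 := ne_zero_of_primitive hN hs
  have hv : Tendsto (fun t : ℂ => t ^ ε) (𝓝[≠] s) (𝓝 (s ^ ε)) :=
    (continuousAt_zpow₀ s ε (Or.inl hs0)).tendsto.mono_left nhdsWithin_le_nhds
  -- With this the twisted combination of `P` and `Q` on the right becomes `P + Q` in the limit.
  have hvs : ((s ^ ε) ^ 2) ^ N = 1 := by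
    rw [← pow_mul, ← zpow_natCast, ← zpow_mul, mul_comm, zpow_mul, zpow_natCast, hs.pow_eq_one,
      one_zpow]
  have h1 := ((continuousAt_qFact hN hN1 hs (N - 1)).inv₀
    (qFact_ne_zero hN hs (Nat.sub_lt hN.pos one_pos))).tendsto.mono_left
      (nhdsWithin_le_nhds (s := {s}ᶜ))
  have hlim : Tendsto (fun t => ((qFact (t ^ 2) N)⁻¹ • S t ^ N) *
      (((t ^ ε) ^ 2) ^ N • P t + (((t ^ ε) ^ 2) ^ N)⁻¹ • Q t) + (qFact (t ^ 2) (N - 1))⁻¹ •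
        (t ^ ε • (S t ^ (N - 1) * (Y t * (b t • U t - a t • W t))))) (𝓝[≠] s)
      (𝓝 (M * (((s ^ ε) ^ 2) ^ N • P s + (((s ^ ε) ^ 2) ^ N)⁻¹ • Q s) +
        (qFact (s ^ 2) (N - 1))⁻¹ •
        (s ^ ε • (S s ^ (N - 1) * (Y s * (b s • U s - a s • W s)))))) := by
    have hvN := (hv.pow 2).pow N
    refine (hM.mul ((hvN.smul hP).add ((hvN.inv₀ ?_).smul hQ))).add (h1.smul (hv.smul
      ((hS.pow (N - 1)).tendsto.mul (hY.mul ((hb.smul hU).sub (ha.smul hW))))))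
    rw [hvs]
    exact one_ne_zero
  have hlim' := ((hP.add hQ).mul hM)
  have heq := tendsto_nhds_unique hlim' (hlim.congr' ?_)
  · rw [heq, add_mul, smul_mul_assoc, smul_mul_assoc, mul_assoc (S s ^ (N - 1)), mul_assoc (Y s),
      hR, mul_zero, mul_zero, smul_zero, smul_zero, add_zero, hvs, inv_one, one_smul, one_smul]
  · filter_upwards [eventually_generic hN hN1 hs, hrel] with t ht hrel
    have hv0 : t ^ ε ≠ 0 := zpow_ne_zero _ ht.1
    have hv' : (t ^ ε) ^ 2 - ((t ^ ε) ^ 2)⁻¹ ≠ 0 := by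
      rcases hε with rfl | rfl
      · rw [zpow_one]; exact ht.2.1
      · rw [zpow_neg_one, inv_pow, inv_inv, ← neg_sub]; exact neg_ne_zero.mpr ht.2.1
    have h2 := hrel.add_mul_pow hv0 hv' (N - 1)
    rw [Nat.sub_add_cancel hN.pos, qz_sq_zpow hε] at h2
    have h3 := ht.2.2 N le_rfl
    have h4 := qFact_self (t ^ 2) hN.pos.ne'
    have h5 : (qFact (t ^ 2) N)⁻¹ * qz (t ^ 2) N = (qFact (t ^ 2) (N - 1))⁻¹ := by
      rw [h4] at h3 ⊢
      have := left_ne_zero_of_mul h3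
      have := right_ne_zero_of_mul h3
      field_simp
    rw [mul_smul_comm, h2, smul_add, smul_mul_assoc, ← h5, mul_smul]

theorem continuous_monodromy (N L : ℕ) :
    Continuous (monodromy L : Matrix (Fin 2) (Fin 2) (LocalOp N) → _) := by
  unfold monodromy
  have h (i : Fin L) : Continuous fun ℓ : Matrix (Fin 2) (Fin 2) (LocalOp N) =>
      ℓ.map (siteOp i) := by
    have h1 : Continuous (siteOp i : LocalOp N → Op N L) := by
      rw [siteOp_eq_tensorAt]
      exact LinearMap.continuous_of_finiteDimensional _
    exact continuous_id.matrix_map h1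
  simp only [List.ofFn_eq_map, ← List.map_reverse]
  exact continuous_list_prod _ fun i _ => h i

end TransferMatrix

/-! ### Relations of the monodromy matrix of the chain -/

section MonodromyXXZ

variable {N L : ℕ} {s t z : ℂ}

theorem two_by_two_entries {R : Type*} [Ring R] {T T' X X' : Matrix (Fin 2) (Fin 2) R}
    (h : T * X = X' * T') (i j : Fin 2) :
    T i 0 * X 0 j + T i 1 * X 1 j = X' i 0 * T' 0 j + X' i 1 * T' 1 j := by
  have := congrFun (congrFun h i) j
  simpa only [Matrix.mul_apply, Fin.sum_univ_two] using this

theorem tensorOp_kHalfPow_mul_opB (ht : t ≠ 0) (r ε : ℤ) :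
    tensorOp (fun _ => kHalfPow N t r) * opB N L t ε =
      t ^ (-2 * r) • (opB N L t ε * tensorOp fun _ => kHalfPow N t r) := by
  rw [opB_eq_chainOp]
  exact tensorOp_mul_chainOp (kHalfPow_commute _ _) (kHalfPow_mul_fOp ht r) (kHalfPow_commute _ _)

theorem tensorOp_kHalfPow_mul_opC (ht : t ≠ 0) (r ε : ℤ) :
    tensorOp (fun _ => kHalfPow N t r) * opC N L t ε =
      t ^ (2 * r) • (opC N L t ε * tensorOp fun _ => kHalfPow N t r) := by
  rw [opC_eq_chainOp]
  exact tensorOp_mul_chainOp (kHalfPow_commute _ _) (kHalfPow_mul_eOp ht r) (kHalfPow_commute _ _)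

theorem monodromyXXZ_intertwine_opB (ht : t ≠ 0) (ht' : t ^ 2 - (t ^ 2)⁻¹ ≠ 0) (hz : z ≠ 0) {ε : ℤ}
    (hε : ε = 1 ∨ ε = -1) :
    monodromyXXZ N L t z * (scal (kappa t (-ε)) (opB N L t ε) +
        (z ^ ε * t ^ (-(L : ℤ) - ε)) • scal !![0, 0; 1, 0] (tensorOp fun _ => kHalfPow N t ε)) =
      (scal (kappa t ε) (opB N L t ε) +
        (z ^ ε * t ^ ((L : ℤ) - ε)) • scal !![0, 0; 1, 0] (tensorOp fun _ => kHalfPow N t (-ε))) *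
        monodromyXXZ N L t z := by
  rw [opB_eq_chainOp, monodromyXXZ]
  -- The exponent in `ω` is forced: multiplying the one-site relation by `c j` must produce `ω j` on
  -- the left and `ω (j + 1)` on the right. The end values `ω 0` and `ω L` give the powers
  -- `t^{∓L-ε}`.
  have := monodromy_intertwine (L := L) (ℓ := localXXZ N t z)
    (c := fun i => t ^ (2 * ((i : ℤ) + 1) - ((L : ℤ) + 1)))
    (ω := fun j => z ^ ε * t ^ (2 * (j : ℤ) - L - ε)) (u := kHalfPow N t (-ε)) (x := fOp N t)
    (w := kHalfPow N t ε) (D₀ := kappa t (-ε)) (D₁ := kappa t ε) (ε := !![0, 0; 1, 0])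
    (localXXZ_commute ht _) (localXXZ_commute ht _) fun j => by
      have h := congrArg (t ^ (2 * ((j : ℤ) + 1) - ((L : ℤ) + 1)) • ·)
        (localXXZ_intertwine_fOp (N := N) ht ht' hz hε)
      beta_reduce at h
      rw [← Matrix.mul_smul, ← Matrix.smul_mul] at h
      simp only [smul_add, smul_smul] at h
      rw [mul_left_comm, ← zpow_add₀ ht, mul_left_comm, ← zpow_add₀ ht] at h
      convert h using 6 <;> push_cast <;> ring
  convert this using 6
  · push_cast; ring
  · ring

theorem monodromyXXZ_intertwine_opC (ht : t ≠ 0) (ht' : t ^ 2 - (t ^ 2)⁻¹ ≠ 0) (hz : z ≠ 0) {ε : ℤ}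
    (hε : ε = 1 ∨ ε = -1) :
    monodromyXXZ N L t z * (scal (kappa t ε) (opC N L t ε) +
        (z ^ ε * t ^ ((L : ℤ) - ε)) • scal !![0, 1; 0, 0] (tensorOp fun _ => kHalfPow N t (-ε))) =
      (scal (kappa t (-ε)) (opC N L t ε) +
        (z ^ ε * t ^ (-(L : ℤ) - ε)) • scal !![0, 1; 0, 0] (tensorOp fun _ => kHalfPow N t ε)) *
        monodromyXXZ N L t z := by
  rw [opC_eq_chainOp, monodromyXXZ]
  have := monodromy_intertwine (L := L) (ℓ := localXXZ N t z)
    (c := fun i => t ^ (((L : ℤ) + 1) - 2 * ((i : ℤ) + 1)))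
    (ω := fun j => z ^ ε * t ^ (L - 2 * (j : ℤ) - ε)) (u := kHalfPow N t ε) (x := eOp N t)
    (w := kHalfPow N t (-ε)) (D₀ := kappa t ε) (D₁ := kappa t (-ε)) (ε := !![0, 1; 0, 0])
    (localXXZ_commute ht _) (localXXZ_commute ht _) fun j => by
      have h := congrArg (t ^ (((L : ℤ) + 1) - 2 * ((j : ℤ) + 1)) • ·)
        (localXXZ_intertwine_eOp (N := N) ht ht' hz hε)
      beta_reduce at h
      rw [← Matrix.mul_smul, ← Matrix.smul_mul] at h
      simp only [smul_add, smul_smul] at h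
      rw [mul_left_comm, ← zpow_add₀ ht, mul_left_comm, ← zpow_add₀ ht] at h
      convert h using 6 <;> push_cast <;> ring
  convert this using 6
  · push_cast; ring
  · ring

theorem monodromyXXZ_commute (ht : t ≠ 0) (r : ℤ) :
    monodromyXXZ N L t z * scal (kappa t r) (tensorOp fun _ => kHalfPow N t r) =
      scal (kappa t r) (tensorOp fun _ => kHalfPow N t r) * monodromyXXZ N L t z :=
  monodromy_commute_tensorOp (localXXZ_commute ht r)

/-- The first three relations are entries of the global intertwining relation, and the last is an
off-diagonal entry of weight conservation. For `C_±` the two auxiliary basis vectors exchange roles.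
-/
theorem chainRelations_opB (ht : t ≠ 0) (ht' : t ^ 2 - (t ^ 2)⁻¹ ≠ 0) (hz : z ≠ 0) {ε : ℤ}
    (hε : ε = 1 ∨ ε = -1) :
    ChainRelations (t ^ ε) (z ^ ε * t ^ (-(L : ℤ) - ε)) (z ^ ε * t ^ ((L : ℤ) - ε))
      (monodromyXXZ N L t z 0 0) (monodromyXXZ N L t z 1 1) (monodromyXXZ N L t z 0 1)
      (opB N L t ε) (tensorOp fun _ => kHalfPow N t ε) (tensorOp fun _ => kHalfPow N t (-ε)) := by
  have h := two_by_two_entries (monodromyXXZ_intertwine_opB (N := N) (L := L) ht ht' hz hε)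
  have h' := two_by_two_entries (monodromyXXZ_commute (N := N) (L := L) (z := z) ht (-ε)) 0 1
  have h00 := h 0 0
  have h01 := h 0 1
  have h11 := h 1 1
  have hv : t ^ ε ≠ 0 := zpow_ne_zero ε ht
  simp only [scal, kappa, Matrix.map_apply, Matrix.add_apply, Matrix.smul_apply, Matrix.of_apply,
    Matrix.cons_val', Matrix.cons_val_zero, Matrix.cons_val_one, Matrix.cons_val_fin_one,
    neg_neg, zero_smul, one_smul, smul_zero, add_zero, zero_add, mul_zero, zero_mul,
    mul_smul_comm, smul_mul_assoc, zpow_neg] at h00 h01 h11 h'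
  refine ⟨h00, ?_, ?_, ?_, ?_, ?_⟩
  · rw [h11, add_comm]
  · exact smul_right_injective _ hv h01
  · rw [tensorOp_kHalfPow_mul_opB ht, neg_mul, zpow_neg, mul_comm, zpow_mul]; norm_cast
  · rw [tensorOp_kHalfPow_mul_opB ht, neg_mul_neg, mul_comm, zpow_mul]; norm_cast
  · have := congrArg (t ^ ε • ·) h'
    simp only [smul_smul, mul_inv_cancel₀ hv, one_smul] at this
    rw [← this, sq]

theorem chainRelations_opC (ht : t ≠ 0) (ht' : t ^ 2 - (t ^ 2)⁻¹ ≠ 0) (hz : z ≠ 0) {ε : ℤ}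
    (hε : ε = 1 ∨ ε = -1) :
    ChainRelations (t ^ ε) (z ^ ε * t ^ ((L : ℤ) - ε)) (z ^ ε * t ^ (-(L : ℤ) - ε))
      (monodromyXXZ N L t z 1 1) (monodromyXXZ N L t z 0 0) (monodromyXXZ N L t z 1 0)
      (opC N L t ε) (tensorOp fun _ => kHalfPow N t (-ε)) (tensorOp fun _ => kHalfPow N t ε) := by
  have h := two_by_two_entries (monodromyXXZ_intertwine_opC (N := N) (L := L) ht ht' hz hε)
  have h' := two_by_two_entries (monodromyXXZ_commute (N := N) (L := L) (z := z) ht ε) 1 0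
  have h00 := h 0 0
  have h10 := h 1 0
  have h11 := h 1 1
  have hv : t ^ ε ≠ 0 := zpow_ne_zero ε ht
  simp only [scal, kappa, Matrix.map_apply, Matrix.add_apply, Matrix.smul_apply, Matrix.of_apply,
    Matrix.cons_val', Matrix.cons_val_zero, Matrix.cons_val_one, Matrix.cons_val_fin_one,
    neg_neg, zero_smul, one_smul, smul_zero, add_zero, zero_add, mul_zero, zero_mul,
    mul_smul_comm, smul_mul_assoc, zpow_neg] at h00 h10 h11 h'
  refine ⟨?_, h00, ?_, ?_, ?_, ?_⟩
  · rw [← h11, add_comm]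
  · exact smul_right_injective _ hv h10
  · rw [tensorOp_kHalfPow_mul_opC ht, mul_neg, zpow_neg, mul_comm, zpow_mul]; norm_cast
  · rw [tensorOp_kHalfPow_mul_opC ht, mul_comm, zpow_mul]; norm_cast
  · have := congrArg (t ^ ε • ·) h'
    simp only [smul_smul, mul_inv_cancel₀ hv, one_smul] at this
    rw [← this, sq]

theorem continuousAt_localXXZ (hs : s ≠ 0) (hs' : s ^ 2 - (s ^ 2)⁻¹ ≠ 0) (z : ℂ) :
    ContinuousAt (fun t => localXXZ N t z) s := by
  have hk (r : ℤ) : ContinuousAt (fun t => kHalfPow N t r) s :=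
    continuousAt_pi.mpr fun a => continuousAt_pi.mpr fun b =>
      (differentiableAt_kHalfPow hs r a b).continuousAt
  have hf : ContinuousAt (fun t => fOp N t) s := by
    refine continuousAt_pi.mpr fun a => continuousAt_pi.mpr fun b => ?_
    simp only [fOp, Matrix.of_apply]
    split_ifs
    · exact (differentiableAt_qInt hs hs' _).continuousAt
    · exact continuousAt_const
  have he : ContinuousAt (fun t => eOp N t) s := by
    refine continuousAt_pi.mpr fun a => continuousAt_pi.mpr fun b => ?_
    simp only [eOp, Matrix.of_apply]
    split_ifs
    · exact (differentiableAt_qInt hs hs' _).continuousAt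
    · exact continuousAt_const
  have hi : ContinuousAt (fun t : ℂ => t⁻¹) s := continuousAt_inv₀ hs
  have h2 : ContinuousAt (fun t : ℂ => t ^ 2 - (t ^ 2)⁻¹) s := by
    have : ContinuousAt (fun t : ℂ => t ^ 2) s := by fun_prop
    exact this.sub (this.inv₀ (pow_ne_zero 2 hs))
  refine continuousAt_pi.mpr fun i => continuousAt_pi.mpr fun j => ?_
  fin_cases i <;> fin_cases j
  · exact hi.smul (((hk 1).const_smul z).sub ((hk (-1)).const_smul z⁻¹))
  · exact h2.smul hf
  · exact h2.smul he
  · exact continuousAt_id.smul (((hk (-1)).const_smul z).sub ((hk 1).const_smul z⁻¹))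

theorem tendsto_monodromyXXZ (hs : s ≠ 0) (hs' : s ^ 2 - (s ^ 2)⁻¹ ≠ 0) (z : ℂ) (i j : Fin 2) :
    Tendsto (fun t => monodromyXXZ N L t z i j) (𝓝[≠] s) (𝓝 (monodromyXXZ N L s z i j)) := by
  have h := ((continuous_monodromy N L).continuousAt.comp
    (continuousAt_localXXZ (N := N) hs hs' z)).tendsto
  exact ((tendsto_pi_nhds.mp (tendsto_pi_nhds.mp h i)) j).mono_left nhdsWithin_le_nhds

theorem tendsto_tensorOp_kHalfPow (hs : s ≠ 0) (r : ℤ) :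
    Tendsto (fun t => tensorOp fun _ : Fin L => kHalfPow N t r) (𝓝[≠] s)
      (𝓝 (tensorOp fun _ => kHalfPow N s r)) := by
  refine tendsto_pi_nhds.mpr fun σ => tendsto_pi_nhds.mpr fun τ => ?_
  simp only [tensorOp_apply]
  exact tendsto_finsetProd _ fun i _ =>
    (differentiableAt_kHalfPow hs r _ _).continuousAt.tendsto.mono_left nhdsWithin_le_nhds

theorem zpow_eq_zpow_neg_of_dvd (hN : Odd N) (hs : IsPrimitiveRoot s (2 * N)) {m : ℤ}
    (hm : (N : ℤ) ∣ m) : s ^ m = s ^ (-m) := by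
  have h := sq_zpow_eq_one hN hs hm
  rw [← zpow_natCast, ← zpow_mul] at h
  have hs0 := ne_zero_of_primitive hN hs
  have h1 : s ^ m = s ^ (-m + (2 : ℕ) * m) := by congr 1; push_cast; ring
  rw [h1, zpow_add₀ hs0, h, mul_one]

/-- For `N ∣ m` one has `s ^ m = s ^ (-m)`. Applied to the weight and to `L`, this makes both terms
equal; this is where `N ∣ L` is needed. -/
theorem cartan_sub_mul_sectorWeight (hN : Odd N) (hL : N ∣ L) (hs : IsPrimitiveRoot s (2 * N))
    (c : ℂ) (n ε : ℤ) :
    ((c * s ^ ((L : ℤ) - n)) • (tensorOp fun _ => kHalfPow N s (-ε)) -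
      (c * s ^ (-(L : ℤ) - n)) • tensorOp fun _ => kHalfPow N s ε) *
      wtOp N L (sectorWeight N) = 0 := by
  have hs0 := ne_zero_of_primitive hN hs
  rw [tensorOp_kHalfPow hs0, tensorOp_kHalfPow hs0, wtOp_smul, wtOp_smul, wtOp_sub, wtOp_mul,
    ← wtOp_zero]
  congr 1
  funext m
  rw [sectorWeight]
  split_ifs with h
  · rw [zpow_sub₀ hs0, zpow_sub₀ hs0,
      zpow_eq_zpow_neg_of_dvd hN hs (Int.natCast_dvd_natCast.mpr hL), neg_mul,
      zpow_eq_zpow_neg_of_dvd hN hs (h.mul_left ε), sub_self, zero_mul]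
  · rw [mul_zero]

/-- The transfer matrix of the chain at the root of unity. -/
def transferXXZ (N L : ℕ) (s z : ℂ) : Op N L := (monodromyXXZ N L s z).trace

theorem transferXXZ_eq : transferXXZ N L s z =
    monodromyXXZ N L s z 0 0 + monodromyXXZ N L s z 1 1 := by
  rw [transferXXZ, Matrix.trace_fin_two]

theorem IsDividedPowerLimit.transferXXZ_opB (hN : Odd N) (hN1 : N ≠ 1) (hL : N ∣ L)
    (hs : IsPrimitiveRoot s (2 * N)) (hz : z ≠ 0) {ε : ℤ} (hε : ε = 1 ∨ ε = -1) {M : Op N L}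
    (hM : IsDividedPowerLimit (fun t => opB N L t ε) N s M) :
    transferXXZ N L s z * M * wtOp N L (sectorWeight N) =
      M * transferXXZ N L s z * wtOp N L (sectorWeight N) := by
  have hs0 := ne_zero_of_primitive hN hs
  have hs1 := sq_sub_inv_ne_zero hN hN1 hs
  have hz' (n : ℤ) : Tendsto (fun t : ℂ => z ^ ε * t ^ n) (𝓝[≠] s) (𝓝 (z ^ ε * s ^ n)) :=
    ((continuousAt_zpow₀ s n (Or.inl hs0)).const_mul (z ^ ε)).tendsto.mono_left nhdsWithin_le_nhds
  rw [transferXXZ_eq]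
  refine IsDividedPowerLimit.transfer_commute hN hN1 hs hε (L := L)
    (a := fun t => z ^ ε * t ^ (-(L : ℤ) - ε)) (b := fun t => z ^ ε * t ^ ((L : ℤ) - ε))
    (P := fun t => monodromyXXZ N L t z 0 0) (Q := fun t => monodromyXXZ N L t z 1 1)
    (W := fun t => tensorOp fun _ => kHalfPow N t ε)
    (U := fun t => tensorOp fun _ => kHalfPow N t (-ε)) ?_ (hz' _) (hz' _)
    (tendsto_monodromyXXZ hs0 hs1 z _ _) (tendsto_monodromyXXZ hs0 hs1 z _ _)
    (tendsto_monodromyXXZ hs0 hs1 z 0 1) (tendsto_tensorOp_kHalfPow hs0 _)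
    (tendsto_tensorOp_kHalfPow hs0 _) (entriesDifferentiableAt_opB hs0 hs1 ε) hM
    (cartan_sub_mul_sectorWeight hN hL hs _ _ _)
  filter_upwards [eventually_generic hN hN1 hs] with t ht
  exact chainRelations_opB ht.1 ht.2.1 hz hε

theorem IsDividedPowerLimit.transferXXZ_opC (hN : Odd N) (hN1 : N ≠ 1) (hL : N ∣ L)
    (hs : IsPrimitiveRoot s (2 * N)) (hz : z ≠ 0) {ε : ℤ} (hε : ε = 1 ∨ ε = -1) {M : Op N L}
    (hM : IsDividedPowerLimit (fun t => opC N L t ε) N s M) :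
    transferXXZ N L s z * M * wtOp N L (sectorWeight N) =
      M * transferXXZ N L s z * wtOp N L (sectorWeight N) := by
  have hs0 := ne_zero_of_primitive hN hs
  have hs1 := sq_sub_inv_ne_zero hN hN1 hs
  have hz' (n : ℤ) : Tendsto (fun t : ℂ => z ^ ε * t ^ n) (𝓝[≠] s) (𝓝 (z ^ ε * s ^ n)) :=
    ((continuousAt_zpow₀ s n (Or.inl hs0)).const_mul (z ^ ε)).tendsto.mono_left nhdsWithin_le_nhds
  rw [transferXXZ_eq, add_comm]
  have hR := cartan_sub_mul_sectorWeight (N := N) hN hL hs (z ^ ε) ε ε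
  -- With the diagonal entries exchanged, the Cartan difference appears with the opposite sign.
  rw [← neg_eq_zero, ← neg_mul, neg_sub] at hR
  refine IsDividedPowerLimit.transfer_commute hN hN1 hs hε (L := L)
    (a := fun t => z ^ ε * t ^ ((L : ℤ) - ε)) (b := fun t => z ^ ε * t ^ (-(L : ℤ) - ε))
    (P := fun t => monodromyXXZ N L t z 1 1) (Q := fun t => monodromyXXZ N L t z 0 0)
    (W := fun t => tensorOp fun _ => kHalfPow N t (-ε))
    (U := fun t => tensorOp fun _ => kHalfPow N t ε) ?_ (hz' _) (hz' _)
    (tendsto_monodromyXXZ hs0 hs1 z _ _) (tendsto_monodromyXXZ hs0 hs1 z _ _)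
    (tendsto_monodromyXXZ hs0 hs1 z 1 0) (tendsto_tensorOp_kHalfPow hs0 _)
    (tendsto_tensorOp_kHalfPow hs0 _) (entriesDifferentiableAt_opC hs0 hs1 ε) hM hR
  filter_upwards [eventually_generic hN hN1 hs] with t ht
  exact chainRelations_opC ht.1 ht.2.1 hz hε

theorem transferXXZ_commute_opA (hs : s ≠ 0) :
    Commute (transferXXZ N L s z) (opA N L s) := by
  have h := two_by_two_entries (monodromyXXZ_commute (N := N) (L := L) (z := z) hs 1)
  have h00 := h 0 0
  have h11 := h 1 1
  simp only [scal, kappa, Matrix.map_apply, Matrix.of_apply,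
    Matrix.cons_val', Matrix.cons_val_zero, Matrix.cons_val_one, Matrix.cons_val_fin_one,
    zero_smul, add_zero, zero_add, mul_zero, zero_mul,
    mul_smul_comm, smul_mul_assoc] at h00 h11
  rw [transferXXZ_eq, opA]
  exact Commute.add_left (smul_right_injective _ (zpow_ne_zero 1 hs) h00)
    (smul_right_injective _ (zpow_ne_zero (-1) hs) h11)

end MonodromyXXZ

/-! ### Identification of the two local operators at the root of unity. -/

section LocalNBS

variable {N : ℕ} {s : ℂ}

theorem pow_eq_neg_one (hN : Odd N) (hs : IsPrimitiveRoot s (2 * N)) : s ^ N = -1 := by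
  have h : s ^ N * s ^ N = 1 := by rw [← pow_add, ← two_mul, hs.pow_eq_one]
  refine (mul_self_eq_one_iff.mp h).resolve_left fun h1 => ?_
  have := Nat.le_of_dvd hN.pos (hs.dvd_of_pow_eq_one _ h1)
  have := hN.pos
  omega

/-- On the diagonal the two agree because `s ^ N = -1`. Off the diagonal the truncated shifts `f`,
`e` may be replaced by the cyclic `X`, `X⁻¹`, since `Z⁻¹ - Z` kills `v_0` and hence the wrap-around
entries. -/
theorem localXXZ_eq_localNBS (hN : Odd N) (hs : IsPrimitiveRoot s (2 * N)) (z : ℂ) :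
    localXXZ N s z = localNBS N (s ^ 2) z := by
  have hs0 := ne_zero_of_primitive hN hs
  have hsN := pow_eq_neg_one hN hs
  have hsN' : s ^ (N : ℤ) = -1 := by rw [zpow_natCast, hsN]
  have hz (n : ℤ) : s ^ ((N : ℤ) + n) = -s ^ n := by rw [zpow_add₀ hs0, hsN', neg_one_mul]
  have hz' (n : ℤ) : s ^ (n - (N : ℤ)) = -s ^ n := by
    rw [zpow_sub₀ hs0, hsN', div_neg, div_one]
  have hq (n : ℕ) : (s ^ 2) ^ n = s ^ (2 * (n : ℤ)) := by
    rw [← pow_mul, ← zpow_natCast]; push_cast; rfl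
  have hq' (n : ℕ) : (s ^ 2)⁻¹ ^ n = s ^ (-(2 * (n : ℤ))) := by rw [inv_pow, hq, zpow_neg]
  -- A nonzero off-diagonal entry requires two distinct basis vectors, which excludes `N = 1`, where
  -- `q - q⁻¹` vanishes.
  have h1 {a b : ℕ} (hb : b < N) (hab : b = a + 1) : s ^ 2 - (s ^ 2)⁻¹ ≠ 0 :=
    sq_sub_inv_ne_zero hN (by omega) hs
  ext1 i j
  ext b a
  fin_cases i <;> fin_cases j
  · simp only [localXXZ, localNBS, kHalfPow, opZ, opZinv, Matrix.of_apply, Matrix.cons_val',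
      Matrix.cons_val_zero, Fin.zero_eta, Matrix.cons_val_fin_one, Matrix.smul_apply,
      Matrix.sub_apply, Matrix.add_apply, Matrix.diagonal_apply, smul_eq_mul]
    split_ifs
    · rw [hq, hq', show (1 : ℤ) * ((N : ℤ) - 1 - 2 * (b : ℤ)) = N + (-(2 * b) - 1) by ring,
        show (-1 : ℤ) * ((N : ℤ) - 1 - 2 * (b : ℤ)) = 2 * b + 1 - N by ring, hz, hz',
        zpow_sub₀ hs0, zpow_add₀ hs0, zpow_one]
      field_simp
      ring
    · simp
  · simp only [localXXZ, localNBS, fOp, opX, opZ, opZinv, Matrix.of_apply, Matrix.cons_val',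
      Matrix.cons_val_zero, Matrix.cons_val_one, Fin.zero_eta, Fin.mk_one, Matrix.cons_val_fin_one,
      Matrix.smul_apply, Matrix.diagonal_sub, Matrix.diagonal_mul, Matrix.neg_apply, smul_eq_mul]
    split_ifs with h h' h'
    · have := h1 b.2 h
      rw [qInt, mul_div_cancel₀ _ this, h]
      ring
    · exact absurd (by rw [← h, Nat.mod_eq_of_lt b.2]) h'
    · have : (b : ℕ) = 0 := by
        have := a.2
        rcases Nat.lt_or_ge ((a : ℕ) + 1) N with h2 | h2
        · rw [Nat.mod_eq_of_lt h2] at h'; exact absurd h' h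
        · rw [h', show (a : ℕ) + 1 = N by omega, Nat.mod_self]
      simp [this]
    · simp
  · simp only [localXXZ, localNBS, eOp, opXinv, opX, opZ, opZinv, Matrix.of_apply, Matrix.cons_val',
      Matrix.cons_val_zero, Matrix.cons_val_one, Fin.zero_eta, Fin.mk_one, Matrix.cons_val_fin_one,
      Matrix.smul_apply, Matrix.diagonal_sub, Matrix.mul_diagonal, Matrix.transpose_apply,
      smul_eq_mul]
    split_ifs with h h' h'
    · have := h1 a.2 h.symm
      rw [qInt, mul_div_cancel₀ _ this, hq, hq', hq, hq', Nat.cast_sub a.2.le, one_mul]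
      rw [show 2 * ((N : ℤ) - a) = N + (-(2 * a) + N) by ring, hz, add_comm, hz, neg_neg]
      rw [show -((N : ℤ) + (N + -(2 * (a : ℕ)))) = 2 * (a : ℕ) - N - N by ring, hz', hz', neg_neg]
    · exact absurd (by rw [h, Nat.mod_eq_of_lt a.2]) h'
    · have : (a : ℕ) = 0 := by
        have := b.2
        rcases Nat.lt_or_ge ((b : ℕ) + 1) N with h2 | h2
        · rw [Nat.mod_eq_of_lt h2] at h'; exact absurd h'.symm h
        · rw [h', show (b : ℕ) + 1 = N by omega, Nat.mod_self]
      simp [this]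
    · simp
  · simp only [localXXZ, localNBS, kHalfPow, opZ, opZinv, Matrix.of_apply, Matrix.cons_val',
      Matrix.cons_val_one, Fin.mk_one, Matrix.cons_val_fin_one, Matrix.smul_apply,
      Matrix.sub_apply, Matrix.diagonal_apply, smul_eq_mul]
    split_ifs
    · rw [hq, hq', show (1 : ℤ) * ((N : ℤ) - 1 - 2 * (b : ℤ)) = N + (-(2 * b) - 1) by ring,
        show (-1 : ℤ) * ((N : ℤ) - 1 - 2 * (b : ℤ)) = 2 * b + 1 - N by ring, hz, hz',
        zpow_sub₀ hs0, zpow_add₀ hs0, zpow_one]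
      field_simp
      ring
    · simp

end LocalNBS

/-! ### Asymptotics of the monodromy matrix -/

section Asymptotics

variable {N L : ℕ}

theorem siteOp_mul_tensorOp {M : Fin L → LocalOp N} {j : Fin L} (hM : M j = 1) (A : LocalOp N) :
    siteOp j A * tensorOp M = tensorOp (Function.update M j A) := by
  rw [← tensorAt_self M j, siteOp_mul_tensorAt, hM, mul_one, tensorAt_apply]

/-- Gauge transformation of the auxiliary space, by a matrix that may vary from site to site. -/
theorem monodromy_scal_intertwine {ℓ ℓ' : Matrix (Fin 2) (Fin 2) (LocalOp N)}
    {D : ℕ → Matrix (Fin 2) (Fin 2) ℂ}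
    (h : ∀ j, ℓ' * scal (D j) 1 = scal (D (j + 1)) 1 * ℓ) :
    monodromy L ℓ' * scal (D 0) 1 = scal (D L) 1 * monodromy L ℓ := by
  refine prod_reverse_ofFn_intertwine _ _ (fun j => scal (D j) 1) fun j => ?_
  have hk (n : ℕ) : scal (D n) (1 : Op N L) = (scal (D n) 1).map (tensorAt 1 j) := by
    have := smul_scal_tensorAt (1 : Fin L → LocalOp N) j 1 (D n) 1
    rw [one_smul, one_smul, ← Pi.one_apply (M := fun _ => LocalOp N) j, tensorAt_self] at this
    rw [← Pi.one_apply (M := fun _ => LocalOp N) j, ← this, ← tensorOp_one]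
    rfl
  rw [hk, hk, map_siteOp_mul, mul_map_siteOp, h]

/-- The monodromy matrix of an upper triangular local operator. -/
theorem monodromy_upperTriangular (α β δ : LocalOp N) :
    monodromy L !![α, β; 0, δ] =
      !![tensorOp fun _ => α, ∑ i, tensorOp (chainFactor i δ β α); 0, tensorOp fun _ => δ] := by
  set F : ℕ → LocalOp N → Fin L → LocalOp N := fun j u l => if (l : ℕ) < j then u else 1 with hF
  set G : ℕ → Fin L → Fin L → LocalOp N := fun j i l =>
    if l < i then δ else if l = i then β else if (l : ℕ) < j then α else 1 with hG
  have hFu (j : Fin L) (u : LocalOp N) : siteOp j u * tensorOp (F j u) = tensorOp (F (j + 1) u) := by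
    rw [siteOp_mul_tensorOp (by simp [hF])]
    congr 1
    funext l
    by_cases hl : l = j
    · subst hl; simp [hF]
    · have : (l : ℕ) ≠ j := fun h => hl (Fin.ext h)
      have h2 : (l : ℕ) < j + 1 ↔ (l : ℕ) < j := by omega
      simp [hF, hl, h2]
  have hGu (j i : Fin L) (hij : i < j) :
      siteOp j α * tensorOp (G j i) = tensorOp (G (j + 1) i) := by
    rw [siteOp_mul_tensorOp (by simp [hG, hij.not_gt, hij.ne'])]
    congr 1
    funext l
    by_cases hl : l = j
    · subst hl; simp [hG, hij.not_gt, hij.ne']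
    · have : (l : ℕ) ≠ j := fun h => hl (Fin.ext h)
      have h2 : (l : ℕ) < j + 1 ↔ (l : ℕ) < j := by omega
      simp [hG, hl, h2]
  have hGn (j : Fin L) : siteOp j β * tensorOp (F j δ) = tensorOp (G (j + 1) j) := by
    rw [siteOp_mul_tensorOp (by simp [hF])]
    congr 1
    funext l
    rcases lt_trichotomy l j with hl | hl | hl
    · simp [hF, hG, hl, hl.ne]
    · subst hl; simp [hG]
    · have h2 : ¬ (l : ℕ) < j + 1 := by have := Fin.lt_def.mp hl; omega
      simp [hF, hG, hl.not_gt, hl.ne', h2]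
  -- The partial products over the first `j` sites play the role of `X j`, against a trivial second
  -- family. In the upper right entry `β` occurs once, with `δ` on the earlier sites and `α` on the
  -- later ones.
  have := prod_reverse_ofFn_intertwine (fun j => (!![α, β; 0, δ]).map (siteOp (N := N) (L := L) j))
    (fun _ => 1)
    (fun j => !![tensorOp (F j α), ∑ i : Fin L, if (i : ℕ) < j then tensorOp (G j i) else 0;
      0, tensorOp (F j δ)]) fun j => by
      rw [mul_one]
      have h0j : siteOp j (0 : LocalOp N) = 0 := by rw [siteOp_eq_tensorAt]; exact map_zero _
      ext1 a b
      fin_cases a <;> fin_cases b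
      · simp [Matrix.mul_apply, Fin.sum_univ_two, hFu]
      · simp only [Matrix.mul_apply, Fin.sum_univ_two, Matrix.map_apply, Matrix.of_apply,
          Matrix.cons_val', Matrix.cons_val_zero, Matrix.cons_val_one, Fin.zero_eta, Fin.mk_one,
          Matrix.cons_val_fin_one, hGn, Finset.mul_sum]
        rw [← Finset.sum_erase_add _ _ (Finset.mem_univ j),
          ← Finset.sum_erase_add (Finset.univ : Finset (Fin L)) _ (Finset.mem_univ j),
          if_neg (lt_irrefl _), mul_zero, add_zero, if_pos (Nat.lt_succ_self _)]
        congr 1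
        refine Finset.sum_congr rfl fun i hi => ?_
        have hij : (i : ℕ) ≠ j := fun h => Finset.ne_of_mem_erase hi (Fin.ext h)
        have h2 : (i : ℕ) < j + 1 ↔ (i : ℕ) < j := by omega
        simp only [h2]
        split_ifs with h
        · exact hGu j i h
        · exact mul_zero _
      · simp only [Matrix.mul_apply, Fin.sum_univ_two, Matrix.map_apply, Matrix.of_apply,
          Matrix.cons_val', Matrix.cons_val_zero, Matrix.cons_val_one, Fin.zero_eta, Fin.mk_one,
          Matrix.cons_val_fin_one, h0j, zero_mul, mul_zero, add_zero]
      · simp only [Matrix.mul_apply, Fin.sum_univ_two, Matrix.map_apply, Matrix.of_apply,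
          Matrix.cons_val', Matrix.cons_val_zero, Matrix.cons_val_one, Fin.mk_one,
          Matrix.cons_val_fin_one, h0j, zero_mul, zero_add, hFu]
  have hX0 : (!![tensorOp (F 0 α), ∑ i : Fin L, if (i : ℕ) < 0 then tensorOp (G 0 i) else 0;
      0, tensorOp (F 0 δ)] : Matrix (Fin 2) (Fin 2) (Op N L)) = 1 := by
    have h1 (u : LocalOp N) : tensorOp (F 0 u) = 1 := by
      rw [← tensorOp_one]; simp [hF]
    ext1 a b
    fin_cases a <;> fin_cases b <;> simp [h1]
  rw [hX0, mul_one, List.ofFn_const, List.reverse_replicate, List.prod_replicate, one_pow,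
    mul_one] at this
  rw [monodromy, this]
  have hGL (i : Fin L) : G L i = chainFactor i δ β α := by funext l; simp [hG, chainFactor]
  simp [hF, hGL]

variable {ι : Type*} {F : Filter ι}

/-- The leading behaviour of the entries of the monodromy matrix of a local operator which is, up
to rescaling, asymptotically diagonal. -/
theorem tendsto_monodromy_entries {ℓ : ι → Matrix (Fin 2) (Fin 2) (LocalOp N)} {y : ι → ℂ}
    {α α' β γ δ δ' : LocalOp N} (hy : Tendsto y F (𝓝 0)) (hy0 : ∀ᶠ x in F, y x ≠ 0)
    (hℓ : ∀ᶠ x in F, y x • ℓ x =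
      !![α - y x ^ 2 • α', y x • β; y x • γ, δ - y x ^ 2 • δ']) :
    Tendsto (fun x => y x ^ L • monodromy L (ℓ x) 0 0) F (𝓝 (tensorOp fun _ => α)) ∧
    Tendsto (fun x => y x ^ ((L : ℤ) - 1) • monodromy L (ℓ x) 0 1) F
      (𝓝 (∑ i, tensorOp (chainFactor i δ β α))) := by
  set P : ℂ → Matrix (Fin 2) (Fin 2) (LocalOp N) := fun w =>
    !![α - w • α', β; w • γ, δ - w • δ'] with hP
  have hPc : Continuous P := by
    refine continuous_pi fun i => continuous_pi fun j => ?_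
    fin_cases i <;> fin_cases j
    · exact continuous_const.sub (continuous_id.smul continuous_const)
    · exact continuous_const
    · exact continuous_id.smul continuous_const
    · exact continuous_const.sub (continuous_id.smul continuous_const)
  have hP0 : P 0 = !![α, β; 0, δ] := by simp [hP]
  have hlim : Tendsto (fun x => monodromy L (P (y x ^ 2))) F (𝓝 (monodromy L (P 0))) := by
    have h2 : Tendsto (fun x => y x ^ 2) F (𝓝 0) := by simpa using hy.pow 2
    exact (((continuous_monodromy N L).comp hPc).tendsto 0).comp h2
  rw [hP0, monodromy_upperTriangular] at hlim
  have hent (i j : Fin 2) := tendsto_pi_nhds.mp (tendsto_pi_nhds.mp hlim i) j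
  have key : ∀ᶠ x in F, monodromy L (P (y x ^ 2)) 0 0 = y x ^ L • monodromy L (ℓ x) 0 0 ∧
      y x • monodromy L (P (y x ^ 2)) 0 1 = y x ^ L • monodromy L (ℓ x) 0 1 := by
    filter_upwards [hℓ] with x hx
    -- Conjugation by `diag(1, y)` takes the off-diagonal entries `y β`, `y γ` to `β`, `y² γ`, so
    -- the local operator becomes upper triangular as `y → 0`. The factor `y ^ j` absorbs the
    -- rescaling of `ℓ`.
    have h := monodromy_scal_intertwine (L := L) (ℓ := ℓ x) (ℓ' := P (y x ^ 2))
      (D := fun j => y x ^ j • !![1, 0; 0, y x]) fun j => by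
        have hs : scal (y x ^ (j + 1) • !![1, 0; 0, y x]) (1 : LocalOp N) * ℓ x =
            y x ^ j • (scal !![1, 0; 0, y x] 1 * (y x • ℓ x)) := by
          rw [Matrix.mul_smul, smul_smul, ← pow_succ, ← Matrix.smul_mul]
          congr 1
          ext1 a b
          simp only [scal, Matrix.map_apply, Matrix.smul_apply, smul_assoc]
        rw [hs, hx]
        ext1 a b
        fin_cases a <;> fin_cases b <;>
          simp [Matrix.mul_apply, scal, hP, smul_smul, sq, mul_comm]
    have h2 := two_by_two_entries h
    have h00 := h2 0 0
    have h01 := h2 0 1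
    simp only [scal, Matrix.map_apply, Matrix.smul_apply, Matrix.of_apply,
      Matrix.cons_val', Matrix.cons_val_zero, Matrix.cons_val_one, Matrix.cons_val_fin_one,
      pow_zero, one_smul, smul_eq_mul, mul_zero, mul_one, zero_smul, add_zero, zero_add,
      zero_mul, mul_smul_comm, smul_mul_assoc, one_mul] at h00 h01
    exact ⟨h00, h01⟩
  constructor
  · exact (hent 0 0).congr' (key.mono fun x hx => hx.1)
  · refine (hent 0 1).congr' ?_
    filter_upwards [key, hy0] with x hx hx0
    rw [zpow_sub_one₀ hx0, mul_comm, mul_smul, zpow_natCast, ← hx.2, smul_smul,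
      inv_mul_cancel₀ hx0, one_smul]

/-- Conjugation by the flip of `ℂ²`; it reduces the asymptotics of `C(z)` to those of an upper right
entry. -/
theorem monodromy_swap (α β γ δ : LocalOp N) :
    monodromy L !![α, β; γ, δ] 1 0 = monodromy L !![δ, γ; β, α] 0 1 := by
  have h := monodromy_scal_intertwine (L := L) (ℓ := !![δ, γ; β, α]) (ℓ' := !![α, β; γ, δ])
    (D := fun _ => !![0, 1; 1, 0]) fun _ => by
      ext1 a b
      fin_cases a <;> fin_cases b <;> simp [Matrix.mul_apply, scal]
  simpa [scal] using two_by_two_entries h 1 1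

theorem tensorOp_chainFactor_smul_smul {t : ℂ} (ht : t ≠ 0) (b : ℂ) (i : Fin L)
    (u x w : LocalOp N) : tensorOp (chainFactor i (t • u) (b • x) (t⁻¹ • w)) =
      (b * t ^ (2 * ((i : ℤ) + 1) - ((L : ℤ) + 1))) • tensorOp (chainFactor i u x w) := by
  rw [tensorOp_chainFactor_smul, mul_smul]
  congr 1
  have h : chainFactor i (t • u) x (t⁻¹ • w) = fun j : Fin L =>
      t ^ ((if j < i then 1 else 0) - (if i < j then 1 else 0) : ℤ) • chainFactor i u x w j := by
    funext j
    rcases lt_trichotomy j i with hj | hj | hj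
    · simp [chainFactor, hj, hj.not_gt]
    · simp [chainFactor, hj]
    · simp [chainFactor, hj, hj.not_gt, hj.ne']
  rw [h, tensorOp_smul, prod_zpow_eq_zpow_sum _ ht]
  congr 2
  -- With `i` counted from `0` there are `i` sites before it and `L - 1 - i` after it; their
  -- difference is the exponent.
  rw [Finset.sum_sub_distrib, Finset.sum_boole, Finset.sum_boole, Finset.filter_gt_eq_Iio,
    Finset.filter_lt_eq_Ioi, Fin.card_Iio, Fin.card_Ioi]
  have := i.2
  omega

/-- The sign `ε` in `y` brings the limits `z → ∞` and `z → 0` to the same form; it is the source of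
the sign in `n_±(z)`. -/
theorem smul_localXXZ {t z y : ℂ} {ε : ℤ} (hε : ε = 1 ∨ ε = -1) (hz : z ≠ 0)
    (hy : y = ((ε : ℂ) * z ^ ε)⁻¹) : y • localXXZ N t z =
      !![t⁻¹ • kHalfPow N t ε - y ^ 2 • (t⁻¹ • kHalfPow N t (-ε)),
          y • ((t ^ 2 - (t ^ 2)⁻¹) • fOp N t);
        y • ((t ^ 2 - (t ^ 2)⁻¹) • eOp N t),
          t • kHalfPow N t (-ε) - y ^ 2 • (t • kHalfPow N t ε)] := by
  rcases hε with rfl | rfl <;> subst hy <;> ext1 a b <;> fin_cases a <;> fin_cases b <;>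
    simp [localXXZ] <;> match_scalars <;> field_simp

theorem tendsto_opA {t : ℂ} (ht : t ≠ 0) :
    Tendsto (fun z : ℂ => (z ^ L * (t ^ L)⁻¹)⁻¹ • monodromyXXZ N L t z 0 0)
      (Bornology.cobounded ℂ) (𝓝 (opA N L t)) := by
  have h := ((tendsto_monodromy_entries (L := L) (ℓ := fun z => localXXZ N t z)
    (y := fun z => (((1 : ℤ) : ℂ) * z ^ (1 : ℤ))⁻¹) (by simpa using tendsto_inv₀_cobounded)
    ((Bornology.eventually_ne_cobounded 0).mono fun z hz => by simpa using hz)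
    ((Bornology.eventually_ne_cobounded 0).mono fun z hz =>
      smul_localXXZ (Or.inl rfl) hz rfl)).1).const_smul (t ^ L)
  have h2 : t ^ L • tensorOp (fun _ : Fin L => t⁻¹ • kHalfPow N t 1) = opA N L t := by
    rw [tensorOp_smul, smul_smul]
    simp [opA, ht]
  rw [h2] at h
  refine h.congr fun z => ?_
  simp [monodromyXXZ, smul_smul]

variable {G : Filter ℂ} {t : ℂ} {ε : ℤ}

theorem smul_localXXZ_swap {t z y : ℂ} {ε : ℤ} (hε : ε = 1 ∨ ε = -1) (hz : z ≠ 0)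
    (hy : y = ((ε : ℂ) * z ^ ε)⁻¹) :
    y • !![localXXZ N t z 1 1, localXXZ N t z 1 0; localXXZ N t z 0 1, localXXZ N t z 0 0] =
      !![t • kHalfPow N t (-ε) - y ^ 2 • (t • kHalfPow N t ε),
          y • ((t ^ 2 - (t ^ 2)⁻¹) • eOp N t);
        y • ((t ^ 2 - (t ^ 2)⁻¹) • fOp N t),
          t⁻¹ • kHalfPow N t ε - y ^ 2 • (t⁻¹ • kHalfPow N t (-ε))] := by
  have h (i j : Fin 2) := congrFun (congrFun (smul_localXXZ (N := N) (t := t) hε hz hy) i) j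
  ext1 i j
  fin_cases i <;> fin_cases j
  exacts [h 1 1, h 1 0, h 0 1, h 0 0]

theorem inv_normFactor (ε : ℤ) (t z : ℂ) : (normFactor L t ε z)⁻¹ =
    (t ^ 2 - (t ^ 2)⁻¹)⁻¹ * ((ε : ℂ) * z ^ ε)⁻¹ ^ ((L : ℤ) - 1) := by
  rw [normFactor, mul_inv, inv_zpow, mul_comm]

theorem tendsto_opB (ht : t ≠ 0) (ht' : t ^ 2 - (t ^ 2)⁻¹ ≠ 0) (hε : ε = 1 ∨ ε = -1)
    (hG : ∀ᶠ z in G, z ≠ 0) (hy : Tendsto (fun z : ℂ => ((ε : ℂ) * z ^ ε)⁻¹) G (𝓝 0)) :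
    Tendsto (fun z : ℂ => (normFactor L t ε z)⁻¹ • monodromyXXZ N L t z 0 1) G
      (𝓝 (opB N L t ε)) := by
  have hε0 : (ε : ℂ) ≠ 0 := by rcases hε with rfl | rfl <;> norm_num
  have h := ((tendsto_monodromy_entries (L := L) (ℓ := fun z => localXXZ N t z) hy
    (hG.mono fun z hz => inv_ne_zero (mul_ne_zero hε0 (zpow_ne_zero _ hz)))
    (hG.mono fun z hz => smul_localXXZ hε hz rfl)).2).const_smul (t ^ 2 - (t ^ 2)⁻¹)⁻¹
  have hB : (t ^ 2 - (t ^ 2)⁻¹)⁻¹ • ∑ i : Fin L, tensorOp (chainFactor i (t • kHalfPow N t (-ε))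
      ((t ^ 2 - (t ^ 2)⁻¹) • fOp N t) (t⁻¹ • kHalfPow N t ε)) = opB N L t ε := by
    rw [opB_eq_chainOp, chainOp, Finset.smul_sum]
    refine Finset.sum_congr rfl fun i _ => ?_
    rw [tensorOp_chainFactor_smul_smul ht, smul_smul, inv_mul_cancel_left₀ ht']
  rw [hB] at h
  refine h.congr fun z => ?_
  rw [inv_normFactor, mul_smul]
  rfl

theorem tendsto_opC (ht : t ≠ 0) (ht' : t ^ 2 - (t ^ 2)⁻¹ ≠ 0) (hε : ε = 1 ∨ ε = -1)
    (hG : ∀ᶠ z in G, z ≠ 0) (hy : Tendsto (fun z : ℂ => ((ε : ℂ) * z ^ ε)⁻¹) G (𝓝 0)) :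
    Tendsto (fun z : ℂ => (normFactor L t ε z)⁻¹ • monodromyXXZ N L t z 1 0) G
      (𝓝 (opC N L t ε)) := by
  have hε0 : (ε : ℂ) ≠ 0 := by rcases hε with rfl | rfl <;> norm_num
  have h := ((tendsto_monodromy_entries (L := L)
    (ℓ := fun z => !![localXXZ N t z 1 1, localXXZ N t z 1 0;
      localXXZ N t z 0 1, localXXZ N t z 0 0]) hy
    (hG.mono fun z hz => inv_ne_zero (mul_ne_zero hε0 (zpow_ne_zero _ hz)))
    (hG.mono fun z hz => smul_localXXZ_swap hε hz rfl)).2).const_smul (t ^ 2 - (t ^ 2)⁻¹)⁻¹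
  have hc (i : Fin L) := tensorOp_chainFactor_smul_smul (inv_ne_zero ht) (t ^ 2 - (t ^ 2)⁻¹) i
    (kHalfPow N t ε) (eOp N t) (kHalfPow N t (-ε))
  simp only [inv_inv, inv_zpow', neg_sub] at hc
  have hC : (t ^ 2 - (t ^ 2)⁻¹)⁻¹ • ∑ i : Fin L, tensorOp (chainFactor i (t⁻¹ • kHalfPow N t ε)
      ((t ^ 2 - (t ^ 2)⁻¹) • eOp N t) (t • kHalfPow N t (-ε))) = opC N L t ε := by
    rw [opC_eq_chainOp, chainOp, Finset.smul_sum]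
    refine Finset.sum_congr rfl fun i _ => ?_
    rw [hc, smul_smul, inv_mul_cancel_left₀ ht']
  rw [hC] at h
  refine h.congr fun z => ?_
  rw [inv_normFactor, mul_smul, monodromyXXZ]
  congr 2
  conv_rhs => rw [Matrix.eta_fin_two (localXXZ N t z)]
  exact (monodromy_swap _ _ _ _).symm

end Asymptotics

/-! ### Restriction to the sector -/

section Sector

variable {N L : ℕ} {s : ℂ}

/-- The Lie subalgebra of the elements commuting with all elements of a set. -/
def lieCentralizer {g : Type*} [LieRing g] [LieAlgebra ℂ g] (S : Set g) : LieSubalgebra ℂ g where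
  carrier := {x | ∀ T ∈ S, ⁅T, x⁆ = 0}
  add_mem' hx hy T hT := by rw [lie_add, hx T hT, hy T hT, add_zero]
  zero_mem' T _ := lie_zero T
  smul_mem' c x hx T hT := by rw [lie_smul, hx T hT, smul_zero]
  lie_mem' hx hy T hT := by rw [leibniz_lie, hx T hT, hy T hT, zero_lie, lie_zero, add_zero]

/-- A Chevalley system in a Lie algebra, whose elements commute with all elements of a set, gives
a homomorphism from the loop algebra with the same property. -/
theorem ChevalleySystem.exists_loopHom_commuting {g : Type*} [LieRing g] [LieAlgebra ℂ g]
    [FiniteDimensional ℂ g] {h hp hm : g} (C : ChevalleySystem h hp hm) (S : Set g)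
    (he : ∀ T ∈ S, ⁅T, C.e⁆ = 0) (hf : ∀ T ∈ S, ⁅T, C.f⁆ = 0) (hf' : ∀ T ∈ S, ⁅T, C.f'⁆ = 0)
    (he' : ∀ T ∈ S, ⁅T, C.e'⁆ = 0) :
    ∃ ρ : Loop →ₗ⁅ℂ⁆ g, (ρ (chevH 0) = -h ∧ ρ (chevH 1) = h ∧ ρ (chevE 0) = C.f' ∧
      ρ (chevE 1) = C.e ∧ ρ (chevF 0) = C.e' ∧ ρ (chevF 1) = C.f) ∧
      ∀ T ∈ S, ∀ x, ⁅T, ρ x⁆ = 0 := by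
  -- The construction is repeated inside the centralizer, a finite-dimensional Lie algebra
  -- containing the four generators, so the whole image commutes with `S`.
  let e : lieCentralizer S := ⟨C.e, he⟩
  let f : lieCentralizer S := ⟨C.f, hf⟩
  let f' : lieCentralizer S := ⟨C.f', hf'⟩
  let e' : lieCentralizer S := ⟨C.e', he'⟩
  have hh : ((⁅e, f⁆ : lieCentralizer S) : g) = h := C.lie_e_f
  have : FiniteDimensional ℂ (lieCentralizer S) :=
    inferInstanceAs (FiniteDimensional ℂ (lieCentralizer S).toSubmodule)
  let C' : ChevalleySystem ⁅e, f⁆ ⁅e, f'⁆ ⁅e', f⁆ :=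
    { e := e
      f := f
      f' := f'
      e' := e'
      lie_e_f := rfl
      lie_e'_f' := Subtype.ext (C.lie_e'_f'.trans hh.symm)
      lie_e_e' := Subtype.ext C.lie_e_e'
      lie_f_f' := Subtype.ext C.lie_f_f'
      lie_e_f' := rfl
      lie_e'_f := rfl
      lie_h_e := Subtype.ext (by rw [LieSubalgebra.coe_bracket, hh]; exact C.lie_h_e)
      lie_h_e' := Subtype.ext (by rw [LieSubalgebra.coe_bracket, hh]; exact C.lie_h_e')
      lie_h_f := Subtype.ext (by rw [LieSubalgebra.coe_bracket, hh]; exact C.lie_h_f)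
      lie_h_f' := Subtype.ext (by rw [LieSubalgebra.coe_bracket, hh]; exact C.lie_h_f') }
  obtain ⟨ρ, h1, h2, h3, h4, h5, h6⟩ := C'.exists_loopHom
  refine ⟨(lieCentralizer S).incl.comp ρ, ⟨?_, ?_, ?_, ?_, ?_, ?_⟩, fun T hT x => (ρ x).2 T hT⟩
  · rw [LieHom.comp_apply, h1, ← hh]; rfl
  · rw [LieHom.comp_apply, h2, ← hh]; rfl
  · rw [LieHom.comp_apply, h3]; rfl
  · rw [LieHom.comp_apply, h4]; rfl
  · rw [LieHom.comp_apply, h5]; rfl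
  · rw [LieHom.comp_apply, h6]; rfl

theorem opA_sq_eq_wtOp (hs : s ≠ 0) : opA N L s ^ 2 = wtOp N L fun m => s ^ (2 * m) := by
  rw [opA, tensorOp_kHalfPow hs, sq, wtOp_mul]
  congr 1
  funext m
  rw [← zpow_add₀ hs]
  congr 1
  ring

theorem siteOp_diagonal (i : Fin L) (d : Fin N → ℂ) :
    siteOp i (Matrix.diagonal d) = Matrix.diagonal fun σ => d (σ i) := by
  have : siteOp i (Matrix.diagonal d) =
      tensorOp fun j => Matrix.diagonal fun a => if j = i then d a else 1 := by
    rw [siteOp]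
    congr 1
    funext j
    split_ifs
    · rfl
    · exact Matrix.diagonal_one.symm
  rw [this, tensorOp_diagonal]
  congr 1
  funext σ
  simp

theorem opH_eq_wtOp (n : ℕ) : opH N L n = wtOp N L fun m => (m : ℂ) / n := by
  ext σ τ
  simp only [opH, siteOp_diagonal, wtOp, Matrix.smul_apply, Matrix.sum_apply,
    Matrix.diagonal_apply, smul_eq_mul]
  split_ifs
  · rw [wt, div_eq_inv_mul]
    push_cast
    rfl
  · simp

theorem mem_sector_iff {v : Space N L} :
    v ∈ sector N L s ↔ (opA N L s ^ 2).mulVec v = v := by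
  rw [sector, Module.End.mem_eigenspace_iff, one_smul, Matrix.toLin'_apply]

/-- On weight `m` the operator `A²` is `s ^ (2 * m)`, which is `1` exactly when `2 * N ∣ 2 * m`. -/
theorem sectorWeight_mulVec (hs : IsPrimitiveRoot s (2 * N)) (hs0 : s ≠ 0) {v : Space N L}
    (hv : v ∈ sector N L s) : (wtOp N L (sectorWeight N)).mulVec v = v := by
  rw [mem_sector_iff, opA_sq_eq_wtOp hs0] at hv
  funext σ
  have h := congrFun hv σ
  rw [wtOp, Matrix.mulVec_diagonal] at h ⊢
  rcases eq_or_ne (v σ) 0 with h0 | h0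
  · rw [h0, mul_zero]
  · have h1 := (hs.zpow_eq_one_iff_dvd _).mp (mul_right_cancel₀ h0 (h.trans (one_mul _).symm))
    push_cast at h1
    rw [sectorWeight, if_pos (Int.dvd_of_mul_dvd_mul_left two_ne_zero h1), one_mul]

theorem exists_isRestriction {M : Op N L} (hM : Commute M (opA N L s ^ 2)) :
    ∃ T : Module.End ℂ (sector N L s), IsRestriction T M := by
  refine ⟨(Matrix.toLin' M).restrict fun v hv => ?_, fun v => ?_⟩
  · rw [mem_sector_iff] at hv ⊢
    rw [Matrix.toLin'_apply, Matrix.mulVec_mulVec, ← hM.eq, ← Matrix.mulVec_mulVec, hv]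
  · rw [LinearMap.coe_restrict_apply, Matrix.toLin'_apply]

theorem HasWeight.commute_opA_sq (hs : IsPrimitiveRoot s (2 * N)) (hs0 : s ≠ 0) {d : ℤ}
    {M : Op N L} (hM : HasWeight d M) (hd : (N : ℤ) ∣ d) : Commute M (opA N L s ^ 2) := by
  rw [opA_sq_eq_wtOp hs0]
  refine Eq.trans ?_ (hM _).symm
  congr 2
  funext m
  have h : s ^ (2 * d) = 1 := (hs.zpow_eq_one_iff_dvd _).mpr (by
    push_cast
    exact mul_dvd_mul_left 2 hd)
  rw [mul_add, zpow_add₀ hs0, h, mul_one]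

theorem commute_wtOp (g g' : ℤ → ℂ) : Commute (wtOp N L g) (wtOp N L g') :=
  Matrix.commute_diagonal _ _

namespace IsRestriction

variable {V : Submodule ℂ (Space N L)} {T T' : Module.End ℂ V} {M M' : Op N L}

theorem neg (h : IsRestriction T M) : IsRestriction (-T) (-M) := fun v => by
  rw [LinearMap.neg_apply, Submodule.coe_neg, h v, Matrix.neg_mulVec]

theorem smul (h : IsRestriction T M) (c : ℂ) : IsRestriction (c • T) (c • M) := fun v => by
  rw [LinearMap.smul_apply, Submodule.coe_smul, h v, Matrix.smul_mulVec]

theorem lie (h : IsRestriction T M) (h' : IsRestriction T' M') :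
    IsRestriction ⁅T, T'⁆ (M * M' - M' * M) := fun v => by
  change ((T (T' v) - T' (T v) : V) : Space N L) = _
  rw [Submodule.coe_sub, h, h', h', h, Matrix.sub_mulVec, Matrix.mulVec_mulVec,
    Matrix.mulVec_mulVec]

/-- The limit identities hold only after right multiplication by the projector to the sector; for
restrictions to the sector this is enough. -/
theorem eq_of_sector {T T' : Module.End ℂ (sector N L s)} (hs : IsPrimitiveRoot s (2 * N))
    (hs0 : s ≠ 0) (h : IsRestriction T M) (h' : IsRestriction T' M')
    (hM : M * wtOp N L (sectorWeight N) = M' * wtOp N L (sectorWeight N)) : T = T' := by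
  refine LinearMap.ext fun v => Subtype.ext ?_
  rw [h v, h' v, ← sectorWeight_mulVec hs hs0 v.2, Matrix.mulVec_mulVec, Matrix.mulVec_mulVec, hM]

end IsRestriction

theorem HasWeight.opH_commutator (hN : N ≠ 0) {n : ℤ} {M : Op N L} (hM : HasWeight (N * n) M) :
    opH N L N * M - M * opH N L N = (n : ℂ) • M := by
  have hN' : (N : ℂ) ≠ 0 := Nat.cast_ne_zero.mpr hN
  have h : (wtOp N L fun m => ((m + N * n : ℤ) : ℂ) / N) =
      (wtOp N L fun m => (m : ℂ) / N) + (n : ℂ) • 1 := by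
    rw [← wtOp_one, wtOp_smul, wtOp_add]
    congr 1
    funext m
    push_cast
    field_simp
  rw [opH_eq_wtOp, hM, h, mul_add, add_sub_cancel_left, mul_smul_comm, mul_one]

theorem lie_eq_smul_of_hasWeight (hs : IsPrimitiveRoot s (2 * N)) (hs0 : s ≠ 0) (hN : N ≠ 0)
    {n : ℤ} {M : Op N L} (hM : HasWeight (N * n) M) {H T : Module.End ℂ (sector N L s)}
    (hH : IsRestriction H (opH N L N)) (hT : IsRestriction T M) : ⁅H, T⁆ = (n : ℂ) • T :=
  (hH.lie hT).eq_of_sector hs hs0 (hT.smul _) (by rw [hM.opH_commutator hN])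

end Sector

/-- The loop algebra representation on the sector, for `N ≠ 1`. -/
theorem exists_loop_representation {N L : ℕ} {s : ℂ} (hN : Odd N) (hN1 : N ≠ 1) (hL : N ∣ L)
    (hs : IsPrimitiveRoot s (2 * N)) {Bp Bm Cp Cm : Op N L}
    (hBp : IsDividedPowerLimit (fun t => opB N L t 1) N s Bp)
    (hBm : IsDividedPowerLimit (fun t => opB N L t (-1)) N s Bm)
    (hCp : IsDividedPowerLimit (fun t => opC N L t 1) N s Cp)
    (hCm : IsDividedPowerLimit (fun t => opC N L t (-1)) N s Cm) :
    ∃ ρ : Loop →ₗ⁅ℂ⁆ Module.End ℂ (sector N L s),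
      IsRestriction (ρ (chevH 0)) (-opH N L N) ∧ IsRestriction (ρ (chevH 1)) (opH N L N) ∧
      IsRestriction (ρ (chevE 0)) Bp ∧ IsRestriction (ρ (chevE 1)) Cp ∧
      IsRestriction (ρ (chevF 0)) Cm ∧ IsRestriction (ρ (chevF 1)) Bm ∧
      ∀ z : ℂ, z ≠ 0 → ∃ T : Module.End ℂ (sector N L s),
        IsRestriction T (transferXXZ N L s z) ∧ ∀ x : Loop, ⁅T, ρ x⁆ = 0 := by
  have hs0 := ne_zero_of_primitive hN hs
  have hN0 : N ≠ 0 := hN.pos.ne'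
  have wBp := HasWeight.limit (fun t => hasWeight_opB (N := N) (L := L) (s := t) 1) hBp
  have wBm := HasWeight.limit (fun t => hasWeight_opB (N := N) (L := L) (s := t) (-1)) hBm
  have wCp := HasWeight.limit (fun t => hasWeight_opC (N := N) (L := L) (s := t) 1) hCp
  have wCm := HasWeight.limit (fun t => hasWeight_opC (N := N) (L := L) (s := t) (-1)) hCm
  obtain ⟨f', hf'⟩ := exists_isRestriction (wBp.commute_opA_sq hs hs0 (dvd_mul_right _ _))
  obtain ⟨f, hf⟩ := exists_isRestriction (wBm.commute_opA_sq hs hs0 (dvd_mul_right _ _))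
  obtain ⟨e, he⟩ := exists_isRestriction (wCp.commute_opA_sq hs hs0 (dvd_mul_right _ _))
  obtain ⟨e', he'⟩ := exists_isRestriction (wCm.commute_opA_sq hs hs0 (dvd_mul_right _ _))
  obtain ⟨H, hH⟩ := exists_isRestriction (s := s) (M := opH N L N) (by
    rw [opH_eq_wtOp, opA_sq_eq_wtOp hs0]; exact commute_wtOp _ _)
  have hT (z : ℂ) : ∃ T : Module.End ℂ (sector N L s), IsRestriction T (transferXXZ N L s z) :=
    exists_isRestriction ((transferXXZ_commute_opA hs0).pow_right 2)
  choose T hT using hT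
  have h0 : IsRestriction (0 : Module.End ℂ (sector N L s)) (0 : Op N L) := fun v => by simp
  have hEF : (Cp * Bm - Bm * Cp) * wtOp N L (sectorWeight N) =
      opH N L N * wtOp N L (sectorWeight N) := by
    rw [opH_eq_wtOp]
    exact IsDividedPowerLimit.commutator hN hN1 hs (ε := -1) (Or.inr rfl) hCp hBm
  have hEF' : (Cm * Bp - Bp * Cm) * wtOp N L (sectorWeight N) =
      opH N L N * wtOp N L (sectorWeight N) := by
    rw [opH_eq_wtOp]
    exact IsDividedPowerLimit.commutator hN hN1 hs (ε := 1) (Or.inl rfl) hCm hBp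
  -- The images of `t ⊗ h` and `t⁻¹ ⊗ h` are not prescribed beforehand; they are taken to be the
  -- mixed brackets.
  let C : ChevalleySystem H ⁅e, f'⁆ ⁅e', f⁆ :=
    { e := e
      f := f
      f' := f'
      e' := e'
      lie_e_f := (he.lie hf).eq_of_sector hs hs0 hH hEF
      lie_e'_f' := (he'.lie hf').eq_of_sector hs hs0 hH hEF'
      lie_e_e' := (he.lie he').eq_of_sector hs hs0 h0 (by
        rw [IsDividedPowerLimit.commute hN hs (fun t ht => opC_commute ht 1 (-1) rfl) hCp hCm,
          sub_self])
      lie_f_f' := (hf.lie hf').eq_of_sector hs hs0 h0 (by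
        rw [IsDividedPowerLimit.commute hN hs (fun t ht => opB_commute ht (-1) 1 (neg_neg 1).symm)
          hBm hBp, sub_self])
      lie_e_f' := rfl
      lie_e'_f := rfl
      lie_h_e := by simpa using lie_eq_smul_of_hasWeight hs hs0 hN0 wCp hH he
      lie_h_e' := by simpa using lie_eq_smul_of_hasWeight hs hs0 hN0 wCm hH he'
      lie_h_f := (lie_eq_smul_of_hasWeight hs hs0 hN0 wBm hH hf).trans
        (by push_cast; module)
      lie_h_f' := (lie_eq_smul_of_hasWeight hs hs0 hN0 wBp hH hf').trans
        (by push_cast; module) }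
  have hcomm {M : Op N L} {x : Module.End ℂ (sector N L s)} (hx : IsRestriction x M)
      (h : ∀ z : ℂ, z ≠ 0 → transferXXZ N L s z * M * wtOp N L (sectorWeight N) =
        M * transferXXZ N L s z * wtOp N L (sectorWeight N)) :
      ∀ y ∈ T '' {0}ᶜ, ⁅y, x⁆ = 0 := by
    rintro _ ⟨z, hz, rfl⟩
    exact ((hT z).lie hx).eq_of_sector hs hs0 h0 (by rw [sub_mul, h z hz, sub_self, zero_mul])
  obtain ⟨ρ, ⟨h1, h2, h3, h4, h5, h6⟩, h7⟩ := C.exists_loopHom_commuting (T '' {0}ᶜ)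
    (hcomm he fun z hz => hCp.transferXXZ_opC hN hN1 hL hs hz (Or.inl rfl))
    (hcomm hf fun z hz => hBm.transferXXZ_opB hN hN1 hL hs hz (Or.inr rfl))
    (hcomm hf' fun z hz => hBp.transferXXZ_opB hN hN1 hL hs hz (Or.inl rfl))
    (hcomm he' fun z hz => hCm.transferXXZ_opC hN hN1 hL hs hz (Or.inr rfl))
  refine ⟨ρ, ?_, ?_, ?_, ?_, ?_, ?_, fun z hz => ⟨T z, hT z, h7 _ ⟨z, hz, rfl⟩⟩⟩
  · rw [h1]; exact hH.neg
  · rw [h2]; exact hH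
  · rw [h3]; exact hf'
  · rw [h4]; exact he
  · rw [h5]; exact he'
  · rw [h6]; exact hf

/-! ### The degenerate case `N = 1`. -/

theorem chainOp_zero {N L : ℕ} (c : Fin L → ℂ) (u w : LocalOp N) : chainOp c u 0 w = 0 := by
  refine Finset.sum_eq_zero fun i _ => ?_
  rw [tensorOp_chainFactor_eq_tensorAt i u 0 0 w, map_zero, smul_zero]

theorem opB_one (L : ℕ) (s : ℂ) (ε : ℤ) : opB 1 L s ε = 0 := by
  have : fOp 1 s = 0 := by ext a b; fin_cases a; fin_cases b; simp [fOp]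
  rw [opB_eq_chainOp, this, chainOp_zero]

theorem opC_one (L : ℕ) (s : ℂ) (ε : ℤ) : opC 1 L s ε = 0 := by
  have : eOp 1 s = 0 := by ext a b; fin_cases a; fin_cases b; simp [eOp]
  rw [opC_eq_chainOp, this, chainOp_zero]

theorem opH_one (L : ℕ) : opH 1 L 1 = 0 := by
  rw [opH_eq_wtOp, ← wtOp_zero]
  ext σ τ
  have (σ : Fin L → Fin 1) : wt σ = 0 := Finset.sum_eq_zero fun i _ => by simp
  simp [wtOp, this]

end NBS

end

theorem proposition1 (N L : ℕ) (hN : Odd N) (hL : N ∣ L)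
    (s : ℂ) (hs : IsPrimitiveRoot s (2 * N)) :
    -- `A`, `B_±`, `C_±` are the asymptotic entries of the monodromy matrix
    (∀ t : ℂ, t ≠ 0 →
      Tendsto (fun z : ℂ => (z ^ L * (t ^ L)⁻¹)⁻¹ • NBS.monodromyXXZ N L t z 0 0)
        (Bornology.cobounded ℂ) (𝓝 (NBS.opA N L t))) ∧
    (∀ t : ℂ, t ≠ 0 → (t ^ 2) ^ 2 ≠ 1 →
      Tendsto (fun z : ℂ => (NBS.normFactor L t 1 z)⁻¹ • NBS.monodromyXXZ N L t z 0 1)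
        (Bornology.cobounded ℂ) (𝓝 (NBS.opB N L t 1)) ∧
      Tendsto (fun z : ℂ => (NBS.normFactor L t (-1) z)⁻¹ • NBS.monodromyXXZ N L t z 0 1)
        (𝓝[≠] 0) (𝓝 (NBS.opB N L t (-1))) ∧
      Tendsto (fun z : ℂ => (NBS.normFactor L t 1 z)⁻¹ • NBS.monodromyXXZ N L t z 1 0)
        (Bornology.cobounded ℂ) (𝓝 (NBS.opC N L t 1)) ∧
      Tendsto (fun z : ℂ => (NBS.normFactor L t (-1) z)⁻¹ • NBS.monodromyXXZ N L t z 1 0)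
        (𝓝[≠] 0) (𝓝 (NBS.opC N L t (-1)))) ∧
    -- the limits `B_±^{(N)}`, `C_±^{(N)}` exist
    ∃ Bp Bm Cp Cm : NBS.Op N L,
      NBS.IsDividedPowerLimit (fun t => NBS.opB N L t 1) N s Bp ∧
      NBS.IsDividedPowerLimit (fun t => NBS.opB N L t (-1)) N s Bm ∧
      NBS.IsDividedPowerLimit (fun t => NBS.opC N L t 1) N s Cp ∧
      NBS.IsDividedPowerLimit (fun t => NBS.opC N L t (-1)) N s Cm ∧
      -- they give a representation of the loop algebra on the sector `A² = 1`
      ∃ ρ : NBS.Loop →ₗ⁅ℂ⁆ Module.End ℂ (NBS.sector N L s),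
        NBS.IsRestriction (ρ (NBS.chevH 0)) (-NBS.opH N L N) ∧
        NBS.IsRestriction (ρ (NBS.chevH 1)) (NBS.opH N L N) ∧
        NBS.IsRestriction (ρ (NBS.chevE 0)) Bp ∧
        NBS.IsRestriction (ρ (NBS.chevE 1)) Cp ∧
        NBS.IsRestriction (ρ (NBS.chevF 0)) Cm ∧
        NBS.IsRestriction (ρ (NBS.chevF 1)) Bm ∧
        -- which commutes with the transfer matrix
        ∀ z : ℂ, z ≠ 0 →
          ∃ T : Module.End ℂ (NBS.sector N L s),
            NBS.IsRestriction T (NBS.tauNBS N L (s ^ 2) z) ∧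
            ∀ x : NBS.Loop, ⁅T, ρ x⁆ = 0 := by
  have hs0 := NBS.ne_zero_of_primitive hN hs
  have hp {t : ℂ} (ht : t ≠ 0) (ht' : (t ^ 2) ^ 2 ≠ 1) : t ^ 2 - (t ^ 2)⁻¹ ≠ 0 := fun h => by
    refine ht' ?_
    have := pow_ne_zero 2 ht
    field_simp at h
    linear_combination h
  have hy1 : Tendsto (fun z : ℂ => (((1 : ℤ) : ℂ) * z ^ (1 : ℤ))⁻¹) (Bornology.cobounded ℂ)
      (𝓝 0) := by simpa using tendsto_inv₀_cobounded
  have hy2 : Tendsto (fun z : ℂ => (((-1 : ℤ) : ℂ) * z ^ (-1 : ℤ))⁻¹) (𝓝[≠] 0) (𝓝 0) := by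
    have : Tendsto (fun z : ℂ => -z) (𝓝[≠] 0) (𝓝 0) := by
      simpa using (tendsto_id (α := ℂ) (x := 𝓝 0)).neg.mono_left nhdsWithin_le_nhds
    simpa [inv_neg] using this
  have hz1 : ∀ᶠ z in Bornology.cobounded ℂ, z ≠ 0 := Bornology.eventually_ne_cobounded 0
  have hz2 : ∀ᶠ z in 𝓝[≠] (0 : ℂ), z ≠ 0 := eventually_mem_nhdsWithin
  refine ⟨fun t ht => NBS.tendsto_opA ht, fun t ht ht' =>
    ⟨NBS.tendsto_opB ht (hp ht ht') (Or.inl rfl) hz1 hy1,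
      NBS.tendsto_opB ht (hp ht ht') (Or.inr rfl) hz2 hy2,
      NBS.tendsto_opC ht (hp ht ht') (Or.inl rfl) hz1 hy1,
      NBS.tendsto_opC ht (hp ht ht') (Or.inr rfl) hz2 hy2⟩, ?_⟩
  have htau (z : ℂ) : NBS.tauNBS N L (s ^ 2) z = NBS.transferXXZ N L s z := by
    rw [NBS.tauNBS, ← NBS.localXXZ_eq_localNBS hN hs]
    rfl
  simp only [htau]
  -- For `N = 1` one has `q = 1`, so `q - q⁻¹ = 0` and the limit arguments fail. But `e = f = 0` and
  -- all weights vanish on a one-dimensional factor, so the zero representation serves.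
  by_cases hN1 : N = 1
  · subst hN1
    have h0 : NBS.IsRestriction (0 : Module.End ℂ (NBS.sector 1 L s)) 0 := fun v => by simp
    have hlim {X : ℂ → NBS.Op 1 L} (hX : ∀ t, X t = 0) : NBS.IsDividedPowerLimit X 1 s 0 := by
      simp only [NBS.IsDividedPowerLimit, hX, pow_one, smul_zero]
      exact tendsto_const_nhds
    refine ⟨0, 0, 0, 0, hlim fun t => NBS.opB_one L t 1, hlim fun t => NBS.opB_one L t (-1),
      hlim fun t => NBS.opC_one L t 1, hlim fun t => NBS.opC_one L t (-1), 0, ?_⟩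
    rw [NBS.opH_one, neg_zero]
    refine ⟨h0, h0, h0, h0, h0, h0, fun z _ => ?_⟩
    obtain ⟨T, hT⟩ := NBS.exists_isRestriction (s := s)
      ((NBS.transferXXZ_commute_opA (N := 1) (L := L) (z := z) hs0).pow_right 2)
    refine ⟨T, hT, fun x => LinearMap.ext fun v => ?_⟩
    change T ((0 : Module.End ℂ (NBS.sector 1 L s)) v) - (0 : Module.End ℂ _) (T v) = 0
    simp
  · have hs1 := NBS.sq_sub_inv_ne_zero hN hN1 hs
    obtain ⟨Bp, hBp⟩ := NBS.exists_isDividedPowerLimit hN hN1 hs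
      (NBS.entriesDifferentiableAt_opB (L := L) hs0 hs1 1) (NBS.opB_pow_eq_zero hN hs (Or.inl rfl))
    obtain ⟨Bm, hBm⟩ := NBS.exists_isDividedPowerLimit hN hN1 hs
      (NBS.entriesDifferentiableAt_opB (L := L) hs0 hs1 (-1))
      (NBS.opB_pow_eq_zero hN hs (Or.inr rfl))
    obtain ⟨Cp, hCp⟩ := NBS.exists_isDividedPowerLimit hN hN1 hs
      (NBS.entriesDifferentiableAt_opC (L := L) hs0 hs1 1) (NBS.opC_pow_eq_zero hN hs (Or.inl rfl))
    obtain ⟨Cm, hCm⟩ := NBS.exists_isDividedPowerLimit hN hN1 hs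
      (NBS.entriesDifferentiableAt_opC (L := L) hs0 hs1 (-1))
      (NBS.opC_pow_eq_zero hN hs (Or.inr rfl))
    exact ⟨Bp, Bm, Cp, Cm, hBp, hBm, hCp, hCm,
      NBS.exists_loop_representation hN hN1 hL hs hBp hBm hCp hCm⟩
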